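/- Let $F$ be a nonarchimedean local field of characteristic $0$ and odd residue characteristic, $E/F$ the unramified quadratic extension with $\mathrm{Gal}(E/F)=\langle\theta\rangle$, $\bar F$ an algebraic closure of $F$, $\varpi$ a uniformizer of $F$, and $\xi\in\mathcal O_E^\times$ a unit with $\mathrm{Tr}_{E/F}(\xi)=0$. Let $J$ be the antidiagonal $3\times 3$ permutation matrix and $\sigma(g)=Jg^{-t}J^{-1}$. Write $\bar g$ for the effect of $\theta$ on $E\otimes_F R$ applied to the entries. For $F$-algebras $R$ put $$G(R)=\{g\in \mathrm{GL}_3(E\otimes_F R): J\bar g^{-t}J^{-1}=g\},\qquad \mathcal S(R)=\{g\in G(R): g=\sigma(g)^{-1}\},$$ $$G_1(R)=\mathrm{SO}_3(R)=\{g\in\mathrm{GL}_3(R):\sigma(g)=g,\ \det g=1\}.$$ The group $G_1$ acts on $\mathcal S$ by $g^{-1}\gamma g$. Let $G_\gamma$ be the centralizer of $\gamma$ in $G$ and $G_{1\gamma}=G_1\cap G_\gamma$. For $\gamma\in\mathcal S(F)$ let $[\gamma]_{\rm st}$ be the set of elements of $\mathcal S(F)$ in the $G_1(\bar F)$-orbit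 of $\gamma$ (the stable orbit), and let its rational orbit be its $G_1(F)$-orbit. Put $\mathfrak D(F,G_{1\gamma},G_1)=\ker[H^1(F,G_{1\gamma})\to H^1(F,G_1)]$. For nonzero $\nu\in F$ let $$T_\nu(F)=\left\{\begin{pmatrix}x&0&y\\0&z&0\\ \nu y&0&x\end{pmatrix}\in G(F): x,y,z\in E\right\}.$$ Write $\mathrm U_{1,L/K}$ for the norm-one group of a quadratic extension $L/K$. A torus over $F$ is of type - I if it is isomorphic to $\mathrm{Res}_{E/F}\mathbb G_m\times \mathrm U_{1,E/F}$; - II if it is isomorphic to $\mathrm U_{1,E/F}\times\mathrm U_{1,E/F}\times\mathrm U_{1,E/F}$; - III if it is isomorphic to $\mathrm{Res}_{K/F}\mathrm U_{1,EK/K}\times \mathrm U_{1,E/F}$ for some quadratic extension $K/F$ with $K\not\cong E$; - IV if it is isomorphic to $\mathrm{Res}_{K/F}\mathrm U_{1,EK/K}$ for some cubic extension $K/F$. Let $\gamma\in\mathcal S(F)$ be regular semisimple as an element of $G(F)$ (that is, with pairwise distinct eigenvalues). (1) If $G_\gamma$ is of type I, II or III, then $[\gamma]_{\rm st}$ meets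 $T_\nu(F)$ for some $\nu\in\{1,\xi^2,\varpi,\xi^2\varpi\}$. (2) The Galois cohomology of the commutative group $G_{1\gamma}$ is $$H^1(F,G_{1\gamma})\cong\begin{cases}(\mathbb Z/2\mathbb Z)^2&\text{if }G_\gamma\text{ is of type I},\\(\mathbb Z/2\mathbb Z)^4&\text{if }G_\gamma\text{ is of type II},\\(\mathbb Z/2\mathbb Z)^2&\text{if }G_\gamma\text{ is of type III},\\0&\text{if }G_\gamma\text{ is of type IV}.\end{cases}$$ (3) If $G_\gamma$ is of type IV, then $\mathfrak D(F,G_{1\gamma},G_1)=0$ and $[\gamma]_{\rm st}$ is the rational orbit of $\gamma$. -/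

import Mathlib

open scoped Matrix
open scoped TensorProduct ValuativeRel

universe u

noncomputable section

namespace SymmSpace

/-! ### The involutions of `GL₃` -/

section Ring

variable {A B : Type*} [CommRing A] [CommRing B]

/-- The antidiagonal matrix `J₃`. -/
def J (A : Type*) [CommRing A] : GL (Fin 3) A where
  val := !![0, 0, 1; 0, 1, 0; 1, 0, 0]
  inv := !![0, 0, 1; 0, 1, 0; 1, 0, 0]
  val_inv := by ext i j; fin_cases i <;> fin_cases j <;> simp [Matrix.mul_apply, Fin.sum_univ_three]
  inv_val := by ext i j; fin_cases i <;> fin_cases j <;> simp [Matrix.mul_apply, Fin.sum_univ_three]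

/-- The inverse transpose `g ↦ g⁻ᵗ`. -/
def invTranspose (A : Type*) [CommRing A] : GL (Fin 3) A →* GL (Fin 3) A where
  toFun g :=
    { val := (g⁻¹).valᵀ
      inv := g.valᵀ
      val_inv := by rw [← Matrix.transpose_mul, ← Units.val_mul, mul_inv_cancel]; simp
      inv_val := by rw [← Matrix.transpose_mul, ← Units.val_mul, inv_mul_cancel]; simp }
  map_one' := by ext1; simp
  map_mul' g h := by ext1; simp [mul_inv_rev]

/-- The involution `σ(g) = J g⁻ᵗ J⁻¹`. -/
def sigma (A : Type*) [CommRing A] : GL (Fin 3) A →* GL (Fin 3) A :=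
  (MulAut.conj (J A)).toMonoidHom.comp (invTranspose A)

lemma map_J (f : A →+* B) : Matrix.GeneralLinearGroup.map f (J A) = J B := by
  ext i j; fin_cases i <;> fin_cases j <;> simp [J, Matrix.GeneralLinearGroup.map]

lemma map_invTranspose (f : A →+* B) (g : GL (Fin 3) A) :
    Matrix.GeneralLinearGroup.map f (invTranspose A g) =
      invTranspose B (Matrix.GeneralLinearGroup.map f g) := by
  have : Matrix.GeneralLinearGroup.map f g⁻¹ = (Matrix.GeneralLinearGroup.map f g)⁻¹ := map_inv _ _
  ext i j
  simp only [invTranspose, MonoidHom.coe_mk, OneHom.coe_mk, ← this]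
  simp [Matrix.GeneralLinearGroup.map]

lemma map_sigma (f : A →+* B) (g : GL (Fin 3) A) :
    Matrix.GeneralLinearGroup.map f (sigma A g) =
      sigma B (Matrix.GeneralLinearGroup.map f g) := by
  simp [sigma, map_J, map_invTranspose]

/-- The elements `g` of `GL₃(A)` with `J ḡ⁻ᵗ J⁻¹ = g`, where the bar is a given ring
endomorphism `c` of `A`. -/
def unitary (c : A →+* A) : Subgroup (GL (Fin 3) A) where
  carrier := {g | sigma A (Matrix.GeneralLinearGroup.map c g) = g}
  mul_mem' {a b} ha hb := by
    simp only [Set.mem_ofPred_eq, map_mul] at *; rw [ha, hb]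
  one_mem' := by simp
  inv_mem' {a} ha := by
    simp only [Set.mem_ofPred_eq, map_inv] at *; rw [ha]

/-- The symmetric space: the elements `g` of the unitary group with `g = σ(g)⁻¹`. -/
def symm (c : A →+* A) : Set (GL (Fin 3) A) :=
  {g | g ∈ unitary c ∧ g = (sigma A g)⁻¹}

/-- The special orthogonal group `SO₃(A) = {g | σ(g) = g, det g = 1}`. -/
def specialOrthogonal (A : Type*) [CommRing A] : Subgroup (GL (Fin 3) A) where
  carrier := {g | sigma A g = g ∧ Matrix.GeneralLinearGroup.det g = 1}
  mul_mem' {a b} ha hb := by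
    simp only [Set.mem_ofPred_eq, map_mul] at *; rw [ha.1, ha.2, hb.1, hb.2]; simp
  one_mem' := by simp
  inv_mem' {a} ha := by
    simp only [Set.mem_ofPred_eq, map_inv] at *; rw [ha.1, ha.2]; simp

/-- A matrix in `GL₃` of a field is regular semisimple if its eigenvalues in an algebraic closure
are pairwise distinct. -/
def IsRegularSemisimple {K : Type*} [Field K] (g : GL (Fin 3) K) : Prop :=
  g.val.charpoly.Separable

end Ring

/-! ### Algebraic groups over `F`, given by their functors of points -/

section Functors

variable {F : Type u} [Field F] {E : Type u} [Field E] [Algebra F E]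

/-- The ring homomorphism `K ⊗ R → K ⊗ S` induced by `R → S`. -/
abbrev tensorMap (K : Type u) [CommRing K] [Algebra F K] {R S : Type u} [CommRing R] [Algebra F R]
    [CommRing S] [Algebra F S] (f : R →ₐ[F] S) : K ⊗[F] R →ₐ[F] K ⊗[F] S :=
  Algebra.TensorProduct.map (AlgHom.id F K) f

/-- The involution `θ ⊗ id` of `E ⊗ R`. -/
def conj (θ : E ≃ₐ[F] E) (R : Type u) [CommRing R] [Algebra F R] : E ⊗[F] R →ₐ[F] E ⊗[F] R :=
  Algebra.TensorProduct.map (θ : E →ₐ[F] E) (AlgHom.id F R)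

/-- The image in `GL₃(E ⊗ R)` of a matrix with entries in `E`. -/
def baseChange (R : Type u) [CommRing R] [Algebra F R] : GL (Fin 3) E →* GL (Fin 3) (E ⊗[F] R) :=
  Matrix.GeneralLinearGroup.map
    (Algebra.TensorProduct.includeLeft : E →ₐ[F] E ⊗[F] R).toRingHom

variable (F E) in
/-- The embedding `GL₃(R) → GL₃(E ⊗ R)`. -/
def embed (R : Type u) [CommRing R] [Algebra F R] : GL (Fin 3) R →* GL (Fin 3) (E ⊗[F] R) :=
  Matrix.GeneralLinearGroup.map
    (Algebra.TensorProduct.includeRight : R →ₐ[F] E ⊗[F] R).toRingHom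

/-- The group `U_{1,E/F}` of elements of norm one: `U_{1,E/F}(R) = {x ∈ (E ⊗ R)ˣ | x x̄ = 1}`. -/
def U1 (θ : E ≃ₐ[F] E) (R : Type u) [CommRing R] [Algebra F R] : Subgroup (E ⊗[F] R)ˣ where
  carrier := {x | x * Units.map (conj θ R).toMonoidHom x = 1}
  mul_mem' {a b} ha hb := by
    simp only [Set.mem_ofPred_eq, map_mul] at *
    rw [mul_mul_mul_comm, ha, hb, one_mul]
  one_mem' := by simp
  inv_mem' {a} ha := by
    simp only [Set.mem_ofPred_eq, map_inv] at *
    rw [← mul_inv, ha, inv_one]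

/-- The unitary group `G = U₃`, with `G(R) = {g ∈ GL₃(E ⊗ R) | J ḡ⁻ᵗ J⁻¹ = g}`. -/
def U3 (θ : E ≃ₐ[F] E) (R : Type u) [CommRing R] [Algebra F R] :
    Subgroup (GL (Fin 3) (E ⊗[F] R)) :=
  unitary (conj θ R).toRingHom

/-- The centralizer `G_γ` in `G` of `γ ∈ GL₃(E)`. -/
def centralizer (θ : E ≃ₐ[F] E) (γ : GL (Fin 3) E) (R : Type u) [CommRing R] [Algebra F R] :
    Subgroup (GL (Fin 3) (E ⊗[F] R)) :=
  U3 θ R ⊓ Subgroup.centralizer {baseChange R γ}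

variable (F) in
/-- The stabilizer `G_{1γ} = G₁ ∩ G_γ` of `γ ∈ GL₃(E)` in `G₁ = SO₃`. -/
def stabilizer (γ : GL (Fin 3) E) (R : Type u) [CommRing R] [Algebra F R] :
    Subgroup (GL (Fin 3) R) :=
  specialOrthogonal R ⊓ (Subgroup.centralizer {baseChange R γ}).comap (embed F E R)

/-! Functoriality in `R` -/

variable {R S : Type u} [CommRing R] [Algebra F R] [CommRing S] [Algebra F S]

lemma conj_tensorMap (θ : E ≃ₐ[F] E) (f : R →ₐ[F] S) :
    (conj θ S).comp (tensorMap E f) = (tensorMap E f).comp (conj θ R) := by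
  refine Algebra.TensorProduct.ext (by ext; simp [conj]) (by ext; simp [conj])

lemma map_baseChange (f : R →ₐ[F] S) (g : GL (Fin 3) E) :
    Matrix.GeneralLinearGroup.map (tensorMap E f).toRingHom (baseChange R g) =
      baseChange S g := by
  ext i j; simp [baseChange, Matrix.GeneralLinearGroup.map]

lemma map_embed (f : R →ₐ[F] S) (g : GL (Fin 3) R) :
    Matrix.GeneralLinearGroup.map (tensorMap E f).toRingHom (embed F E R g) =
      embed F E S (Matrix.GeneralLinearGroup.map f.toRingHom g) := by
  ext i j; simp [embed, Matrix.GeneralLinearGroup.map]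

/-- The map `U_{1,E/F}(R) → U_{1,E/F}(S)` induced by `R → S`. -/
def U1Map (θ : E ≃ₐ[F] E) (f : R →ₐ[F] S) : U1 θ R →* U1 θ S :=
  ((Units.map (tensorMap E f).toMonoidHom).comp (U1 θ R).subtype).codRestrict (U1 θ S)
    fun x => by
      have h := congrArg (Units.map (tensorMap E f).toMonoidHom) x.2
      rw [map_mul, map_one] at h
      refine Eq.trans (congrArg₂ _ rfl ?_) h
      ext
      exact DFunLike.congr_fun (conj_tensorMap θ f) (x.1.val)

/-- The map `G_γ(R) → G_γ(S)` induced by `R → S`. -/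
def centralizerMap (θ : E ≃ₐ[F] E) (γ : GL (Fin 3) E) (f : R →ₐ[F] S) :
    centralizer θ γ R →* centralizer θ γ S :=
  ((Matrix.GeneralLinearGroup.map (tensorMap E f).toRingHom).comp
    (centralizer θ γ R).subtype).codRestrict (centralizer θ γ S)
    fun x => by
      obtain ⟨x, hx, hc⟩ := x
      refine ⟨?_, ?_⟩
      · change sigma _ (Matrix.GeneralLinearGroup.map _
          (Matrix.GeneralLinearGroup.map (tensorMap E f).toRingHom x)) =
          Matrix.GeneralLinearGroup.map (tensorMap E f).toRingHom x
        have hx' : sigma _ (Matrix.GeneralLinearGroup.map (conj θ R).toRingHom x) = x := hx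
        conv_rhs => rw [← hx', map_sigma]
        congr 1
        ext i j
        exact DFunLike.congr_fun (conj_tensorMap θ f) _
      · change _ ∈ Subgroup.centralizer _
        have hc' := Subgroup.mem_centralizer_singleton_iff.1 hc
        rw [Subgroup.mem_centralizer_singleton_iff]
        have h := congrArg (Matrix.GeneralLinearGroup.map (tensorMap E f).toRingHom) hc'
        rw [map_mul, map_mul, map_baseChange] at h
        exact h

lemma map_mem_specialOrthogonal (f : R →ₐ[F] S) {g : GL (Fin 3) R}
    (hg : g ∈ specialOrthogonal R) :
    Matrix.GeneralLinearGroup.map f.toRingHom g ∈ specialOrthogonal S := by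
  refine ⟨?_, ?_⟩
  · rw [← map_sigma, hg.1]
  · have h := hg.2
    rw [Units.ext_iff, Matrix.GeneralLinearGroup.val_det_apply] at h ⊢
    change (f.toRingHom.mapMatrix g.val).det = 1
    rw [← RingHom.map_det, h]
    simp

lemma map_mem_stabilizer (γ : GL (Fin 3) E) (f : R →ₐ[F] S) {g : GL (Fin 3) R}
    (hg : g ∈ stabilizer F γ R) :
    Matrix.GeneralLinearGroup.map f.toRingHom g ∈ stabilizer F γ S := by
  refine ⟨map_mem_specialOrthogonal f hg.1, ?_⟩
  have hc' := Subgroup.mem_centralizer_singleton_iff.1 hg.2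
  change _ ∈ Subgroup.centralizer _
  rw [Subgroup.mem_centralizer_singleton_iff]
  have h := congrArg (Matrix.GeneralLinearGroup.map (tensorMap E f).toRingHom) hc'
  rw [map_mul, map_mul, map_baseChange, map_embed] at h
  exact h

end Functors

/-! ### Galois cohomology -/

section Cohomology

variable (Γ : Type*) [Group Γ] [TopologicalSpace Γ]
variable (A : Type*) [Group A] [MulDistribMulAction Γ A]
variable {B : Type*} [Group B] [MulDistribMulAction Γ B]

/-- Continuous 1-cocycles of a topological group `Γ` in a discrete group `A`:
`a(st) = a(s) · s(a(t))`. -/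
structure Cocycle where
  toFun : Γ → A
  locallyConstant : IsLocallyConstant toFun
  map_mul : ∀ s t, toFun (s * t) = toFun s * s • toFun t

/-- Two cocycles are cohomologous if `b(s) = g⁻¹ · a(s) · s(g)` for some `g`. -/
def cohomologous : Setoid (Cocycle Γ A) where
  r a b := ∃ g : A, ∀ s, b.toFun s = g⁻¹ * a.toFun s * s • g
  iseqv :=
    { refl := fun a => ⟨1, fun s => by simp⟩
      symm := fun {a b} ⟨g, h⟩ => ⟨g⁻¹, fun s => by simp [h, mul_assoc]⟩
      trans := fun {a b c} ⟨g, h⟩ ⟨k, h'⟩ => ⟨g * k, fun s => by simp [h, h', mul_assoc]⟩ }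

/-- The pointed set `H¹(Γ, A)`. -/
def H1 : Type _ := Quotient (cohomologous Γ A)

/-- The neutral element of `H¹(Γ, A)`. -/
instance : One (H1 Γ A) where
  one := Quotient.mk _ ⟨fun _ => 1, IsLocallyConstant.const 1, fun s t => by simp⟩

/-- If `A` is commutative, cohomology classes are multiplied by multiplying cocycles pointwise. -/
instance [IsMulCommutative A] : Mul (H1 Γ A) where
  mul := Quotient.map₂
    (fun a b => ⟨fun s => a.toFun s * b.toFun s, a.locallyConstant.mul b.locallyConstant,
      fun s t => by
        rw [a.map_mul, b.map_mul, smul_mul', mul_assoc, mul_assoc,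
          ← mul_assoc (s • (a.toFun t)), ← mul_assoc (b.toFun s),
          mul_comm' (s • (a.toFun t)) (b.toFun s)]⟩)
    (by
      rintro a a' ⟨g, hg⟩ b b' ⟨k, hk⟩
      refine ⟨g * k, fun s => ?_⟩
      simp only [hg, hk, smul_mul', mul_inv_rev]
      have e : ∀ x y : A, x * y = y * x := mul_comm'
      have e' : ∀ x y z : A, x * (y * z) = y * (x * z) := fun x y z => by
        rw [← mul_assoc, e x y, mul_assoc]
      simp only [mul_assoc, e, e'])

/-- `A` is commutative and `H¹(Γ, A) ≅ (ℤ/2ℤ)ᵏ` as groups. -/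
def H1IsElementaryTwo (k : ℕ) : Prop :=
  ∃ _ : IsMulCommutative A, Nonempty (H1 Γ A ≃* Multiplicative (Fin k → ZMod 2))

variable {A} in
/-- The map on `H¹` induced by an equivariant homomorphism. -/
def H1.map (φ : A →* B) (hφ : ∀ (s : Γ) (a : A), φ (s • a) = s • φ a) : H1 Γ A → H1 Γ B :=
  Quotient.map
    (fun a => ⟨fun s => φ (a.toFun s), a.locallyConstant.comp _, fun s t => by
      rw [a.map_mul, _root_.map_mul, hφ]⟩)
    (by
      rintro a b ⟨g, hg⟩
      refine ⟨φ g, fun s => ?_⟩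
      simp only [hg, _root_.map_mul, map_inv, hφ])

end Cohomology

section GaloisAction

variable {F : Type u} [Field F] {E : Type u} [Field E] [Algebra F E]
variable (Fbar : Type u) [Field Fbar] [Algebra F Fbar]

/-- The Galois group acts on `G₁(F̄)` entrywise. -/
instance : MulDistribMulAction (Fbar ≃ₐ[F] Fbar) (specialOrthogonal Fbar) where
  smul s g := ⟨Matrix.GeneralLinearGroup.map (s : Fbar →ₐ[F] Fbar).toRingHom g,
    map_mem_specialOrthogonal _ g.2⟩
  one_smul _ := rfl
  mul_smul _ _ _ := rfl
  smul_one _ := Subtype.ext (map_one _)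
  smul_mul _ _ _ := Subtype.ext (map_mul _ _ _)

/-- The Galois group acts on `G_{1γ}(F̄)` entrywise. -/
instance (γ : GL (Fin 3) E) : MulDistribMulAction (Fbar ≃ₐ[F] Fbar) (stabilizer F γ Fbar) where
  smul s g := ⟨Matrix.GeneralLinearGroup.map (s : Fbar →ₐ[F] Fbar).toRingHom g,
    map_mem_stabilizer γ _ g.2⟩
  one_smul _ := rfl
  mul_smul _ _ _ := rfl
  smul_one _ := Subtype.ext (map_one _)
  smul_mul _ _ _ := Subtype.ext (map_mul _ _ _)

/-- The inclusion `G_{1γ}(F̄) → G₁(F̄)`. -/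
def stabilizerInclusion (γ : GL (Fin 3) E) : stabilizer F γ Fbar →* specialOrthogonal Fbar :=
  Subgroup.inclusion inf_le_left

/-- `𝔇(F, G_{1γ}, G₁) = ker[H¹(F, G_{1γ}) → H¹(F, G₁)]`. -/
def frakD (γ : GL (Fin 3) E) : Set (H1 (Fbar ≃ₐ[F] Fbar) (stabilizer F γ Fbar)) :=
  {x | H1.map (Fbar ≃ₐ[F] Fbar) (stabilizerInclusion Fbar γ) (fun _ _ => rfl) x = 1}

end GaloisAction

/-! ### Orbits, tori and their types -/

section Orbits

variable {F E : Type u} [Field F] [Field E] [Algebra F E] (θ : E ≃ₐ[F] E)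

/-- The set `𝒮(F)`. -/
abbrev symmPoints : Set (GL (Fin 3) E) := symm (θ : E →+* E)

/-- The rational orbit of `γ`: the elements of `𝒮(F)` of the form `g⁻¹ γ g`, `g ∈ G₁(F)`. -/
def rationalOrbit (γ : GL (Fin 3) E) : Set (GL (Fin 3) E) :=
  {γ' | γ' ∈ symmPoints θ ∧ ∃ g ∈ specialOrthogonal F,
    (Matrix.GeneralLinearGroup.map (algebraMap F E) g)⁻¹ * γ *
      Matrix.GeneralLinearGroup.map (algebraMap F E) g = γ'}

/-- The stable class `[γ]_st`: the elements of `𝒮(F)` of the form `g⁻¹ γ g` with `g ∈ G₁(F̄)`,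
the product being taken in `GL₃(E ⊗ F̄)`. -/
def stableClass (Fbar : Type u) [Field Fbar] [Algebra F Fbar] (γ : GL (Fin 3) E) :
    Set (GL (Fin 3) E) :=
  {γ' | γ' ∈ symmPoints θ ∧ ∃ g ∈ specialOrthogonal Fbar,
    (embed F E Fbar g)⁻¹ * baseChange Fbar γ * embed F E Fbar g = baseChange Fbar γ'}

/-- The set `T_ν(F)`, for nonzero `ν` in (the image of) `F`. For such `ν` the group of all matrices
of this shape in `G` is connected, so it is its own neutral component. -/
def T (ν : E) : Set (GL (Fin 3) E) :=
  {g | g ∈ unitary (θ : E →+* E) ∧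
    ∃ x y z : E, g.val = !![x, 0, y; 0, z, 0; ν * y, 0, x]}

/-! The four types of maximal tori. An isomorphism of algebraic groups over `F` is a family of
isomorphisms of the groups of `R`-points, natural in the commutative `F`-algebra `R`. -/

/-- Type I: `G_γ ≅ Res_{E/F} 𝔾_m × U_{1,E/F}`. -/
def IsTypeI (γ : GL (Fin 3) E) : Prop :=
  ∃ e : ∀ (R : Type u) [CommRing R] [Algebra F R],
      centralizer θ γ R ≃* (E ⊗[F] R)ˣ × U1 θ R,
    ∀ (R S : Type u) [CommRing R] [Algebra F R] [CommRing S] [Algebra F S] (f : R →ₐ[F] S)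
      (g : centralizer θ γ R),
      e S (centralizerMap θ γ f g) =
        (Units.map (tensorMap E f).toMonoidHom (e R g).1, U1Map θ f (e R g).2)

/-- Type II: `G_γ ≅ U_{1,E/F} × U_{1,E/F} × U_{1,E/F}`. -/
def IsTypeII (γ : GL (Fin 3) E) : Prop :=
  ∃ e : ∀ (R : Type u) [CommRing R] [Algebra F R],
      centralizer θ γ R ≃* U1 θ R × U1 θ R × U1 θ R,
    ∀ (R S : Type u) [CommRing R] [Algebra F R] [CommRing S] [Algebra F S] (f : R →ₐ[F] S)
      (g : centralizer θ γ R),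
      e S (centralizerMap θ γ f g) =
        (U1Map θ f (e R g).1, U1Map θ f (e R g).2.1, U1Map θ f (e R g).2.2)

/-- Type III: `G_γ ≅ Res_{K/F} U_{1,EK/K} × U_{1,E/F}` for a quadratic extension `K/F` not
isomorphic to `E`. Here `EK = E ⊗ K`, so `U_{1,EK/K}` is the base change of `U_{1,E/F}` to `K` and
the group of `R`-points of its restriction of scalars is `U_{1,E/F}(K ⊗ R)`. -/
def IsTypeIII (γ : GL (Fin 3) E) : Prop :=
  ∃ (K : Type u) (_ : Field K) (_ : Algebra F K),
    Module.finrank F K = 2 ∧ IsEmpty (K ≃ₐ[F] E) ∧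
    ∃ e : ∀ (R : Type u) [CommRing R] [Algebra F R],
        centralizer θ γ R ≃* U1 θ (K ⊗[F] R) × U1 θ R,
      ∀ (R S : Type u) [CommRing R] [Algebra F R] [CommRing S] [Algebra F S] (f : R →ₐ[F] S)
        (g : centralizer θ γ R),
        e S (centralizerMap θ γ f g) =
          (U1Map θ (tensorMap K f) (e R g).1, U1Map θ f (e R g).2)

/-- Type IV: `G_γ ≅ Res_{K/F} U_{1,EK/K}` for a cubic extension `K/F`. Again `EK = E ⊗ K`, so the
group of `R`-points of the right-hand side is `U_{1,E/F}(K ⊗ R)`. -/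
def IsTypeIV (γ : GL (Fin 3) E) : Prop :=
  ∃ (K : Type u) (_ : Field K) (_ : Algebra F K), Module.finrank F K = 3 ∧
    ∃ e : ∀ (R : Type u) [CommRing R] [Algebra F R],
        centralizer θ γ R ≃* U1 θ (K ⊗[F] R),
      ∀ (R S : Type u) [CommRing R] [Algebra F R] [CommRing S] [Algebra F S] (f : R →ₐ[F] S)
        (g : centralizer θ γ R),
        e S (centralizerMap θ γ f g) = U1Map θ (tensorMap K f) (e R g)

end Orbits

end SymmSpace

end

/-! ### Square classes of local fields -/

/-! The Cayley transform linearises the problem. An element γ of 𝒮(F) satisfies γ̄γ = 1 and is fixed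
by transposition about the antidiagonal. If c c̄ = 1 and 1 - cγ is invertible, then τ = ξ(1 + cγ)/(1
- cγ) has entries in F and the same symmetry, and a matrix intertwines γ with γ' exactly when it
intertwines τ with τ' (`IsCayley.intertwine_iff`). Orbits and stabilizers can therefore be read off
from a symmetric matrix τ over F with distinct eigenvalues, which over F̄ has an eigenbasis
orthonormal for J (`exists_isFrame`).

Whatever commutes with τ is diagonal in that basis, hence symmetric, so on the centralizer being
orthogonal means g² = 1. Let L be the centralizer algebra of τ in the 3 × 3 matrices over F, a
product of fields. Then G_{1γ} is the kernel of det on the two-torsion of the torus Lˣ. Hilbert 90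
for this torus (`IsFrame.hilbert90`) and square roots over F̄ identify H¹ with {x ∈ Lˣ : det x is a
square in Fˣ} modulo squares of Lˣ (`IsTwoTorsionKernel.h1IsElementaryTwo`). A finite extension of F
has four square classes and two square roots of 1, so Lˣ has |Lˣ[2]|² square classes. Since det is
onto modulo squares, |H¹| = |Lˣ[2]|²/4. An element of G_γ(F) with square 1 is fixed by θ, so
G_γ(F)[2] = Lˣ[2], and the type gives 4, 8, 4, 2 for its order. In type IV, H¹ is trivial and a
conjugating element over F̄ descends to F; this is (3).

For (1), an element of Lˣ[2] other than ±1 splits off a rational eigenvalue z; the others are x ± δ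
with δ² in Fˣ. Write δ² = νf² with ν one of the four square class representatives. The cross-shaped
matrix with entries x, f, z, νf is symmetric with the same eigenvalues as τ, hence SO₃(F̄)-conjugate
to it (`IsFrame.exists_conj`), and its inverse Cayley transform lies in T_ν. -/

section SquareClasses

/-- The subgroup of squares of a commutative group. -/
abbrev squares (G : Type*) [CommGroup G] : Subgroup G := (powMonoidHom 2 : G →* G).range

lemma mem_squares {G : Type*} [CommGroup G] {x : G} : x ∈ squares G ↔ ∃ y, y ^ 2 = x := Iff.rfl

section Normed

variable {K : Type*} [NontriviallyNormedField K] [IsUltrametricDist K] [ProperSpace K]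

/-- With x = 1 + m, the equation (1 + y)² = x reads y = (m - y²)/2. As |2| = 1, the right-hand side
contracts the closed ball of radius |m| by the factor |m| < 1. -/
lemma exists_sq_eq_of_norm_sub_one_lt (h2 : ‖(2 : K)‖ = 1) {x : K} (hx : ‖x - 1‖ < 1) :
    ∃ y : K, y ^ 2 = x := by
  set m := x - 1 with hm
  have h20 : (2 : K) ≠ 0 := fun h => by simp [h] at h2
  let f : K → K := fun y => (m - y ^ 2) / 2
  have hmaps : Set.MapsTo f (Metric.closedBall 0 ‖m‖) (Metric.closedBall 0 ‖m‖) := by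
    intro y hy
    rw [mem_closedBall_zero_iff] at hy ⊢
    rw [norm_div, h2, div_one]
    rw [sub_eq_add_neg]
    refine (IsUltrametricDist.norm_add_le_max _ _).trans (max_le le_rfl ?_)
    rw [norm_neg, norm_pow]
    nlinarith [norm_nonneg y, norm_nonneg m]
  have hc : ContractingWith ⟨‖m‖, norm_nonneg m⟩ (hmaps.restrict f _ _) := by
    refine ⟨by exact_mod_cast hx, LipschitzWith.of_dist_le_mul fun a b => ?_⟩
    obtain ⟨a, ha⟩ := a
    obtain ⟨b, hb⟩ := b
    rw [mem_closedBall_zero_iff] at ha hb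
    change dist ((m - a ^ 2) / 2) ((m - b ^ 2) / 2) ≤ ‖m‖ * dist a b
    have : (m - a ^ 2) / 2 - (m - b ^ 2) / 2 = (-(a + b) * (a - b)) / 2 := by ring
    rw [dist_eq_norm, dist_eq_norm, this, norm_div, h2, div_one, norm_mul, norm_neg]
    exact mul_le_mul_of_nonneg_right
      ((IsUltrametricDist.norm_add_le_max _ _).trans (max_le ha hb)) (norm_nonneg _)
  obtain ⟨y, -, hy, -⟩ := hc.exists_fixedPoint' (Metric.isClosed_closedBall.isComplete)
    hmaps (x := 0) (by simp) (edist_ne_top _ _)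
  refine ⟨1 + y, ?_⟩
  have : (m - y ^ 2) / 2 = y := hy
  field_simp at this
  linear_combination -this + hm

open scoped NormedField

variable (K) in
lemma compactSpace_integer : CompactSpace (Valued.integer K) := by
  refine isCompact_iff_compactSpace.mp ?_
  convert! isCompact_closedBall (0 : K) 1
  ext x
  simpa using! Valued.integer.mem_iff

variable (K) in
lemma isDiscreteValuationRing_integer : IsDiscreteValuationRing (Valued.integer K) := by
  have := compactSpace_integer K
  have : (Valued.v : Valuation K NNReal).IsNontrivial := by
    obtain ⟨x, hx⟩ := NormedField.exists_one_lt_norm K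
    refine ⟨x, ?_, ?_⟩
    · rw [NormedField.v_eq_valuation]
      rintro h
      simp at h
      simp [h] at hx
      linarith
    · rw [NormedField.v_eq_valuation]
      intro h
      have : ‖x‖ = 1 := congrArg NNReal.toReal h
      linarith
  exact Valued.integer.isDiscreteValuationRing_of_compactSpace

variable (K) in
lemma finite_residueField_integer : Finite (Valued.ResidueField K) := by
  have := compactSpace_integer K
  let : (Valued.v : Valuation K NNReal).RankOne :=
    inferInstanceAs (NormedField.valuation (K := K)).RankOne
  exact (Valued.integer.compactSpace_iff_completeSpace_and_isDiscreteValuationRing_and_finite_residueField.mp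
    inferInstance).2.2

variable (K) in
lemma exists_uniformizer : ∃ π : Kˣ, ‖(π : K)‖ < 1 ∧
    ∀ x : Kˣ, ∃ n : ℤ, ∃ u : Kˣ, ‖(u : K)‖ = 1 ∧ x = π ^ n * u := by
  have := isDiscreteValuationRing_integer K
  obtain ⟨p, hp⟩ := IsDiscreteValuationRing.exists_irreducible (Valued.integer K)
  have hp0 : (p : K) ≠ 0 := fun h => hp.ne_zero (Subtype.ext h)
  refine ⟨Units.mk0 (p : K) hp0, Valued.integer.norm_irreducible_lt_one hp, ?_⟩
  have key : ∀ x : Kˣ, ‖(x : K)‖ ≤ 1 →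
      ∃ n : ℤ, ∃ u : Kˣ, ‖(u : K)‖ = 1 ∧ x = Units.mk0 (p : K) hp0 ^ n * u := by
    intro x hx
    have hx0 : (⟨x, Valued.integer.mem_iff.2 hx⟩ : Valued.integer K) ≠ 0 :=
      fun h => x.ne_zero (congrArg Subtype.val h)
    obtain ⟨n, u, hu⟩ := IsDiscreteValuationRing.eq_unit_mul_pow_irreducible hx0 hp
    refine ⟨n, Units.map (Valued.integer K).subtype.toMonoidHom u,
      Valued.integer.norm_coe_unit u, ?_⟩
    ext
    have := congrArg Subtype.val hu
    simpa [mul_comm] using this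
  intro x
  rcases le_total ‖(x : K)‖ 1 with h | h
  · exact key x h
  · obtain ⟨n, u, hu, hx⟩ := key x⁻¹ (by simpa using inv_le_one_of_one_le₀ h)
    refine ⟨-n, u⁻¹, by simp [hu], ?_⟩
    rw [← inv_inv x, hx, mul_inv, zpow_neg]

variable (K) in
/-- The elements of norm one. -/
def normOneUnits : Subgroup Kˣ where
  carrier := {x | ‖(x : K)‖ = 1}
  mul_mem' {a b} ha hb := by simp_all
  one_mem' := by simp
  inv_mem' {a} ha := by simp_all

variable (K) in
-- Modulo squares and units only the parity of the valuation survives.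
lemma index_squares_sup_normOneUnits : (squares Kˣ ⊔ normOneUnits K).index = 2 := by
  obtain ⟨π, hπ, h⟩ := exists_uniformizer K
  have hπ0 : 0 < ‖(π : K)‖ := norm_pos_iff.2 π.ne_zero
  have hodd : π ∉ squares Kˣ ⊔ normOneUnits K := by
    intro hmem
    obtain ⟨y, ⟨s, rfl⟩, z, hz, hyz⟩ := Subgroup.mem_sup.1 hmem
    obtain ⟨n, u, hu, rfl⟩ := h s
    have h1 := congrArg (fun x : Kˣ => ‖(x : K)‖) hyz
    have hz' : ‖(z : K)‖ = 1 := hz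
    simp [hu, hz'] at h1
    have h2 : ‖(π : K)‖ ^ (n * 2) = ‖(π : K)‖ ^ (1 : ℤ) := by
      rw [zpow_mul, zpow_one]; exact_mod_cast h1
    have := zpow_right_injective₀ hπ0 hπ.ne h2
    omega
  have heven : ∀ (m : ℤ) (u : Kˣ), ‖(u : K)‖ = 1 →
      π ^ (m + m) * u ∈ squares Kˣ ⊔ normOneUnits K := by
    intro m u hu
    refine Subgroup.mul_mem_sup ⟨π ^ m, ?_⟩ hu
    simp [pow_two, zpow_add]
  rw [Subgroup.index_eq_two_iff]
  refine ⟨π, fun b => ?_⟩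
  obtain ⟨n, u, hu, rfl⟩ := h b
  rcases Int.even_or_odd n with ⟨m, rfl⟩ | ⟨m, rfl⟩
  · refine Or.inr ⟨heven m u hu, fun hm => hodd ?_⟩
    exact (Subgroup.mul_mem_cancel_left _ (heven m u hu)).1 hm
  · have h1 : π ^ (2 * m + 1) * u * π = π ^ ((m + 1) + (m + 1)) * u := by
      rw [mul_right_comm, ← zpow_add_one]; congr 2; ring
    have h2 := heven (m + 1) u hu
    refine Or.inl ⟨h1 ▸ h2, fun hm => hodd ?_⟩
    rw [← h1] at h2
    exact (Subgroup.mul_mem_cancel_left _ hm).1 h2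

/-- The index is 2 · 2: one factor is the parity of the valuation, the other the quadratic character
of the residue of a unit. -/
lemma index_squares_of_norm_two (h2 : ‖(2 : K)‖ = 1) : (squares Kˣ).index = 4 := by
  rw [← Subgroup.relIndex_mul_index (le_sup_left : squares Kˣ ≤ squares Kˣ ⊔ normOneUnits K),
    index_squares_sup_normOneUnits]
  suffices (squares Kˣ).relIndex (squares Kˣ ⊔ normOneUnits K) = 2 by rw [this]
  have := isDiscreteValuationRing_integer K
  have := finite_residueField_integer K
  let _ := Fintype.ofFinite (Valued.ResidueField K)
  let res := IsLocalRing.residue (Valued.integer K)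
  have hres : ∀ z : Valued.integer K, res z = 0 ↔ ‖(z : K)‖ < 1 := by
    intro z
    rw [IsLocalRing.residue_eq_zero_iff, IsLocalRing.mem_maximalIdeal, mem_nonunits_iff,
      Valued.integer.isUnit_iff_norm_eq_one]
    exact ⟨fun h => lt_of_le_of_ne (Valued.integer.norm_le_one z) h, fun h => h.ne⟩
  have hchar : ringChar (Valued.ResidueField K) ≠ 2 := by
    intro h
    have h20 : ((2 : ℕ) : Valued.ResidueField K) = 0 := by
      rw [ringChar.spec, h]
    have : res 2 = 0 := by rw [map_ofNat]; exact_mod_cast h20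
    rw [hres] at this
    have h3 : (((2 : Valued.integer K)) : K) = 2 := rfl
    rw [h3, h2] at this
    exact lt_irrefl _ this
  -- If the residue of u is the square of that of v, then u/v² is congruent to 1 and so has a square
  -- root.
  have hsq : ∀ (u : Kˣ) (hu : ‖(u : K)‖ = 1),
      u ∈ squares Kˣ ↔ IsSquare (res ⟨u, Valued.integer.mem_iff.2 hu.le⟩) := by
    intro u hu
    constructor
    · rintro ⟨s, rfl⟩
      have hs : ‖(s : K)‖ = 1 := by
        have : ‖(s : K)‖ ^ 2 = 1 := by simpa using hu
        exact (pow_eq_one_iff_of_nonneg (norm_nonneg _) two_ne_zero).1 this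
      refine ⟨res ⟨s, Valued.integer.mem_iff.2 hs.le⟩, ?_⟩
      rw [← map_mul]
      congr 1
      ext
      simp [pow_two]
    · rintro ⟨r, hr⟩
      obtain ⟨v, rfl⟩ := IsLocalRing.residue_surjective r
      rw [← map_mul, ← sub_eq_zero, ← map_sub, hres] at hr
      have hv : ‖(v : K)‖ = 1 := by
        refine le_antisymm (Valued.integer.norm_le_one v) (not_lt.1 fun hlt => ?_)
        have h1 : ‖(u : K)‖ ≤ max ‖(u : K) - v * v‖ ‖(v * v : K)‖ := by
          simpa using IsUltrametricDist.norm_add_le_max ((u : K) - v * v) (v * v : K)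
        rw [hu, norm_mul] at h1
        rcases le_max_iff.1 h1 with h1 | h1
        · exact absurd hr (not_lt.2 h1)
        · nlinarith [norm_nonneg (v : K)]
      have hv0 : (v : K) ≠ 0 := fun h => by simp [h] at hv
      have h1 : ‖(u : K) / (v * v) - 1‖ < 1 := by
        rw [div_sub_one (mul_ne_zero hv0 hv0), norm_div, norm_mul, hv]
        simpa using hr
      obtain ⟨y, hy⟩ := exists_sq_eq_of_norm_sub_one_lt h2 h1
      have hy0 : y * v ≠ 0 := by
        refine mul_ne_zero (fun h => ?_) hv0
        rw [h] at hy
        have : (u : K) / (v * v) ≠ 0 := div_ne_zero u.ne_zero (mul_ne_zero hv0 hv0)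
        exact this (by simpa using hy.symm)
      refine ⟨Units.mk0 _ hy0, ?_⟩
      ext
      simp only [powMonoidHom_apply, Units.val_pow_eq_pow_val, Units.val_mk0, mul_pow, hy]
      field_simp
  obtain ⟨e, he⟩ := FiniteField.exists_nonsquare hchar
  obtain ⟨ε, rfl⟩ := IsLocalRing.residue_surjective e
  have hε : ‖(ε : K)‖ = 1 := by
    refine le_antisymm (Valued.integer.norm_le_one ε) (not_lt.1 fun hlt => he ?_)
    rw [(hres ε).2 hlt]
    exact IsSquare.zero
  have hε0 : (ε : K) ≠ 0 := fun h => by simp [h] at hε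
  have hns : Units.mk0 (ε : K) hε0 ∉ squares Kˣ := fun h => he ((hsq _ hε).1 h)
  rw [Subgroup.relIndex_eq_two_iff]
  refine ⟨Units.mk0 (ε : K) hε0, Subgroup.mem_sup_right hε, fun b hb => ?_⟩
  obtain ⟨y, hy, z, hz, rfl⟩ := Subgroup.mem_sup.1 hb
  have hz : ‖(z : K)‖ = 1 := hz
  by_cases hzs : z ∈ squares Kˣ
  · have hb := mul_mem hy hzs
    exact Or.inr ⟨hb, fun h => hns ((Subgroup.mul_mem_cancel_left _ hb).1 h)⟩
  · refine Or.inl ⟨?_, fun h => hzs ((Subgroup.mul_mem_cancel_left _ hy).1 h)⟩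
    rw [mul_assoc]
    refine mul_mem hy ?_
    have hzε : ‖((z * Units.mk0 (ε : K) hε0 : Kˣ) : K)‖ = 1 := by simp [hz, hε]
    rw [hsq _ hzε]
    rw [hsq _ hz] at hzs
    have : res ⟨_, Valued.integer.mem_iff.2 hzε.le⟩ =
        res ⟨z, Valued.integer.mem_iff.2 hz.le⟩ * res ε := by
      rw [← map_mul]; rfl
    rw [this]
    -- In a finite field of odd characteristic the product of two nonsquares is a square, by
    -- multiplicativity of the quadratic character.
    classical
    by_contra hcon
    rw [← quadraticChar_neg_one_iff_not_isSquare] at hzs he hcon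
    rw [map_mul, hzs, he] at hcon
    norm_num at hcon

end Normed

/-- The spectral norm makes K a locally compact ultrametric field and extends the norm of F, so |2|
= 1 persists in K. -/
lemma index_squares_of_finiteDimensional (F : Type*) [NontriviallyNormedField F]
    [IsUltrametricDist F] [ProperSpace F] (h2 : ‖(2 : F)‖ = 1)
    (K : Type*) [Field K] [Algebra F K] [FiniteDimensional F K] : (squares Kˣ).index = 4 := by
  let _ := spectralNorm.nontriviallyNormedField F K
  let _ := spectralNorm.normedAlgebra F K
  have : IsUltrametricDist K :=
    IsUltrametricDist.isUltrametricDist_of_isNonarchimedean_norm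
      (isNonarchimedean_spectralNorm (K := F) (L := K))
  have : ProperSpace K := FiniteDimensional.proper F K
  refine index_squares_of_norm_two ?_
  have : ‖algebraMap F K 2‖ = ‖(2 : F)‖ := spectralNorm_extends _
  rwa [h2, map_ofNat] at this

/-- The valuation is turned into a norm. Were |2| < 1, then 2 would vanish in the residue field,
whose characteristic would be 2. -/
theorem IsNonarchimedeanLocalField.index_squares (F : Type*) [Field F] [ValuativeRel F]
    [TopologicalSpace F] [IsNonarchimedeanLocalField F] (hp : ringChar 𝓀[F] ≠ 2)
    (K : Type*) [Field K] [Algebra F K] [FiniteDimensional F K] : (squares Kˣ).index = 4 := by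
  let := IsTopologicalAddGroup.rightUniformSpace F
  have := isUniformAddGroup_of_addCommGroup (G := F)
  let : (Valued.v (R := F)).RankOne :=
    { hom' := ValuativeRel.IsRankLeOne.nonempty.some.emb (R := F).comp
        MonoidWithZeroHom.ValueGroup₀.embedding
      strictMono' := ValuativeRel.IsRankLeOne.nonempty.some.strictMono.comp
        MonoidWithZeroHom.ValueGroup₀.embedding_strictMono }
  let := Valued.toNontriviallyNormedField (L := F)
    (Γ₀ := ValuativeRel.ValueGroupWithZero F)
  have : IsUltrametricDist F := inferInstance
  have : ProperSpace F := .of_nontriviallyNormedField_of_weaklyLocallyCompactSpace F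
  refine index_squares_of_finiteDimensional F ?_ K
  have hle : ‖(2 : F)‖ ≤ 1 := by
    have := IsUltrametricDist.norm_add_le_max (1 : F) 1
    rw [one_add_one_eq_two] at this
    simpa using this
  refine le_antisymm hle (not_lt.1 fun hlt => hp ?_)
  have hv : ValuativeRel.valuation F 2 < 1 := by
    have := Valued.toNormedField.norm_lt_one_iff.1 hlt
    rwa [IsValuativeTopology.v_eq_valuation] at this
  have h0 : IsLocalRing.residue 𝒪[F] 2 = 0 := by
    rw [IsLocalRing.residue_eq_zero_iff, IsLocalRing.mem_maximalIdeal, mem_nonunits_iff]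
    intro hu
    have := (Valuation.integer.integers (ValuativeRel.valuation F)).isUnit_iff_valuation_eq_one.1 hu
    exact hv.ne this
  have h1 : ((2 : ℕ) : 𝓀[F]) = 0 := by exact_mod_cast (map_ofNat (IsLocalRing.residue 𝒪[F]) 2) ▸ h0
  rw [ringChar.spec] at h1
  exact ((Nat.dvd_prime Nat.prime_two).1 h1).resolve_left (CharP.ringChar_ne_one)

end SquareClasses

/-! ### Two-torsion and squares -/

section TwoTorsion

/-- The number of elements of order at most two. -/
noncomputable abbrev twoTorsionCard (G : Type*) [Group G] : ℕ := Nat.card {g : G // g ^ 2 = 1}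

lemma twoTorsionCard_congr {G H : Type*} [Group G] [Group H] (e : G ≃* H) :
    twoTorsionCard G = twoTorsionCard H :=
  Nat.card_congr (e.toEquiv.subtypeEquiv fun g => by
    change _ ↔ e g ^ 2 = 1
    rw [← map_pow, map_eq_one_iff e e.injective])

lemma twoTorsionCard_prod (G H : Type*) [Group G] [Group H] :
    twoTorsionCard (G × H) = twoTorsionCard G * twoTorsionCard H := by
  rw [← Nat.card_prod]
  exact Nat.card_congr
    { toFun := fun g => (⟨g.1.1, congrArg Prod.fst g.2⟩, ⟨g.1.2, congrArg Prod.snd g.2⟩)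
      invFun := fun g => ⟨(g.1.1, g.2.1), Prod.ext g.1.2 g.2.2⟩
      left_inv := fun _ => rfl
      right_inv := fun _ => rfl }

lemma twoTorsionCard_pi {ι : Type*} [Fintype ι] (G : ι → Type*) [∀ i, Group (G i)] :
    twoTorsionCard (∀ i, G i) = ∏ i, twoTorsionCard (G i) := by
  rw [← Nat.card_pi]
  exact Nat.card_congr
    { toFun := fun g i => ⟨g.1 i, congrFun g.2 i⟩
      invFun := fun g => ⟨fun i => (g i).1, funext fun i => (g i).2⟩
      left_inv := fun _ => rfl
      right_inv := fun _ => rfl }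

lemma twoTorsionCard_units_of_isDomain (R : Type*) [CommRing R] [IsDomain R]
    (h2 : (2 : R) ≠ 0) : twoTorsionCard Rˣ = 2 := by
  have hne : (1 : Rˣ) ≠ -1 := by
    intro h
    have : (1 : R) = -1 := congrArg Units.val h
    apply h2
    linear_combination this
  have : {g : Rˣ | g ^ 2 = 1} = {1, -1} := by
    ext g
    simp only [Set.mem_ofPred_eq, Set.mem_insert_iff, Set.mem_singleton_iff]
    refine ⟨fun h => ?_, by rintro (rfl | rfl) <;> simp⟩
    have h' : (g : R) ^ 2 = 1 := by
      rw [← Units.val_pow_eq_pow_val, h, Units.val_one]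
    rcases sq_eq_one_iff.1 h' with h | h
    · exact Or.inl (Units.ext h)
    · exact Or.inr (Units.ext h)
  change Nat.card ↥{g : Rˣ | g ^ 2 = 1} = 2
  rw [this, Nat.card_coe_set_eq, Set.ncard_pair hne]

lemma index_squares_congr {G H : Type*} [CommGroup G] [CommGroup H] (e : G ≃* H) :
    (squares G).index = (squares H).index := by
  have : squares G = (squares H).comap (e : G →* H) := by
    ext x
    simp only [Subgroup.mem_comap, mem_squares, MonoidHom.coe_coe]
    constructor
    · rintro ⟨y, rfl⟩
      exact ⟨e y, by simp⟩
    · rintro ⟨y, hy⟩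
      exact ⟨e.symm y, by rw [← map_pow, hy]; simp⟩
  rw [this, Subgroup.index_comap_of_surjective _ e.surjective]

lemma index_squares_pi {ι : Type*} [Fintype ι] (G : ι → Type*) [∀ i, CommGroup (G i)] :
    (squares (∀ i, G i)).index = ∏ i, (squares (G i)).index := by
  let f : (∀ i, G i) →* ∀ i, G i ⧸ squares (G i) :=
    MonoidHom.pi fun i => (QuotientGroup.mk' _).comp (Pi.evalMonoidHom G i)
  have hf : Function.Surjective f := fun y => by
    choose x hx using fun i => QuotientGroup.mk'_surjective (squares (G i)) (y i)
    exact ⟨x, funext hx⟩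
  have hker : f.ker = squares (∀ i, G i) := by
    ext x
    rw [MonoidHom.mem_ker, mem_squares]
    have : f x = 1 ↔ ∀ i, ∃ y, y ^ 2 = x i := by
      rw [funext_iff]
      exact forall_congr' fun i => (QuotientGroup.eq_one_iff (x i)).trans Iff.rfl
    rw [this]
    constructor
    · intro h
      choose y hy using h
      exact ⟨y, funext hy⟩
    · rintro ⟨y, rfl⟩ i
      exact ⟨y i, rfl⟩
  rw [← hker, Subgroup.index_ker, MonoidHom.range_eq_top.2 hf, Subgroup.card_top, Nat.card_pi]
  rfl

/-- For a finite reduced algebra over a local field of odd residue characteristic, the number of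
square classes is the square of the number of square roots of unity. -/
theorem index_squares_of_isReduced (F : Type*) [Field F] [ValuativeRel F]
    [TopologicalSpace F] [IsNonarchimedeanLocalField F] [CharZero F] (hp : ringChar 𝓀[F] ≠ 2)
    (L : Type*) [CommRing L] [Algebra F L] [FiniteDimensional F L] [IsReduced L] :
    (squares Lˣ).index = twoTorsionCard Lˣ ^ 2 := by
  have : IsArtinianRing L := IsArtinianRing.of_finite F L
  let := Fintype.ofFinite (MaximalSpectrum L)
  -- A reduced Artinian ring is the product of its residue fields; each is a finite extension of F
  -- with index 4 = 2².
  let e : Lˣ ≃* ∀ I : MaximalSpectrum L, (L ⧸ I.asIdeal)ˣ :=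
    (Units.mapEquiv (IsArtinianRing.equivPi L : L ≃* _)).trans MulEquiv.piUnits
  rw [index_squares_congr e, index_squares_pi, twoTorsionCard_congr e, twoTorsionCard_pi,
    ← Finset.prod_pow]
  refine Finset.prod_congr rfl fun I _ => ?_
  let := Ideal.Quotient.field I.asIdeal
  have : CharZero (L ⧸ I.asIdeal) := charZero_of_injective_algebraMap (algebraMap F (L ⧸ I.asIdeal)).injective
  have h1 : (squares (L ⧸ I.asIdeal)ˣ).index = 4 :=
    IsNonarchimedeanLocalField.index_squares F hp (L ⧸ I.asIdeal)
  have h2 := twoTorsionCard_units_of_isDomain (L ⧸ I.asIdeal) two_ne_zero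
  rw [h2]
  exact h1

/-- A finite commutative group of exponent two is an `𝔽₂`-vector space. -/
lemma nonempty_mulEquiv_of_sq_eq_one {Q : Type*} [CommGroup Q] (h : ∀ x : Q, x ^ 2 = 1) (k : ℕ)
    (hk : Nat.card Q = 2 ^ k) : Nonempty (Q ≃* Multiplicative (Fin k → ZMod 2)) := by
  let : Module (ZMod 2) (Additive Q) := AddCommGroup.zmodModule fun x => h x
  have : Finite Q := Nat.finite_of_card_ne_zero (by rw [hk]; positivity)
  have : Module.Finite (ZMod 2) (Additive Q) := Module.Finite.of_finite
  have hr : Module.finrank (ZMod 2) (Additive Q) = k := by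
    have := Module.natCard_eq_pow_finrank (K := ZMod 2) (V := Additive Q)
    rw [Nat.card_zmod] at this
    exact Nat.pow_right_injective le_rfl (this.symm.trans hk)
  let e := (Module.finBasisOfFinrankEq (ZMod 2) (Additive Q) hr).equivFun
  exact ⟨(MulEquiv.toAdditiveLeft).symm e.toAddEquiv⟩

end TwoTorsion

/-! ### Galois cohomology of the two-torsion of a torus -/

namespace SymmSpace

section TwoTorsionCohomology

variable {Γ A D M : Type*} [Group Γ] [CommGroup A] [MulDistribMulAction Γ A]
  [CommGroup D] [MulDistribMulAction Γ D] [Group M] [MulDistribMulAction Γ M]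

variable (Γ) in
/-- The elements `b` such that `b²` and `d(b)` are invariant. -/
def sqInvariant (d : A →* D) : Subgroup A where
  carrier := {b | (∀ s : Γ, s • b ^ 2 = b ^ 2) ∧ ∀ s : Γ, s • d b = d b}
  mul_mem' {a b} ha hb := by
    refine ⟨fun s => ?_, fun s => ?_⟩
    · rw [mul_pow, smul_mul', ha.1, hb.1]
    · rw [map_mul, smul_mul', ha.2, hb.2]
  one_mem' := by simp
  inv_mem' {a} ha := by
    refine ⟨fun s => ?_, fun s => ?_⟩
    · rw [inv_pow, smul_inv', ha.1]
    · rw [map_inv, smul_inv', ha.2]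

/-- An injective homomorphism onto the kernel of `d` on the two-torsion. -/
structure IsTwoTorsionKernel (ι : M →* A) (d : A →* D) : Prop where
  injective : Function.Injective ι
  smul : ∀ (s : Γ) m, ι (s • m) = s • ι m
  smul_right : ∀ (s : Γ) x, d (s • x) = s • d x
  mem_range : ∀ x, (∃ m, ι m = x) ↔ x ^ 2 = 1 ∧ d x = 1

variable {ι : M →* A} {d : A →* D}

lemma IsTwoTorsionKernel.isMulCommutative (h : IsTwoTorsionKernel (Γ := Γ) ι d) :
    IsMulCommutative M :=
  ⟨⟨fun a b => h.injective (by rw [map_mul, map_mul, mul_comm])⟩⟩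

variable [TopologicalSpace Γ]

/-- This is the connecting map. Invariance of b² and d(b) places b/s(b) in the image of M, and it
satisfies the cocycle identity because it is a coboundary in A. -/
lemma IsTwoTorsionKernel.exists_coboundary (h : IsTwoTorsionKernel (Γ := Γ) ι d)
    (hcont : ∀ b : A, IsLocallyConstant fun s : Γ => s • b) (b : sqInvariant Γ d) :
    ∃ a : Cocycle Γ M, ∀ s, ι (a.toFun s) = b.1 * (s • b.1)⁻¹ := by
  have hb : ∀ s : Γ, ∃ m, ι m = b.1 * (s • b.1)⁻¹ := fun s => by
    rw [h.mem_range, mul_pow, inv_pow, ← smul_pow', b.2.1, mul_inv_cancel, map_mul, map_inv,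
      h.smul_right, b.2.2, mul_inv_cancel]
    exact ⟨rfl, rfl⟩
  choose f hf using hb
  refine ⟨⟨f, ?_, fun s t => h.injective ?_⟩, hf⟩
  · have h1 : IsLocallyConstant fun s : Γ => b.1 * (s • b.1)⁻¹ :=
      (hcont b.1).comp fun x => b.1 * x⁻¹
    refine (IsLocallyConstant.iff_exists_open _).2 fun s => ?_
    obtain ⟨U, hU, hs, hc⟩ := (IsLocallyConstant.iff_exists_open _).1 h1 s
    exact ⟨U, hU, hs, fun t ht => h.injective (by rw [hf, hf]; exact hc t ht)⟩
  · rw [map_mul, hf, h.smul, hf, hf, smul_mul', smul_inv', ← mul_smul, mul_assoc,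
      inv_mul_cancel_left]

/-- The cohomology of the kernel of `d` on the two-torsion of `A`, provided that every cocycle
becomes a coboundary in `A`. -/
theorem IsTwoTorsionKernel.h1IsElementaryTwo (h : IsTwoTorsionKernel (Γ := Γ) ι d)
    (hcont : ∀ b : A, IsLocallyConstant fun s : Γ => s • b)
    (hsqrt : ∀ x : A, ∃ y, y ^ 2 = x)
    (e : A) (he : ∀ s : Γ, s • e = e) (he2 : e ^ 2 = 1)
    (hd2 : ∀ x : D, x ^ 2 = 1 → x = 1 ∨ x = d e)
    (h90 : ∀ a : Cocycle Γ M, ∃ b : A, ∀ s, ι (a.toFun s) = b * (s • b)⁻¹)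
    {A₀ D₀ : Type*} [CommGroup A₀] [CommGroup D₀] (j : A₀ →* A) (jD : D₀ →* D) (d₀ : A₀ →* D₀)
    (hj : Function.Injective j) (hjD : Function.Injective jD)
    (hj_range : ∀ x, (∃ y, j y = x) ↔ ∀ s : Γ, s • x = x)
    (hjD_range : ∀ x, (∃ y, jD y = x) ↔ ∀ s : Γ, s • x = x)
    (hdj : ∀ x, d (j x) = jD (d₀ x))
    (hd₀ : ∀ f, ∃ x y, d₀ x = f * y ^ 2)
    (k : ℕ) (hD : (squares D₀).index ≠ 0)
    (hk : (squares A₀).index = (squares D₀).index * 2 ^ k) :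
    H1IsElementaryTwo Γ M k := by
  have hM := h.isMulCommutative
  refine ⟨hM, ?_⟩
  let Z := sqInvariant Γ d
  -- the squaring map
  choose q₀ hq₀ using fun b : Z => (hj_range (b.1 ^ 2)).2 b.2.1
  let q : Z →* A₀ :=
    { toFun := q₀
      map_one' := hj (by rw [hq₀]; simp)
      map_mul' := fun a b => hj (by rw [map_mul, hq₀, hq₀, hq₀]; exact mul_pow _ _ _) }
  have hq : ∀ b : Z, j (q b) = b.1 ^ 2 := hq₀
  -- If d(x) = f² with f invariant, then any square root y of x has d(y) equal to f or d(e)f, and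
  -- both are invariant since e is.
  have hqrange : q.range = (squares D₀).comap d₀ := by
    ext x
    constructor
    · rintro ⟨b, rfl⟩
      obtain ⟨f, hf⟩ := (hjD_range (d b.1)).2 b.2.2
      refine ⟨f, hjD ?_⟩
      rw [← hdj, hq, map_pow, ← hf, powMonoidHom_apply, map_pow]
    · rintro ⟨f, hf⟩
      obtain ⟨y, hy⟩ := hsqrt (j x)
      have hfix : ∀ s : Γ, s • d y = d y := by
        have h1 : (d y * (jD f)⁻¹) ^ 2 = 1 := by
          rw [mul_pow, ← map_pow, hy, hdj, ← hf, powMonoidHom_apply, map_pow, inv_pow,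
            mul_inv_cancel]
        have h2 : ∀ s : Γ, s • jD f = jD f := (hjD_range _).1 ⟨f, rfl⟩
        intro s
        rcases hd2 _ h1 with h3 | h3
        · rw [mul_inv_eq_one.1 h3, h2]
        · rw [mul_inv_eq_iff_eq_mul.1 h3, smul_mul', ← h.smul_right, he, h2]
      refine ⟨⟨y, fun s => ?_, hfix⟩, hj ?_⟩
      · rw [hy]; exact (hj_range _).1 ⟨x, rfl⟩ s
      · rw [hq, hy]
  -- the connecting map
  choose a₀ ha₀ using h.exists_coboundary hcont
  let N : Subgroup Z := (squares A₀).comap q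
  have hN : ∀ z : Z, z ∈ N ↔ ∃ m : M, ∃ y : A₀, z.1 = ι m * j y := by
    intro z
    constructor
    · rintro ⟨y, hy⟩
      have h1 : (z.1 * (j y)⁻¹) ^ 2 = 1 := by
        rw [mul_pow, ← hq, ← hy, powMonoidHom_apply, map_pow, inv_pow, mul_inv_cancel]
      have h2 : d (z.1 * (j y)⁻¹) ^ 2 = 1 := by rw [← map_pow, h1, map_one]
      obtain ⟨e', he'⟩ := (hj_range e).2 he
      rcases hd2 _ h2 with h3 | h3
      · obtain ⟨m, hm⟩ := (h.mem_range _).2 ⟨h1, h3⟩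
        exact ⟨m, y, by rw [hm, inv_mul_cancel_right]⟩
      -- When d takes the value d(e) rather than 1, multiplication by e corrects it. As e is
      -- invariant with e² = 1, it can be absorbed into the factor from A₀.
      · obtain ⟨m, hm⟩ := (h.mem_range (z.1 * (j y)⁻¹ * e)).2
          ⟨by rw [mul_pow, h1, he2, one_mul], by rw [map_mul, h3, ← map_mul, ← pow_two, he2,
            map_one]⟩
        refine ⟨m, e' * y, ?_⟩
        rw [hm, map_mul, he', mul_assoc, ← mul_assoc e e, ← pow_two, he2, one_mul,
          inv_mul_cancel_right]
    · rintro ⟨m, y, hz⟩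
      refine ⟨y, hj ?_⟩
      rw [hq, hz, mul_pow, ((h.mem_range _).1 ⟨m, rfl⟩).1, one_mul, powMonoidHom_apply, map_pow]
  -- If g in M relates the two cocycles, then g z⁻¹z' is Galois-invariant, so z⁻¹z' differs from an
  -- element of A₀ by an element of M.
  have hcoh : ∀ z z' : Z, (cohomologous Γ M).r (a₀ z) (a₀ z') ↔ z⁻¹ * z' ∈ N := by
    intro z z'
    rw [hN]
    have key : ∀ g : M, (∀ s, (a₀ z').toFun s = g⁻¹ * (a₀ z).toFun s * s • g) ↔
        ∃ y, z.1⁻¹ * z'.1 = ι g⁻¹ * j y := by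
      intro g
      have : (∃ y, z.1⁻¹ * z'.1 = ι g⁻¹ * j y) ↔ ∃ y, j y = ι g * (z.1⁻¹ * z'.1) := by
        refine exists_congr fun y => ?_
        rw [map_inv, eq_inv_mul_iff_mul_eq, eq_comm]
      rw [this, hj_range]
      refine forall_congr' fun s => ?_
      rw [← h.injective.eq_iff, map_mul, map_mul, map_inv, ha₀, ha₀, h.smul]
      simp only [smul_mul', smul_inv']
      generalize s • z.1 = u
      generalize s • z'.1 = v
      generalize s • ι g = w
      constructor
      · intro H
        have H' : z'.1 = (ι g)⁻¹ * (z.1 * u⁻¹) * w * v := by rw [← H, inv_mul_cancel_right]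
        rw [H']
        simp [mul_comm, mul_left_comm]
      · intro H
        have H' : (ι g)⁻¹ * (z.1 * u⁻¹) * w * v = (ι g)⁻¹ * (z.1 * (w * (u⁻¹ * v))) := by
          simp only [mul_assoc, mul_left_comm]
        rw [mul_inv_eq_iff_eq_mul, H', H, mul_left_comm z.1, mul_inv_cancel_left,
          inv_mul_cancel_left]
    constructor
    · rintro ⟨g, hg⟩
      exact ⟨g⁻¹, (key g).1 hg⟩
    · rintro ⟨m, hm⟩
      exact ⟨m⁻¹, (key m⁻¹).2 (by simpa using hm)⟩
  let δ : Z ⧸ N → H1 Γ M := Quotient.lift (fun z => Quotient.mk (cohomologous Γ M) (a₀ z))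
    fun z z' hzz => Quotient.sound ((hcoh z z').2 (QuotientGroup.leftRel_apply.1 hzz))
  have hδ : Function.Bijective δ := by
    constructor
    · rintro ⟨z⟩ ⟨z'⟩ hzz
      exact Quotient.sound (QuotientGroup.leftRel_apply.2 ((hcoh z z').1 (Quotient.exact hzz)))
    · rintro ⟨a⟩
      -- A cocycle of M becomes b/s(b) in A. Its values have square 1 and trivial d, which says
      -- precisely that b² and d(b) are invariant.
      obtain ⟨b, hb⟩ := h90 a
      have hbZ : b ∈ Z := by
        have h1 : ∀ s : Γ, (b * (s • b)⁻¹) ^ 2 = 1 ∧ d (b * (s • b)⁻¹) = 1 :=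
          fun s => (h.mem_range _).1 ⟨_, hb s⟩
        refine ⟨fun s => ?_, fun s => ?_⟩
        · have := (h1 s).1
          rw [mul_pow, inv_pow, mul_inv_eq_one] at this
          rw [smul_pow', this]
        · have := (h1 s).2
          rw [map_mul, map_inv, mul_inv_eq_one] at this
          rw [← h.smul_right, this]
      refine ⟨Quotient.mk _ ⟨b, hbZ⟩, ?_⟩
      refine congrArg (Quotient.mk (cohomologous Γ M)) ?_
      have : (a₀ ⟨b, hbZ⟩).toFun = a.toFun := funext fun s => h.injective (by rw [ha₀, hb])
      cases a
      generalize ha' : a₀ ⟨b, hbZ⟩ = a' at this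
      cases a'
      cases this
      rfl
  have hmul : ∀ x y, δ (x * y) = δ x * δ y := by
    rintro ⟨x⟩ ⟨y⟩
    refine congrArg (Quotient.mk (cohomologous Γ M)) ?_
    have : (a₀ (x * y)).toFun = fun s => (a₀ x).toFun s * (a₀ y).toFun s :=
      funext fun s => h.injective (by
        rw [map_mul, ha₀, ha₀, ha₀, Subgroup.coe_mul, smul_mul', mul_inv]
        exact mul_mul_mul_comm _ _ _ _)
    generalize a₀ (x * y) = a' at this
    cases a'
    cases this
    rfl
  -- Squaring identifies Z/N with d₀⁻¹(D₀²)/A₀². As d₀ is onto modulo squares, d₀⁻¹(D₀²) has index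
  -- [D₀ : D₀²] in A₀, and dividing the indices leaves 2ᵏ.
  have hcard : Nat.card (Z ⧸ N) = 2 ^ k := by
    change N.index = _
    rw [Subgroup.index_comap, hqrange]
    have hle : squares A₀ ≤ (squares D₀).comap d₀ := by
      rintro _ ⟨y, rfl⟩
      exact ⟨d₀ y, by simp⟩
    have hW : ((squares D₀).comap d₀).index = (squares D₀).index := by
      have : (squares D₀).comap d₀ = ((QuotientGroup.mk' (squares D₀)).comp d₀).ker := by
        rw [← MonoidHom.comap_ker, QuotientGroup.ker_mk']
      rw [this, Subgroup.index_ker, MonoidHom.range_eq_top.2, Subgroup.card_top]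
      · rfl
      · rintro ⟨f⟩
        obtain ⟨x, y, hxy⟩ := hd₀ f
        refine ⟨x, ?_⟩
        refine (QuotientGroup.eq.2 ?_ : QuotientGroup.mk (d₀ x) = QuotientGroup.mk f)
        exact ⟨y⁻¹, by simp [hxy]⟩
    have := Subgroup.relIndex_mul_index hle
    rw [hW, hk, mul_comm] at this
    exact Nat.eq_of_mul_eq_mul_left (Nat.pos_of_ne_zero hD) this
  have hexp : ∀ x : Z ⧸ N, x ^ 2 = 1 := by
    rintro ⟨z⟩
    refine (QuotientGroup.eq_one_iff (z ^ 2)).2 ((hN _).2 ⟨1, ?_⟩)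
    obtain ⟨y, hy⟩ := (hj_range _).2 z.2.1
    exact ⟨y, by simp [hy]⟩
  obtain ⟨φ⟩ := nonempty_mulEquiv_of_sq_eq_one hexp k hcard
  exact ⟨(MulEquiv.ofBijective (⟨δ, hmul⟩ : (Z ⧸ N) →ₙ* H1 Γ M) hδ).symm.trans φ⟩

end TwoTorsionCohomology

end SymmSpace

/-! ### Matrices symmetric about the antidiagonal -/

namespace SymmSpace

section Antitranspose

variable {A B : Type*} [CommRing A] [CommRing B]

lemma J_mul_J : (J A).val * (J A).val = 1 := (J A).val_inv

lemma J_transpose : (J A).valᵀ = (J A).val := by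
  ext i j; fin_cases i <;> fin_cases j <;> simp [J]

lemma det_J : (J A).val.det = -1 := by
  simp [J, Matrix.det_fin_three]

/-- The transpose with respect to the antidiagonal. -/
def antitranspose (M : Matrix (Fin 3) (Fin 3) A) : Matrix (Fin 3) (Fin 3) A :=
  (J A).val * Mᵀ * (J A).val

lemma antitranspose_mul (M N : Matrix (Fin 3) (Fin 3) A) :
    antitranspose (M * N) = antitranspose N * antitranspose M := by
  simp only [antitranspose, Matrix.transpose_mul, Matrix.mul_assoc]
  rw [← Matrix.mul_assoc (J A).val (J A).val, J_mul_J, Matrix.one_mul]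

@[simp] lemma antitranspose_one : antitranspose (1 : Matrix (Fin 3) (Fin 3) A) = 1 := by
  simp [antitranspose, J_mul_J]

lemma antitranspose_add (M N : Matrix (Fin 3) (Fin 3) A) :
    antitranspose (M + N) = antitranspose M + antitranspose N := by
  simp [antitranspose, Matrix.mul_add, Matrix.add_mul]

lemma antitranspose_smul (a : A) (M : Matrix (Fin 3) (Fin 3) A) :
    antitranspose (a • M) = a • antitranspose M := by
  simp [antitranspose]

lemma antitranspose_map (f : A →+* B) (M : Matrix (Fin 3) (Fin 3) A) :
    antitranspose (M.map f) = (antitranspose M).map f := by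
  have : (J A).val.map f = (J B).val := by
    rw [← map_J f]; rfl
  simp only [antitranspose, Matrix.map_mul, this, Matrix.transpose_map]

lemma val_sigma (g : GL (Fin 3) A) : (sigma A g).val = antitranspose (g⁻¹).val := rfl

lemma sigma_eq_iff (g h : GL (Fin 3) A) :
    sigma A g = h ↔ antitranspose g.val * h.val = 1 := by
  have h1 : antitranspose g.val * (sigma A g).val = 1 := by
    rw [val_sigma, ← antitranspose_mul, ← Units.val_mul, inv_mul_cancel, Units.val_one,
      antitranspose_one]
  constructor
  · rintro rfl
    exact h1
  · intro h2
    have h3 : (sigma A g).val * antitranspose g.val = 1 := mul_eq_one_comm.1 h1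
    ext1
    calc (sigma A g).val = (sigma A g).val * (antitranspose g.val * h.val) := by rw [h2, mul_one]
      _ = h.val := by rw [← Matrix.mul_assoc, h3, Matrix.one_mul]

lemma eq_sigma_inv_iff (g : GL (Fin 3) A) : g = (sigma A g)⁻¹ ↔ antitranspose g.val = g.val := by
  rw [eq_comm, inv_eq_iff_eq_inv, sigma_eq_iff]
  constructor
  · intro h
    calc antitranspose g.val = antitranspose g.val * ((g⁻¹).val * g.val) := by
          rw [← Units.val_mul, inv_mul_cancel, Units.val_one, mul_one]
      _ = g.val := by rw [← Matrix.mul_assoc, h, Matrix.one_mul]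
  · intro h
    rw [h, ← Units.val_mul, mul_inv_cancel, Units.val_one]

lemma mem_unitary_iff (c : A →+* A) (g : GL (Fin 3) A) :
    g ∈ unitary c ↔ antitranspose (g.val.map c) * g.val = 1 :=
  sigma_eq_iff (Matrix.GeneralLinearGroup.map c g) g

/-- Once g equals its antitranspose, the transpose drops out of the unitary condition. -/
lemma mem_symm_iff (c : A →+* A) (g : GL (Fin 3) A) :
    g ∈ symm c ↔ antitranspose g.val = g.val ∧ g.val.map c * g.val = 1 := by
  change g ∈ unitary c ∧ g = (sigma A g)⁻¹ ↔ _
  rw [eq_sigma_inv_iff, mem_unitary_iff, and_comm]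
  refine and_congr_right fun h => ?_
  rw [antitranspose_map, h]

lemma mem_specialOrthogonal_iff (g : GL (Fin 3) A) :
    g ∈ specialOrthogonal A ↔ antitranspose g.val * g.val = 1 ∧ g.val.det = 1 := by
  change sigma A g = g ∧ Matrix.GeneralLinearGroup.det g = 1 ↔ _
  rw [sigma_eq_iff, Units.ext_iff]
  rfl

/-- The invertible matrices commuting with a given matrix. -/
def torus (τ : Matrix (Fin 3) (Fin 3) A) : Subgroup (GL (Fin 3) A) where
  carrier := {g | Commute g.val τ}
  mul_mem' ha hb := Commute.mul_left ha hb
  one_mem' := Commute.one_left _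
  inv_mem' ha := Commute.units_inv_left ha

lemma mem_torus {τ : Matrix (Fin 3) (Fin 3) A} {g : GL (Fin 3) A} :
    g ∈ torus τ ↔ Commute g.val τ := Iff.rfl

end Antitranspose

/-! ### Orthonormal eigenbases for the form `J` -/

section Frame

variable {k : Type*} [Field k]

/-- An orthonormal basis (the columns of `P`) of eigenvectors of `τ` with distinct eigenvalues. -/
structure IsFrame (τ : Matrix (Fin 3) (Fin 3) k) (P : GL (Fin 3) k) (t : Fin 3 → k) : Prop where
  injective : Function.Injective t
  mul_eq : τ * P.val = P.val * Matrix.diagonal t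
  orthonormal : P.valᵀ * (J k).val * P.val = 1

variable {τ : Matrix (Fin 3) (Fin 3) k} {P : GL (Fin 3) k} {t : Fin 3 → k}

lemma GL_mul_inv_val (P : GL (Fin 3) k) : P.val * (P⁻¹).val = 1 := P.val_inv

lemma GL_inv_mul_val (P : GL (Fin 3) k) : (P⁻¹).val * P.val = 1 := P.inv_val

lemma mul_eq_mul_diagonal_iff (P : GL (Fin 3) k) (M : Matrix (Fin 3) (Fin 3) k) (d : Fin 3 → k) :
    M * P.val = P.val * Matrix.diagonal d ↔ M = P.val * Matrix.diagonal d * (P⁻¹).val := by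
  constructor
  · intro h
    rw [← h, Matrix.mul_assoc, GL_mul_inv_val, Matrix.mul_one]
  · rintro rfl
    rw [Matrix.mul_assoc, GL_inv_mul_val, Matrix.mul_one]

/-- In the eigenbasis, the (i, j) entry of M is annihilated by the difference of the i-th and j-th
eigenvalues, which is nonzero off the diagonal. -/
lemma IsFrame.exists_diagonal (h : IsFrame τ P t) {M : Matrix (Fin 3) (Fin 3) k}
    (hM : Commute M τ) : ∃ d : Fin 3 → k, M * P.val = P.val * Matrix.diagonal d := by
  set N := (P⁻¹).val * M * P.val with hN
  have h1 : N * Matrix.diagonal t = Matrix.diagonal t * N := by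
    have h2 : Matrix.diagonal t = (P⁻¹).val * τ * P.val := by
      rw [Matrix.mul_assoc, h.mul_eq, ← Matrix.mul_assoc, GL_inv_mul_val, Matrix.one_mul]
    have h3 : ∀ X Y : Matrix (Fin 3) (Fin 3) k,
        (P⁻¹).val * X * P.val * ((P⁻¹).val * Y * P.val) = (P⁻¹).val * (X * Y) * P.val := by
      intro X Y
      rw [show (P⁻¹).val * X * P.val * ((P⁻¹).val * Y * P.val) =
        (P⁻¹).val * X * (P.val * (P⁻¹).val) * Y * P.val by simp only [Matrix.mul_assoc],
        GL_mul_inv_val, Matrix.mul_one, Matrix.mul_assoc (P⁻¹).val X Y]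
    rw [h2, hN, h3, h3, hM.eq]
  refine ⟨fun i => N i i, ?_⟩
  have h4 : N = Matrix.diagonal fun i => N i i := by
    ext i j
    by_cases hij : i = j
    · simp [hij]
    · have := congrFun (congrFun h1 i) j
      rw [Matrix.mul_diagonal, Matrix.diagonal_mul, mul_comm, ← sub_eq_zero, ← sub_mul] at this
      rw [Matrix.diagonal_apply_ne _ hij]
      exact (mul_eq_zero.1 this).resolve_left
        (sub_ne_zero.2 fun h' => hij (h.injective h').symm)
  rw [← h4, hN, ← Matrix.mul_assoc, ← Matrix.mul_assoc, GL_mul_inv_val, Matrix.one_mul]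

lemma IsFrame.commute (h : IsFrame τ P t) {M N : Matrix (Fin 3) (Fin 3) k}
    (hM : Commute M τ) (hN : Commute N τ) : Commute M N := by
  obtain ⟨m, hm⟩ := h.exists_diagonal hM
  obtain ⟨n, hn⟩ := h.exists_diagonal hN
  have h1 : M * N * P.val = N * M * P.val := by
    rw [Matrix.mul_assoc, hn, ← Matrix.mul_assoc, hm, Matrix.mul_assoc, Matrix.mul_assoc N, hm,
      ← Matrix.mul_assoc N, hn, Matrix.mul_assoc, Matrix.diagonal_mul_diagonal,
      Matrix.diagonal_mul_diagonal]
    simp only [mul_comm]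
  have := congrArg (· * (P⁻¹).val) h1
  change M * N = N * M
  simpa only [Matrix.mul_assoc, GL_mul_inv_val, Matrix.mul_one] using this

/-- Orthonormality says P⁻¹ = PᵗJ, so M = P D PᵗJ is visibly symmetric. This is what reduces the
orthogonality condition on the torus to g² = 1. -/
lemma antitranspose_eq_of_mul_eq (hP : P.valᵀ * (J k).val * P.val = 1)
    {M : Matrix (Fin 3) (Fin 3) k} {d : Fin 3 → k}
    (hM : M * P.val = P.val * Matrix.diagonal d) : antitranspose M = M := by
  have h1 : (P⁻¹).val = P.valᵀ * (J k).val := by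
    calc (P⁻¹).val = P.valᵀ * (J k).val * P.val * (P⁻¹).val := by rw [hP, Matrix.one_mul]
      _ = _ := by rw [Matrix.mul_assoc _ P.val, GL_mul_inv_val, Matrix.mul_one]
  rw [(mul_eq_mul_diagonal_iff P M d).1 hM, h1]
  simp only [antitranspose, Matrix.transpose_mul, Matrix.transpose_transpose, J_transpose,
    Matrix.diagonal_transpose, ← Matrix.mul_assoc, J_mul_J, Matrix.one_mul]

lemma IsFrame.antitranspose_eq (h : IsFrame τ P t) {M : Matrix (Fin 3) (Fin 3) k}
    (hM : Commute M τ) : antitranspose M = M := by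
  obtain ⟨d, hd⟩ := h.exists_diagonal hM
  exact antitranspose_eq_of_mul_eq h.orthonormal hd

lemma det_of_mul_eq (P : GL (Fin 3) k) {M : Matrix (Fin 3) (Fin 3) k} {d : Fin 3 → k}
    (hM : M * P.val = P.val * Matrix.diagonal d) : M.det = ∏ i, d i := by
  have := congrArg Matrix.det hM
  rw [Matrix.det_mul, Matrix.det_mul, Matrix.det_diagonal, mul_comm] at this
  have hP : P.val.det ≠ 0 := (Matrix.isUnit_iff_isUnit_det _).1 P.isUnit |>.ne_zero
  exact mul_left_cancel₀ hP this

lemma mul_eq_of_mul_mul_eq (P : GL (Fin 3) k) {M N : Matrix (Fin 3) (Fin 3) k} {m n : Fin 3 → k}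
    (hM : M * P.val = P.val * Matrix.diagonal m) (hN : N * P.val = P.val * Matrix.diagonal n) :
    M * N * P.val = P.val * Matrix.diagonal (fun i => m i * n i) := by
  rw [Matrix.mul_assoc, hN, ← Matrix.mul_assoc, hM, Matrix.mul_assoc,
    Matrix.diagonal_mul_diagonal]

lemma diagonal_injective (P : GL (Fin 3) k) {M : Matrix (Fin 3) (Fin 3) k} {m n : Fin 3 → k}
    (hM : M * P.val = P.val * Matrix.diagonal m) (hN : M * P.val = P.val * Matrix.diagonal n) :
    m = n := by
  have h : Matrix.diagonal m = Matrix.diagonal n := by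
    have h1 := congrArg ((P⁻¹).val * ·) (hM.symm.trans hN)
    simpa only [← Matrix.mul_assoc, GL_inv_mul_val, Matrix.one_mul] using h1
  exact Matrix.diagonal_injective h

/-- A symmetric matrix with distinct eigenvalues over an algebraically closed field has an
orthonormal eigenbasis. -/
theorem exists_isFrame [IsAlgClosed k] (ht : Function.Injective t)
    (hτ : antitranspose τ = τ)
    (hχ : τ.charpoly = ∏ i, (Polynomial.X - Polynomial.C (t i))) :
    ∃ P, IsFrame τ P t := by
  have hJτ : τᵀ * (J k).val = (J k).val * τ := by
    conv_rhs => rw [← hτ, antitranspose, ← Matrix.mul_assoc, ← Matrix.mul_assoc, J_mul_J,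
      Matrix.one_mul]
  have hv : ∀ i, ∃ v : Fin 3 → k, v ≠ 0 ∧ τ *ᵥ v = t i • v := by
    intro i
    have h0 : (Matrix.scalar (Fin 3) (t i) - τ).det = 0 := by
      rw [← Matrix.eval_charpoly, hχ, Polynomial.eval_prod]
      exact Finset.prod_eq_zero (Finset.mem_univ i) (by simp)
    obtain ⟨v, hv0, hv⟩ := Matrix.exists_mulVec_eq_zero_iff.2 h0
    refine ⟨v, hv0, ?_⟩
    rw [Matrix.sub_mulVec, sub_eq_zero] at hv
    rw [← hv]
    ext j
    simp [Matrix.mulVec_diagonal]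
  choose v hv0 hv using hv
  let V : Matrix (Fin 3) (Fin 3) k := (Matrix.of v)ᵀ
  have hcol : ∀ i, V.col i = v i := fun i => rfl
  have hVτ : τ * V = V * Matrix.diagonal t := by
    ext i j
    rw [Matrix.mul_diagonal, mul_comm]
    exact congrFun (hv j) i
  have hVu : IsUnit V := by
    rw [← Matrix.linearIndependent_cols_iff_isUnit]
    refine Module.End.eigenvectors_linearIndependent' (Matrix.toLin' τ) t ht v fun i => ?_
    rw [Module.End.hasEigenvector_iff, Module.End.mem_eigenspace_iff]
    exact ⟨by rw [Matrix.toLin'_apply, hv], hv0 i⟩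
  -- τ is self-adjoint for the form J, so eigenvectors with different eigenvalues are orthogonal.
  have hdiag : ∀ i j, i ≠ j → (Vᵀ * (J k).val * V) i j = 0 := by
    have h1 : Matrix.diagonal t * (Vᵀ * (J k).val * V) = Vᵀ * (J k).val * V * Matrix.diagonal t := by
      have h2 : Matrix.diagonal t * Vᵀ = Vᵀ * τᵀ := by
        rw [← Matrix.transpose_mul, hVτ, Matrix.transpose_mul, Matrix.diagonal_transpose]
      rw [← Matrix.mul_assoc, ← Matrix.mul_assoc, h2, Matrix.mul_assoc Vᵀ, hJτ,
        Matrix.mul_assoc _ V, ← hVτ]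
      simp only [Matrix.mul_assoc]
    intro i j hij
    have := congrFun (congrFun h1 i) j
    rw [Matrix.mul_diagonal, Matrix.diagonal_mul, mul_comm _ (t j), ← sub_eq_zero, ← sub_mul]
      at this
    exact (mul_eq_zero.1 this).resolve_left (sub_ne_zero.2 fun h' => hij (ht h'))
  set b : Fin 3 → k := fun i => (Vᵀ * (J k).val * V) i i with hb
  have hVb : Vᵀ * (J k).val * V = Matrix.diagonal b := by
    ext i j
    by_cases hij : i = j
    · simp [hij, hb]
    · rw [hdiag i j hij, Matrix.diagonal_apply_ne _ hij]
  -- The form is nondegenerate and diagonal in this basis, so no eigenvector is isotropic.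
  have hb0 : ∀ i, b i ≠ 0 := by
    have : (Vᵀ * (J k).val * V).det ≠ 0 := by
      have hV := ((Matrix.isUnit_iff_isUnit_det _).1 hVu).ne_zero
      rw [Matrix.det_mul, Matrix.det_mul, Matrix.det_transpose, det_J]
      exact mul_ne_zero (mul_ne_zero hV (neg_ne_zero.2 one_ne_zero)) hV
    rw [hVb, Matrix.det_diagonal, Finset.prod_ne_zero_iff] at this
    exact fun i => this i (Finset.mem_univ i)
  -- Scaling the i-th eigenvector by a square root of 1/bᵢ gives it length one.
  choose r hr using fun i => IsAlgClosed.exists_pow_nat_eq (b i)⁻¹ (n := 2) two_pos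
  have hr0 : ∀ i, r i ≠ 0 := fun i h => by
    have := hr i
    rw [h] at this
    exact inv_ne_zero (hb0 i) (by simpa using this.symm)
  have hPu : IsUnit (V * Matrix.diagonal r) := by
    refine hVu.mul ?_
    rw [Matrix.isUnit_iff_isUnit_det, Matrix.det_diagonal]
    exact IsUnit.mk0 _ (Finset.prod_ne_zero_iff.2 fun i _ => hr0 i)
  obtain ⟨P, hP⟩ := hPu
  refine ⟨P, ht, ?_, ?_⟩
  · rw [hP, ← Matrix.mul_assoc, hVτ, Matrix.mul_assoc, Matrix.mul_assoc,
      Matrix.diagonal_mul_diagonal, Matrix.diagonal_mul_diagonal]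
    simp only [mul_comm]
  · rw [hP, Matrix.transpose_mul, Matrix.diagonal_transpose,
      show Matrix.diagonal r * Vᵀ * (J k).val * (V * Matrix.diagonal r) =
        Matrix.diagonal r * (Vᵀ * (J k).val * V) * Matrix.diagonal r by
        simp only [Matrix.mul_assoc], hVb, Matrix.diagonal_mul_diagonal,
      Matrix.diagonal_mul_diagonal, ← Matrix.diagonal_one]
    congr 1
    ext i
    have := hr i
    have hbi := hb0 i
    field_simp at this
    linear_combination this

/-- Over an algebraically closed field, symmetric matrices with the same distinct eigenvalues are
conjugate under `SO₃`. -/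
theorem IsFrame.exists_conj {τ' : Matrix (Fin 3) (Fin 3) k} {P' : GL (Fin 3) k}
    (h : IsFrame τ P t) (h' : IsFrame τ' P' t) :
    ∃ g ∈ specialOrthogonal k, τ * g.val = g.val * τ' := by
  -- P P'⁻¹ is orthogonal and intertwines τ with τ', but its determinant may be -1. The sign ε
  -- allows it to be replaced by its negative, which in odd dimension has the opposite determinant.
  have key : ∀ ε : k, ε ^ 2 = 1 → ∀ Q : GL (Fin 3) k, Q.val = ε • (P * P'⁻¹).val →
      antitranspose Q.val * Q.val = 1 ∧ τ * Q.val = Q.val * τ' := by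
    intro ε hε Q hQ
    have h1 : (P'⁻¹).val = P'.valᵀ * (J k).val := by
      calc (P'⁻¹).val = P'.valᵀ * (J k).val * P'.val * (P'⁻¹).val := by
            rw [h'.orthonormal, Matrix.one_mul]
        _ = _ := by rw [Matrix.mul_assoc _ P'.val, GL_mul_inv_val, Matrix.mul_one]
    constructor
    · rw [hQ, antitranspose_smul, Matrix.smul_mul, Matrix.mul_smul, smul_smul, ← pow_two, hε,
        one_smul, Units.val_mul, antitranspose_mul]
      have h2 : antitranspose P.val * P.val = (J k).val := by
        rw [antitranspose, Matrix.mul_assoc, Matrix.mul_assoc, ← Matrix.mul_assoc P.valᵀ,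
          h.orthonormal, Matrix.mul_one]
      have h3 : antitranspose (P'⁻¹).val * (J k).val = P'.val := by
        rw [h1, antitranspose, Matrix.transpose_mul, Matrix.transpose_transpose, J_transpose,
          ← Matrix.mul_assoc, J_mul_J, Matrix.one_mul, Matrix.mul_assoc, J_mul_J, Matrix.mul_one]
      rw [Matrix.mul_assoc, ← Matrix.mul_assoc (antitranspose P.val), h2, ← Matrix.mul_assoc, h3,
        GL_mul_inv_val]
    · have h4 : (P'⁻¹).val * τ' = Matrix.diagonal t * (P'⁻¹).val := by
        rw [(mul_eq_mul_diagonal_iff P' τ' t).1 h'.mul_eq, ← Matrix.mul_assoc, ← Matrix.mul_assoc,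
          GL_inv_mul_val, Matrix.one_mul]
      rw [hQ, Matrix.mul_smul, Matrix.smul_mul, Units.val_mul, ← Matrix.mul_assoc, h.mul_eq,
        Matrix.mul_assoc, ← h4, Matrix.mul_assoc]
  obtain ⟨h1, h2⟩ := key 1 (one_pow _) (P * P'⁻¹) (one_smul _ _).symm
  have hdet : (P * P'⁻¹).val.det ^ 2 = 1 := by
    have := congrArg Matrix.det h1
    rw [Matrix.det_mul, antitranspose, Matrix.det_mul, Matrix.det_mul, Matrix.det_transpose,
      det_J, Matrix.det_one] at this
    linear_combination this
  rcases sq_eq_one_iff.1 hdet with h3 | h3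
  · exact ⟨P * P'⁻¹, (mem_specialOrthogonal_iff _).2 ⟨h1, h3⟩, h2⟩
  · have h4 : (-(P * P'⁻¹) : GL (Fin 3) k).val = (-1 : k) • (P * P'⁻¹).val := by simp
    obtain ⟨h5, h6⟩ := key (-1) (by ring) _ h4
    refine ⟨_, (mem_specialOrthogonal_iff _).2 ⟨h5, ?_⟩, h6⟩
    rw [h4, Matrix.det_smul, h3, Fintype.card_fin]
    ring

end Frame

end SymmSpace

/-! ### The torus of matrices commuting with a regular symmetric matrix -/

namespace SymmSpace

section Torus

variable {F : Type*} [Field F] {τ : Matrix (Fin 3) (Fin 3) F}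
  {k : Type*} [Field k] [Algebra F k] {P : GL (Fin 3) k} {t : Fin 3 → k}

lemma map_injective_of_field {A B : Type*} [CommRing A] [CommRing B] {f : A →+* B}
    (hf : Function.Injective f) :
    Function.Injective (Matrix.GeneralLinearGroup.map (n := Fin 3) f) := by
  intro g h hgh
  ext i j
  exact hf (congrArg (fun u : GL (Fin 3) B => u.val i j) hgh)

lemma commute_map {A B : Type*} [CommRing A] [CommRing B] (f : A →+* B)
    {M N : Matrix (Fin 3) (Fin 3) A} (h : Commute M N) : Commute (M.map f) (N.map f) := by
  change M.map f * N.map f = N.map f * M.map f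
  rw [← Matrix.map_mul, h.eq, Matrix.map_mul]

lemma commute_map_iff {A B : Type*} [CommRing A] [CommRing B] {f : A →+* B}
    (hf : Function.Injective f) {M N : Matrix (Fin 3) (Fin 3) A} :
    Commute (M.map f) (N.map f) ↔ Commute M N := by
  refine ⟨fun h => ?_, commute_map f⟩
  have h' : (M * N).map f = (N * M).map f := by rw [Matrix.map_mul, Matrix.map_mul]; exact h
  exact Matrix.map_injective hf h'

/-- Matrices commuting with `τ` commute, over any ring that embeds in a field where `τ` has an
orthonormal eigenbasis. -/
lemma IsFrame.commute_of_map {R : Type*} [CommRing R] {f : R →+* k} (hf : Function.Injective f)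
    {τ : Matrix (Fin 3) (Fin 3) R} (h : IsFrame (τ.map f) P t) {M N : Matrix (Fin 3) (Fin 3) R}
    (hM : Commute M τ) (hN : Commute N τ) : Commute M N :=
  (commute_map_iff hf).1 (h.commute (commute_map f hM) (commute_map f hN))

lemma IsFrame.antitranspose_eq_of_map {R : Type*} [CommRing R] {f : R →+* k}
    (hf : Function.Injective f) {τ : Matrix (Fin 3) (Fin 3) R} (h : IsFrame (τ.map f) P t)
    {M : Matrix (Fin 3) (Fin 3) R} (hM : Commute M τ) : antitranspose M = M := by
  have := h.antitranspose_eq (commute_map f hM)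
  rw [antitranspose_map] at this
  exact Matrix.map_injective hf this

lemma IsFrame.isMulCommutative_torus {R : Type*} [CommRing R] {f : R →+* k}
    (hf : Function.Injective f) {τ : Matrix (Fin 3) (Fin 3) R} (h : IsFrame (τ.map f) P t) :
    IsMulCommutative (torus τ) :=
  ⟨⟨fun a b => Subtype.ext (Units.ext (h.commute_of_map hf a.2 b.2))⟩⟩

open scoped IsMulCommutative in
/-- The square classes of the rational points of the torus. -/
theorem IsFrame.index_squares_torus [ValuativeRel F] [TopologicalSpace F]
    [IsNonarchimedeanLocalField F] [CharZero F] (hp : ringChar 𝓀[F] ≠ 2)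
    (h : IsFrame (τ.map (algebraMap F k)) P t) [IsMulCommutative (torus τ)] :
    (squares (torus τ)).index = twoTorsionCard (torus τ) ^ 2 := by
  have hinj := (algebraMap F k).injective
  -- The torus is the unit group of the centralizer algebra of τ. That algebra is commutative and
  -- reduced because over k it is diagonal in the eigenbasis.
  let L := Subalgebra.centralizer F {τ}
  have hL : ∀ M : Matrix (Fin 3) (Fin 3) F, M ∈ L ↔ Commute M τ := fun M => by
    rw [Subalgebra.mem_centralizer_iff]
    simp only [Set.mem_singleton_iff, forall_eq]
    exact eq_comm
  let : CommRing L :=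
    { (inferInstance : Ring L) with
      mul_comm := fun a b => Subtype.ext
        (h.commute_of_map hinj ((hL _).1 a.2) ((hL _).1 b.2)) }
  have : FiniteDimensional F L := FiniteDimensional.of_injective L.val.toLinearMap
    Subtype.val_injective
  have : IsReduced L := by
    refine (isReduced_iff_pow_one_lt 2 one_lt_two).2 fun x hx => ?_
    have hx2 : (x.1.map (algebraMap F k)) * (x.1.map (algebraMap F k)) = 0 := by
      rw [← Matrix.map_mul, ← pow_two, show x.1 ^ 2 = 0 from congrArg Subtype.val hx]
      simp
    obtain ⟨m, hm⟩ := h.exists_diagonal (commute_map (algebraMap F k) ((hL _).1 x.2))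
    have hmm := mul_eq_of_mul_mul_eq P hm hm
    have h0 : (fun i => m i * m i) = 0 := diagonal_injective P hmm (by rw [hx2]; simp)
    have hm0 : m = 0 := funext fun i => mul_self_eq_zero.1 (congrFun h0 i)
    rw [mul_eq_mul_diagonal_iff, hm0] at hm
    refine Subtype.ext (Matrix.map_injective hinj ?_)
    change x.1.map (algebraMap F k) = (0 : Matrix (Fin 3) (Fin 3) F).map (algebraMap F k)
    rw [hm]
    simp
  let e : Lˣ ≃* torus τ :=
    { toFun := fun u => ⟨Units.map L.val.toMonoidHom u, (hL _).1 u.1.2⟩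
      invFun := fun g =>
        ⟨⟨g.1.val, (hL _).2 g.2⟩, ⟨(g⁻¹).1.val, (hL _).2 (g⁻¹).2⟩,
          Subtype.ext g.1.val_inv, Subtype.ext g.1.inv_val⟩
      left_inv := fun u => by ext; rfl
      right_inv := fun g => by ext; rfl
      map_mul' := fun a b => by ext; rfl }
  rw [← index_squares_congr e, ← twoTorsionCard_congr e]
  exact index_squares_of_isReduced F hp L

variable (k τ) in
/-- The points of the torus over an extension field. -/
abbrev torusOver : Subgroup (GL (Fin 3) k) := torus (τ.map (algebraMap F k))

lemma map_mem_torusOver {g : GL (Fin 3) F} (hg : g ∈ torus τ) :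
    Matrix.GeneralLinearGroup.map (algebraMap F k) g ∈ torusOver τ k :=
  commute_map _ hg

lemma map_algebraMap_map (s : k ≃ₐ[F] k) :
    (τ.map (algebraMap F k)).map (s : k →ₐ[F] k).toRingHom = τ.map (algebraMap F k) := by
  ext i j; simp

instance torusOverAction : MulDistribMulAction (k ≃ₐ[F] k) (torusOver τ k) where
  smul s g := ⟨Matrix.GeneralLinearGroup.map (s : k →ₐ[F] k).toRingHom g,
    by
      have := commute_map (s : k →ₐ[F] k).toRingHom g.2
      rwa [map_algebraMap_map] at this⟩
  one_smul _ := rfl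
  mul_smul _ _ _ := rfl
  smul_one _ := Subtype.ext (map_one _)
  smul_mul _ _ _ := Subtype.ext (map_mul _ _ _)

lemma torusOver_smul_val (s : k ≃ₐ[F] k) (g : torusOver τ k) :
    (s • g).1.val = g.1.val.map s := rfl

lemma isLocallyConstant_apply [Algebra.IsIntegral F k] (x : k) :
    IsLocallyConstant fun s : k ≃ₐ[F] k => s x := by
  rw [IsLocallyConstant.iff_exists_open]
  intro s
  refine ⟨_, (stabilizer_isOpen_of_isIntegral (K := F) x).leftCoset s,
    mem_own_leftCoset (MulAction.stabilizer (k ≃ₐ[F] k) x).toSubmonoid s, ?_⟩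
  rintro _ ⟨u, hu, rfl⟩
  change s (u x) = s x
  congr 1

lemma isLocallyConstant_smul [Algebra.IsIntegral F k] (g : torusOver τ k) :
    IsLocallyConstant fun s : k ≃ₐ[F] k => s • g := by
  rw [IsLocallyConstant.iff_exists_open]
  intro s
  refine ⟨⋂ i, ⋂ j, {u | u (g.1.val i j) = s (g.1.val i j)},
    isOpen_iInter_of_finite fun i => isOpen_iInter_of_finite fun j =>
      (isLocallyConstant_apply (F := F) (g.1.val i j)).isOpen_fiber _, ?_, ?_⟩
  · simp
  · intro u hu
    simp only [Set.mem_iInter, Set.mem_ofPred_eq] at hu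
    ext i j
    exact hu i j

/-- Each sum is an F-linear map in c, nonzero by independence of characters because its coefficient
at σ = 1 is nonzero. Over an infinite field E is not a finite union of proper subspaces, so one c
avoids all the kernels. -/
lemma exists_algEquiv_sum_ne_zero [Infinite F] (E : IntermediateField F k) [FiniteDimensional F E]
    {ι : Type*} [Finite ι] (ε : ι → (E ≃ₐ[F] E) → k) (hε : ∀ i, ε i 1 ≠ 0) :
    ∃ c : E, ∀ i, ∑ σ : E ≃ₐ[F] E, ε i σ * (σ c : k) ≠ 0 := by
  let f : ι → E →ₗ[F] k := fun i => ∑ σ : E ≃ₐ[F] E,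
    (LinearMap.mulLeft F (ε i σ)).comp (E.val.toLinearMap.comp σ.toLinearMap)
  have hf : ∀ i c, f i c = ∑ σ : E ≃ₐ[F] E, ε i σ * (σ c : k) := fun i c => by
    simp [f, LinearMap.sum_apply]
  by_contra! hcon
  have hcover : ⋃ i, (LinearMap.ker (f i) : Set E) = Set.univ := by
    refine Set.eq_univ_of_forall fun c => ?_
    obtain ⟨i, hi⟩ := hcon c
    exact Set.mem_iUnion.2 ⟨i, by rw [SetLike.mem_coe, LinearMap.mem_ker, hf, hi]⟩
  obtain ⟨i, hi⟩ := Subspace.exists_eq_top_of_iUnion_eq_univ hcover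
  have hli := (linearIndependent_monoidHom E k).comp
    (fun σ : E ≃ₐ[F] E => ((E.val : E →* k).comp (σ : E →* E))) (fun σ σ' h => by
      ext x
      exact DFunLike.congr_fun h x)
  rw [Fintype.linearIndependent_iff] at hli
  refine hε i (hli (ε i) ?_ 1)
  ext c
  have : f i c = 0 := by rw [← LinearMap.mem_ker, hi]; trivial
  rw [hf] at this
  simpa using this

/-- Hilbert 90 for the torus of matrices commuting with `τ`. -/
theorem IsFrame.hilbert90 [Infinite F] [Normal F k] (h : IsFrame (τ.map (algebraMap F k)) P t)
    (a : Cocycle (k ≃ₐ[F] k) (torusOver τ k)) :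
    ∃ b : torusOver τ k, ∀ s, a.toFun s = b * (s • b)⁻¹ := by
  have ha1 : a.toFun 1 = 1 := by
    have := a.map_mul 1 1
    rw [one_smul, mul_one] at this
    exact left_eq_mul.1 this
  -- By local constancy the cocycle is trivial on the subgroup fixing some finite normal E, hence
  -- factors through the Galois group of E.
  have hopen : {s | a.toFun s = 1} ∈ nhds (1 : k ≃ₐ[F] k) :=
    (a.locallyConstant.isOpen_fiber 1).mem_nhds ha1
  rw [krullTopology_mem_nhds_one_iff_of_normal] at hopen
  obtain ⟨E, _, _, hE⟩ := hopen
  choose ℓ hℓ using AlgEquiv.restrictNormalHom_surjective (F := F) (K₁ := E) k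
  have hℓE : ∀ σ (c : E), ℓ σ (c : k) = (σ c : k) := fun σ c => by
    conv_rhs => rw [← hℓ σ]
    exact (AlgEquiv.restrictNormal_apply E (ℓ σ) c).symm
  have hfac : ∀ s s' : k ≃ₐ[F] k, (∀ c : E, s c = s' c) → a.toFun s = a.toFun s' := by
    intro s s' hss
    have h1 : s'⁻¹ * s ∈ E.fixingSubgroup := by
      rw [IntermediateField.mem_fixingSubgroup_iff]
      intro c hc
      change s'.symm (s c) = c
      rw [hss ⟨c, hc⟩]
      simp
    have h2 : a.toFun (s'⁻¹ * s) = 1 := hE h1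
    calc a.toFun s = a.toFun (s' * (s'⁻¹ * s)) := by rw [mul_inv_cancel_left]
      _ = a.toFun s' := by rw [a.map_mul, h2, smul_one, mul_one]
  choose ε hε using fun s => h.exists_diagonal (a.toFun s).2
  have hε0 : ∀ s i, ε s i ≠ 0 := by
    intro s
    have h1 := det_of_mul_eq P (hε s)
    have h2 : (a.toFun s).1.val.det ≠ 0 :=
      ((Matrix.isUnit_iff_isUnit_det _).1 (a.toFun s).1.isUnit).ne_zero
    rw [h1, Finset.prod_ne_zero_iff] at h2
    exact fun i => h2 i (Finset.mem_univ i)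
  obtain ⟨c, hc⟩ := exists_algEquiv_sum_ne_zero E (fun i σ => ε (ℓ σ) i) (fun i => hε0 _ i)
  -- The Poincaré series of the cocycle at c. In the eigenbasis it is diagonal, and c was chosen so
  -- that no diagonal entry vanishes.
  let B : Matrix (Fin 3) (Fin 3) k := ∑ σ : E ≃ₐ[F] E, (σ c : k) • (a.toFun (ℓ σ)).1.val
  have hBP : B * P.val = P.val * Matrix.diagonal fun i => ∑ σ : E ≃ₐ[F] E, ε (ℓ σ) i * (σ c : k) := by
    rw [Finset.sum_mul]
    simp only [Matrix.smul_mul, hε]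
    rw [show (Matrix.diagonal fun i => ∑ σ : E ≃ₐ[F] E, ε (ℓ σ) i * (σ c : k)) =
      ∑ σ : E ≃ₐ[F] E, (σ c : k) • Matrix.diagonal (ε (ℓ σ)) by
        ext i j
        rw [Matrix.sum_apply]
        by_cases hij : i = j
        · simp [hij, mul_comm]
        · simp [hij], Finset.mul_sum]
    simp only [Matrix.mul_smul]
  have hBu : IsUnit B := by
    rw [Matrix.isUnit_iff_isUnit_det, det_of_mul_eq P hBP]
    exact IsUnit.mk0 _ (Finset.prod_ne_zero_iff.2 fun i _ => hc i)
  obtain ⟨b, hb⟩ := hBu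
  have hbT : b ∈ torusOver τ k := by
    rw [mem_torus, hb]
    exact Commute.sum_left _ _ _ fun σ _ => Commute.smul_left (a.toFun (ℓ σ)).2 _
  refine ⟨⟨b, hbT⟩, fun s => ?_⟩
  rw [eq_mul_inv_iff_mul_eq]
  ext1
  ext1
  rw [Subgroup.coe_mul, Units.val_mul, torusOver_smul_val]
  change (a.toFun s).1.val * b.val.map s = b.val
  rw [hb]
  have h1 : B.map s = ∑ σ : E ≃ₐ[F] E, s (σ c : k) • (s • a.toFun (ℓ σ)).1.val := by
    have : ∀ M : Matrix (Fin 3) (Fin 3) k, s.toRingEquiv.toRingHom.mapMatrix M = M.map s := fun M => rfl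
    rw [← this, map_sum]
    refine Finset.sum_congr rfl fun σ _ => ?_
    ext i j
    simp [torusOver_smul_val]
  rw [h1, Finset.mul_sum]
  -- The cocycle identity turns a(s) · s(B) into the same sum reindexed by σ ↦ sσ.
  refine Fintype.sum_equiv (Equiv.mulLeft (AlgEquiv.restrictNormalHom E s)) _ _ fun σ => ?_
  have h2 : ((AlgEquiv.restrictNormalHom E s * σ) c : k) = s (σ c : k) :=
    AlgEquiv.restrictNormal_apply E s (σ c)
  have h3 : a.toFun (ℓ (AlgEquiv.restrictNormalHom E s * σ)) = a.toFun s * s • a.toFun (ℓ σ) := by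
    rw [← a.map_mul]
    refine hfac _ _ fun c => ?_
    rw [hℓE]
    change _ = s (ℓ σ c)
    rw [hℓE]
    exact AlgEquiv.restrictNormal_apply E s (σ c)
  rw [Equiv.coe_mulLeft, h2, h3, Matrix.mul_smul]
  rfl

end Torus

end SymmSpace

/-! ### Cohomology of the stabilizer -/

namespace SymmSpace

section StabilizerCohomology

variable {F E k : Type u} [Field F] [Field E] [Algebra F E] [Field k] [Algebra F k]
  {τ : Matrix (Fin 3) (Fin 3) F} {P : GL (Fin 3) k} {t : Fin 3 → k} {γ : GL (Fin 3) E}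

lemma exists_map_eq_of_forall_map_eq [IsGalois F k] (x : GL (Fin 3) k)
    (h : ∀ s : k ≃ₐ[F] k, Matrix.GeneralLinearGroup.map (s : k →ₐ[F] k).toRingHom x = x) :
    ∃ y, Matrix.GeneralLinearGroup.map (algebraMap F k) y = x := by
  have key : ∀ g : GL (Fin 3) k,
      (∀ s : k ≃ₐ[F] k, Matrix.GeneralLinearGroup.map (s : k →ₐ[F] k).toRingHom g = g) →
        ∃ M : Matrix (Fin 3) (Fin 3) F, M.map (algebraMap F k) = g.val := by
    intro g hg
    have : ∀ i j, ∃ a, algebraMap F k a = g.val i j := fun i j =>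
      (InfiniteGalois.mem_range_algebraMap_iff_fixed _).2 fun s =>
        congrArg (fun u : GL (Fin 3) k => u.val i j) (hg s)
    choose M hM using this
    exact ⟨Matrix.of M, by ext i j; exact hM i j⟩
  obtain ⟨M, hM⟩ := key x h
  obtain ⟨N, hN⟩ := key x⁻¹ fun s => by rw [map_inv, h]
  have hMN : M * N = 1 := by
    refine Matrix.map_injective (algebraMap F k).injective ?_
    change (M * N).map (algebraMap F k) = (1 : Matrix (Fin 3) (Fin 3) F).map (algebraMap F k)
    rw [Matrix.map_mul, hM, hN, Matrix.map_one _ (map_zero _) (map_one _)]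
    exact x.val_inv
  exact ⟨⟨M, N, hMN, mul_eq_one_comm.1 hMN⟩, Units.ext hM⟩

lemma mem_range_map_iff_smul_eq [IsGalois F k] (x : torusOver τ k) :
    (∃ y ∈ torus τ, Matrix.GeneralLinearGroup.map (algebraMap F k) y = x) ↔
      ∀ s : k ≃ₐ[F] k, s • x = x := by
  constructor
  · rintro ⟨y, -, hy⟩ s
    ext i j
    rw [torusOver_smul_val, ← hy]
    simp
  · intro h
    obtain ⟨y, hy⟩ := exists_map_eq_of_forall_map_eq (F := F) x.1 fun s => congrArg Subtype.val (h s)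
    refine ⟨y, (commute_map_iff (algebraMap F k).injective).1 ?_, hy⟩
    have h1 : y.val.map (algebraMap F k) = x.1.val := congrArg Units.val hy
    rw [h1]
    exact x.2

open scoped IsMulCommutative in
/-- The cohomology of the stabilizer is determined by the two-torsion of the torus. -/
theorem IsFrame.h1IsElementaryTwo [IsAlgClosed k] [IsGalois F k] [CharZero F]
    [ValuativeRel F] [TopologicalSpace F] [IsNonarchimedeanLocalField F]
    (hp : ringChar 𝓀[F] ≠ 2) (h : IsFrame (τ.map (algebraMap F k)) P t)
    (hstab : ∀ g, g ∈ stabilizer F γ k ↔ g ∈ specialOrthogonal k ∧ g ∈ torusOver τ k)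
    (m : ℕ) (hm : twoTorsionCard (torus τ) ^ 2 = 4 * 2 ^ m) :
    H1IsElementaryTwo (k ≃ₐ[F] k) (stabilizer F γ k) m := by
  have hinj := (algebraMap F k).injective
  have := h.isMulCommutative_torus hinj
  have : IsMulCommutative (torusOver τ k) :=
    IsFrame.isMulCommutative_torus (f := RingHom.id k) Function.injective_id (by simpa using! h)
  let ι : stabilizer F γ k →* torusOver τ k :=
    Subgroup.inclusion fun g hg => ((hstab g).1 hg).2
  let d : torusOver τ k →* kˣ := Matrix.GeneralLinearGroup.det.comp (torusOver τ k).subtype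
  have hd : ∀ x, (d x).val = x.1.val.det := fun x => rfl
  have hsymm : ∀ x : torusOver τ k, antitranspose x.1.val = x.1.val :=
    fun x => h.antitranspose_eq x.2
  have hker : IsTwoTorsionKernel (Γ := k ≃ₐ[F] k) ι d :=
    { injective := Subgroup.inclusion_injective _
      smul := fun s x => rfl
      smul_right := fun s x => by
        ext
        exact (RingHom.map_det (s : k →ₐ[F] k).toRingHom x.1.val).symm
      -- Elements of the torus are symmetric, so membership in SO₃ reads x² = 1 and det x = 1.
      mem_range := fun x => by
        have h1 : (∃ a, ι a = x) ↔ x.1 ∈ specialOrthogonal k :=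
          ⟨by rintro ⟨a, rfl⟩; exact ((hstab _).1 a.2).1,
            fun hx => ⟨⟨x.1, (hstab _).2 ⟨hx, x.2⟩⟩, rfl⟩⟩
        rw [h1, mem_specialOrthogonal_iff, hsymm, Subtype.ext_iff, Units.ext_iff, Units.ext_iff]
        exact and_congr_left fun _ => by rw [← pow_two]; rfl }
  -- The rational element -1 has determinant -1 in odd dimension; it absorbs the sign ambiguity of
  -- the determinant of a square root.
  let e : torusOver τ k := ⟨-1, by
    rw [mem_torus, Units.val_neg, Units.val_one]; exact Commute.neg_one_left _⟩
  have he : ∀ s : k ≃ₐ[F] k, s • e = e := fun s => by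
    ext i j
    rw [torusOver_smul_val]
    simp [e, Matrix.one_apply, apply_ite]
  have hde : (d e).val = -1 := by
    rw [hd]
    change (-(1 : Matrix (Fin 3) (Fin 3) k)).det = -1
    rw [Matrix.det_neg, Matrix.det_one, Fintype.card_fin]
    norm_num
  let j : torus τ →* torusOver τ k :=
    ((Matrix.GeneralLinearGroup.map (algebraMap F k)).comp (torus τ).subtype).codRestrict _
      fun g => map_mem_torusOver g.2
  let d₀ : torus τ →* Fˣ := Matrix.GeneralLinearGroup.det.comp (torus τ).subtype
  refine hker.h1IsElementaryTwo (fun b => isLocallyConstant_smul b) ?_ e he ?_ ?_ ?_ j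
    (Units.map (algebraMap F k).toMonoidHom) d₀ ?_ ?_ ?_ ?_ ?_ ?_ m ?_ ?_
  -- Square roots are taken entry by entry in the eigenbasis; the result is still diagonal there,
  -- hence commutes with τ.
  · intro x
    obtain ⟨a, ha⟩ := h.exists_diagonal x.2
    choose r hr using fun i => IsAlgClosed.exists_pow_nat_eq (a i) (n := 2) two_pos
    set M := P.val * Matrix.diagonal r * (P⁻¹).val with hM
    have hMP : M * P.val = P.val * Matrix.diagonal r := (mul_eq_mul_diagonal_iff P M r).2 hM
    have hM2 : M * M = x.1.val := by
      have h1 := mul_eq_of_mul_mul_eq P hMP hMP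
      rw [mul_eq_mul_diagonal_iff] at h1 ha
      rw [h1, ha]
      simp only [← pow_two, hr]
    have hMu : IsUnit M := by
      rw [Matrix.isUnit_iff_isUnit_det]
      have := (Matrix.isUnit_iff_isUnit_det _).1 x.1.isUnit
      rw [← hM2, Matrix.det_mul] at this
      exact isUnit_of_mul_isUnit_left this
    obtain ⟨y, hy⟩ := hMu
    have hMτ : Commute M (τ.map (algebraMap F k)) := by
      rw [(mul_eq_mul_diagonal_iff P M r).1 hMP, (mul_eq_mul_diagonal_iff P _ t).1 h.mul_eq]
      have h1 : ∀ X Y : Matrix (Fin 3) (Fin 3) k,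
          P.val * X * (P⁻¹).val * (P.val * Y * (P⁻¹).val) = P.val * (X * Y) * (P⁻¹).val := by
        intro X Y
        rw [show P.val * X * (P⁻¹).val * (P.val * Y * (P⁻¹).val) =
          P.val * X * ((P⁻¹).val * P.val) * Y * (P⁻¹).val by simp only [Matrix.mul_assoc],
          GL_inv_mul_val, Matrix.mul_one, Matrix.mul_assoc P.val X Y]
      change _ * _ = _ * _
      rw [h1, h1, Matrix.diagonal_mul_diagonal, Matrix.diagonal_mul_diagonal]
      simp only [mul_comm]
    refine ⟨⟨y, by rw [mem_torus, hy]; exact hMτ⟩, ?_⟩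
    ext1
    ext1
    rw [pow_two]
    change y.val * y.val = _
    rw [hy, hM2]
  · ext i j
    simp [e]
  · intro x hx
    have h1 : (x : k) ^ 2 = 1 := by rw [← Units.val_pow_eq_pow_val, hx, Units.val_one]
    rcases sq_eq_one_iff.1 h1 with h2 | h2
    · exact Or.inl (Units.ext h2)
    · exact Or.inr (Units.ext (h2.trans hde.symm))
  · intro a
    obtain ⟨b, hb⟩ := h.hilbert90 ⟨fun s => ι (a.toFun s), a.locallyConstant.comp _, fun s t => by
      rw [a.map_mul, map_mul]; rfl⟩
    exact ⟨b, hb⟩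
  · intro x y hxy
    exact Subtype.ext (map_injective_of_field hinj (congrArg Subtype.val hxy))
  · exact Units.map_injective hinj
  · intro x
    rw [← mem_range_map_iff_smul_eq]
    constructor
    · rintro ⟨y, rfl⟩
      exact ⟨y.1, y.2, rfl⟩
    · rintro ⟨y, hy, hxy⟩
      exact ⟨⟨y, hy⟩, Subtype.ext hxy⟩
  · intro x
    constructor
    · rintro ⟨y, rfl⟩ s
      ext
      simp
    · intro hx
      obtain ⟨y, hy⟩ := (InfiniteGalois.mem_range_algebraMap_iff_fixed (k := F) x.val).2
        fun s => congrArg Units.val (hx s)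
      have hy0 : y ≠ 0 := by
        rintro rfl
        exact x.ne_zero (by rw [← hy, map_zero])
      exact ⟨Units.mk0 y hy0, Units.ext hy⟩
  · intro x
    ext
    exact (RingHom.map_det (algebraMap F k) x.1.val).symm
  -- The scalar matrix f has determinant f³ = f · f².
  · intro f
    refine ⟨⟨Units.map (algebraMap F (Matrix (Fin 3) (Fin 3) F)).toMonoidHom f, ?_⟩, f, ?_⟩
    · exact Algebra.commutes f.val τ
    · ext
      change (algebraMap F (Matrix (Fin 3) (Fin 3) F) f.val).det = _
      rw [Algebra.algebraMap_eq_smul_one, Matrix.det_smul, Matrix.det_one]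
      simp
      ring
  · rw [IsNonarchimedeanLocalField.index_squares F hp F]
    norm_num
  · rw [h.index_squares_torus hp, hm, IsNonarchimedeanLocalField.index_squares F hp F]

end StabilizerCohomology

end SymmSpace

/-! ### The Cayley transform -/

namespace SymmSpace

/-! ### Trace-zero generators of a quadratic extension -/

section Quadratic

variable {F E : Type*} [Field F] [Field E] [Algebra F E]

/-- A nonzero element `ξ` with `θ(ξ) = -ξ` and `E = F ⊕ F ξ`. -/
structure IsImaginary (θ : E ≃ₐ[F] E) (ξ : E) : Prop where
  ne_zero : ξ ≠ 0
  map_eq : θ ξ = -ξ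
  exists_eq : ∀ e, ∃ a b : F, e = algebraMap F E a + algebraMap F E b * ξ

/-- In characteristic zero a nonzero trace-zero element lies outside F, so 1, ξ is a basis. If ξ² =
p + qξ then the trace of ξ is q; hence ξ² is in F, and θ(ξ) = ±ξ with the sign + excluded by θ ≠ 1.
-/
lemma isImaginary_of_trace_eq_zero [CharZero F] (hE : Module.finrank F E = 2) {θ : E ≃ₐ[F] E}
    (hθ : θ ≠ 1) {ξ : E} (hξ0 : ξ ≠ 0) (hξ : Algebra.trace F E ξ = 0) : IsImaginary θ ξ := by
  have : FiniteDimensional F E := Module.finite_of_finrank_pos (by omega)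
  have hnot : ∀ a, ξ ≠ algebraMap F E a := by
    rintro a rfl
    rw [Algebra.trace_algebraMap, hE] at hξ
    apply hξ0
    have : a = 0 := by simpa using hξ
    rw [this, map_zero]
  have hli : LinearIndependent F ![1, ξ] := by
    rw [LinearIndependent.pair_iff]
    intro s t hst
    by_cases ht : t = 0
    · subst ht
      simpa using hst
    · exfalso
      refine hnot (-(t⁻¹ * s)) ?_
      have : t • ξ = -(s • 1) := by rw [eq_neg_iff_add_eq_zero, add_comm, hst]
      rw [← inv_smul_smul₀ ht ξ, this, Algebra.algebraMap_eq_smul_one, smul_neg, smul_smul, neg_smul]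
  have hspan : Submodule.span F (Set.range ![1, ξ]) = ⊤ :=
    hli.span_eq_top_of_card_eq_finrank (by simp [hE])
  have hex : ∀ e, ∃ a b : F, e = algebraMap F E a + algebraMap F E b * ξ := by
    intro e
    have he : e ∈ Submodule.span F (Set.range ![1, ξ]) := by rw [hspan]; trivial
    rw [Matrix.range_cons_cons_empty, Submodule.mem_span_pair] at he
    obtain ⟨a, b, rfl⟩ := he
    exact ⟨a, b, by rw [Algebra.algebraMap_eq_smul_one, Algebra.smul_def b]⟩
  obtain ⟨p, q, hpq⟩ := hex (ξ ^ 2)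
  have hq : q = 0 := by
    let b := Module.Basis.mk hli hspan.ge
    have hb0 : b 0 = 1 := by simp [b]
    have hb1 : b 1 = ξ := by simp [b]
    have h1 : b.repr (ξ * b 0) 0 = 0 := by
      rw [hb0, mul_one, ← hb1, b.repr_self]; simp
    have h2 : b.repr (ξ * b 1) 1 = q := by
      have : ξ * b 1 = p • b 0 + q • b 1 := by
        rw [hb0, hb1, ← pow_two, hpq, Algebra.algebraMap_eq_smul_one, Algebra.smul_def q]
      rw [this, map_add, map_smul, map_smul, b.repr_self, b.repr_self]
      simp
    rw [Algebra.trace_eq_matrix_trace b, Matrix.trace_fin_two, Algebra.leftMulMatrix_eq_repr_mul,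
      Algebra.leftMulMatrix_eq_repr_mul, h1, h2, zero_add] at hξ
    exact hξ
  refine ⟨hξ0, ?_, hex⟩
  have hsq : θ ξ ^ 2 = ξ ^ 2 := by
    rw [← map_pow, hpq, hq, map_zero, zero_mul, add_zero, AlgEquiv.commutes]
  refine (sq_eq_sq_iff_eq_or_eq_neg.1 hsq).resolve_left fun h => hθ ?_
  ext e
  obtain ⟨a, b, rfl⟩ := hex e
  simp [h]

variable {θ : E ≃ₐ[F] E} {ξ : E}

lemma IsImaginary.map_map (h : IsImaginary θ ξ) (e : E) : θ (θ e) = e := by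
  obtain ⟨a, b, rfl⟩ := h.exists_eq e
  simp [h.map_eq]

lemma IsImaginary.exists_algebraMap_eq [CharZero F] (h : IsImaginary θ ξ) {e : E} (he : θ e = e) :
    ∃ a, algebraMap F E a = e := by
  have : CharZero E := charZero_of_injective_algebraMap (algebraMap F E).injective
  obtain ⟨a, b, rfl⟩ := h.exists_eq e
  refine ⟨a, ?_⟩
  simp only [map_add, map_mul, AlgEquiv.commutes, h.map_eq] at he
  have : 2 * (algebraMap F E b * ξ) = 0 := by linear_combination -he
  rw [(mul_eq_zero.1 this).resolve_left two_ne_zero, add_zero]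

lemma IsImaginary.exists_sq_eq [CharZero F] (h : IsImaginary θ ξ) :
    ∃ u, algebraMap F E u = ξ ^ 2 :=
  h.exists_algebraMap_eq (by rw [map_pow, h.map_eq, neg_sq])

lemma IsImaginary.algebraMap_add_ne_zero [CharZero F] (h : IsImaginary θ ξ) (a : F) :
    algebraMap F E a + ξ ≠ 0 := by
  have : CharZero E := charZero_of_injective_algebraMap (algebraMap F E).injective
  intro h0
  have h1 := congrArg θ h0
  rw [map_add, AlgEquiv.commutes, h.map_eq, map_zero] at h1
  have : 2 * ξ = 0 := by linear_combination h0 - h1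
  exact h.ne_zero ((mul_eq_zero.1 this).resolve_left two_ne_zero)

end Quadratic

/-! ### The transform from the symmetric space to symmetric matrices over `F` -/

section Cayley

variable {F E : Type u} [Field F] [Field E] [Algebra F E]

/-- The relation `τ = ξ (1 + cγ) / (1 - cγ)`. -/
def IsCayley (c ξ : E) (γ : Matrix (Fin 3) (Fin 3) E) (τ : Matrix (Fin 3) (Fin 3) F) : Prop :=
  (1 - c • γ) * (τ.map (algebraMap F E) + ξ • (1 : Matrix (Fin 3) (Fin 3) E)) = (2 * ξ) • (1 : Matrix (Fin 3) (Fin 3) E)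

lemma map_smul_matrix {A B : Type*} [CommRing A] [CommRing B] (f : A →+* B) (a : A)
    (M : Matrix (Fin 3) (Fin 3) A) : (a • M).map f = f a • M.map f := by
  ext i j; simp

lemma map_one_matrix {A B : Type*} [CommRing A] [CommRing B] (f : A →+* B) :
    (1 : Matrix (Fin 3) (Fin 3) A).map f = 1 := Matrix.map_one _ (map_zero f) (map_one f)

lemma map_add_matrix {A B : Type*} [CommRing A] [CommRing B] (f : A →+* B)
    (M N : Matrix (Fin 3) (Fin 3) A) : (M + N).map f = M.map f + N.map f := by
  ext i j; simp

lemma map_sub_matrix {A B : Type*} [CommRing A] [CommRing B] (f : A →+* B)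
    (M N : Matrix (Fin 3) (Fin 3) A) : (M - N).map f = M.map f - N.map f := by
  ext i j; simp

lemma map_map_matrix {A B C : Type*} [CommRing A] [CommRing B] [CommRing C] (f : A →+* B)
    (g : B →+* C) (M : Matrix (Fin 3) (Fin 3) A) : (M.map f).map g = M.map (g.comp f) := by
  ext i j; simp

/-- U and W are inverse to each other up to a unit scalar, as are U' and W', and intertwining passes
to inverses. -/
lemma intertwine_of_mul_eq_smul {A : Type*} [CommRing A] {U W U' W' g : Matrix (Fin 3) (Fin 3) A}
    {s : A} (hs : IsUnit s) (h : U * W = s • (1 : Matrix (Fin 3) (Fin 3) A)) (h' : U' * W' = s • (1 : Matrix (Fin 3) (Fin 3) A)) :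
    U * g = g * U' ↔ W * g = g * W' := by
  obtain ⟨s, rfl⟩ := hs
  have comm : ∀ {X Y : Matrix (Fin 3) (Fin 3) A}, X * Y = (s : A) • (1 : Matrix (Fin 3) (Fin 3) A) → Y * X = (s : A) • (1 : Matrix (Fin 3) (Fin 3) A) := by
    intro X Y hXY
    have h1 : X * ((↑s⁻¹ : A) • Y) = 1 := by
      rw [Matrix.mul_smul, hXY, smul_smul, Units.inv_mul, one_smul]
    have h2 := mul_eq_one_comm.1 h1
    rw [Matrix.smul_mul] at h2
    rw [← h2, smul_smul, Units.mul_inv, one_smul]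
  have key : ∀ {U W U' W' : Matrix (Fin 3) (Fin 3) A}, U * W = (s : A) • (1 : Matrix (Fin 3) (Fin 3) A) →
      U' * W' = (s : A) • (1 : Matrix (Fin 3) (Fin 3) A) → U * g = g * U' → W * g = g * W' := by
    intro U W U' W' h h' hg
    have h1 : W * (U * g) * W' = W * (g * U') * W' := by rw [hg]
    rw [← Matrix.mul_assoc, comm h, Matrix.mul_assoc W, Matrix.mul_assoc g, h', Matrix.smul_mul,
      Matrix.one_mul, Matrix.smul_mul, Matrix.mul_smul, Matrix.mul_smul, Matrix.mul_one] at h1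
    have := congrArg (fun M => (↑s⁻¹ : A) • M) h1
    simpa [smul_smul] using this.symm
  exact ⟨key h h', key (comm h) (comm h')⟩

/-- Intertwining `γ` and `γ'` is the same as intertwining their Cayley transforms. -/
lemma IsCayley.intertwine_iff [CharZero F] {c ξ : E} (hc : c ≠ 0) (hξ : ξ ≠ 0)
    {γ γ' : Matrix (Fin 3) (Fin 3) E} {τ τ' : Matrix (Fin 3) (Fin 3) F} (h : IsCayley c ξ γ τ)
    (h' : IsCayley c ξ γ' τ') {A : Type*} [CommRing A] (f : E →+* A)
    (g : Matrix (Fin 3) (Fin 3) A) :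
    γ.map f * g = g * γ'.map f ↔
      τ.map (f.comp (algebraMap F E)) * g = g * τ'.map (f.comp (algebraMap F E)) := by
  have : CharZero E := charZero_of_injective_algebraMap (algebraMap F E).injective
  have hmap : ∀ {γ : Matrix (Fin 3) (Fin 3) E} {τ : Matrix (Fin 3) (Fin 3) F}, IsCayley c ξ γ τ →
      (1 - f c • γ.map f) * (τ.map (f.comp (algebraMap F E)) + f ξ • (1 : Matrix (Fin 3) (Fin 3) A)) = f (2 * ξ) • (1 : Matrix (Fin 3) (Fin 3) A) := by
    intro γ τ h
    have := congrArg (fun M => M.map f) h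
    simpa only [Matrix.map_mul, map_smul_matrix, map_add_matrix, map_sub_matrix, map_one_matrix,
      map_map_matrix] using this
  have hs : IsUnit (f (2 * ξ)) := (IsUnit.mk0 _ (mul_ne_zero two_ne_zero hξ)).map f
  have key := intertwine_of_mul_eq_smul (g := g) hs (hmap h) (hmap h')
  have h1 : (1 - f c • γ.map f) * g = g * (1 - f c • γ'.map f) ↔ γ.map f * g = g * γ'.map f := by
    rw [Matrix.sub_mul, Matrix.mul_sub, Matrix.one_mul, Matrix.mul_one, sub_right_inj,
      Matrix.smul_mul, Matrix.mul_smul]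
    exact ((IsUnit.mk0 _ hc).map f).smul_left_cancel
  have h2 : (τ.map (f.comp (algebraMap F E)) + f ξ • (1 : Matrix (Fin 3) (Fin 3) A)) * g = g * (τ'.map (f.comp (algebraMap F E)) + f ξ • (1 : Matrix (Fin 3) (Fin 3) A)) ↔
      τ.map (f.comp (algebraMap F E)) * g = g * τ'.map (f.comp (algebraMap F E)) := by
    rw [Matrix.add_mul, Matrix.mul_add, Matrix.smul_mul, Matrix.mul_smul, Matrix.one_mul,
      Matrix.mul_one, add_left_inj]
  rw [← h1, key, h2]

/-- An element of the symmetric space has a rational symmetric Cayley transform. -/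
theorem exists_isCayley [CharZero F] {θ : E ≃ₐ[F] E} {ξ : E} (h : IsImaginary θ ξ) {c : E}
    (hc : θ c * c = 1) {γ : GL (Fin 3) E} (hγ : γ ∈ symmPoints θ)
    (hu : IsUnit (1 - c • γ.val)) :
    ∃ τ : Matrix (Fin 3) (Fin 3) F, antitranspose τ = τ ∧ IsCayley c ξ γ.val τ := by
  obtain ⟨hsym, hunit⟩ := (mem_symm_iff _ _).1 hγ
  obtain ⟨u, hu⟩ := hu
  set w := (u⁻¹).val with hw
  have huw : (1 - c • γ.val) * w = 1 := by rw [← hu]; exact u.mul_inv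
  have hwu : w * (1 - c • γ.val) = 1 := by rw [← hu]; exact u.inv_mul
  -- With c̄c = 1 and γ̄γ = 1, the product (1 - c̄γ̄)(-cγ) equals 1 - cγ, so the conjugate of w = (1
  -- - cγ)⁻¹ is -cγw = 1 - w.
  have hθu : (1 - c • γ.val).map θ * (-(c • γ.val) * w) = 1 := by
    have h1 : (1 - c • γ.val).map θ = 1 - θ c • γ.val.map θ := by
      rw [show ((1 - c • γ.val).map θ : Matrix (Fin 3) (Fin 3) E) =
        (1 - c • γ.val).map (θ : E →+* E) from rfl, map_sub_matrix, map_one_matrix, map_smul_matrix]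
      rfl
    rw [h1, ← Matrix.mul_assoc]
    have h2 : (1 - θ c • γ.val.map θ) * -(c • γ.val) = 1 - c • γ.val := by
      have h3 : γ.val.map θ * γ.val = 1 := hunit
      rw [Matrix.sub_mul, Matrix.one_mul, Matrix.mul_neg, Matrix.smul_mul, Matrix.mul_smul, h3,
        smul_smul, hc, one_smul]
      abel
    rw [h2, huw]
  have hθw : w.map θ = -(c • γ.val) * w := by
    have h1 : w.map θ * (1 - c • γ.val).map θ = 1 := by
      have := congrArg (fun M => M.map (θ : E →+* E)) hwu
      simp only [Matrix.map_mul, map_one_matrix] at this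
      exact this
    calc w.map θ = w.map θ * ((1 - c • γ.val).map θ * (-(c • γ.val) * w)) := by
          rw [hθu, Matrix.mul_one]
      _ = _ := by rw [← Matrix.mul_assoc, h1, Matrix.one_mul]
  have hsum : w.map θ = 1 - w := by
    rw [hθw, ← huw, Matrix.sub_mul, Matrix.one_mul, Matrix.neg_mul]
    abel
  have hwsym : antitranspose w = w := by
    have h1 : antitranspose (1 - c • γ.val) = 1 - c • γ.val := by
      rw [sub_eq_add_neg, ← neg_smul, antitranspose_add, antitranspose_smul, antitranspose_one, hsym]
    have h2 : antitranspose w * (1 - c • γ.val) = 1 := by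
      rw [← h1, ← antitranspose_mul, huw, antitranspose_one]
    calc antitranspose w = antitranspose w * ((1 - c • γ.val) * w) := by rw [huw, Matrix.mul_one]
      _ = w := by rw [← Matrix.mul_assoc, h2, Matrix.one_mul]
  -- From w̄ = 1 - w and ξ̄ = -ξ, the matrix 2ξw - ξ is fixed by θ.
  have hfix : ∀ i j, ∃ a, algebraMap F E a = ((2 * ξ) • w - ξ • (1 : Matrix (Fin 3) (Fin 3) E)) i j := by
    intro i j
    refine h.exists_algebraMap_eq ?_
    have h1 : θ (w i j) = (1 : Matrix (Fin 3) (Fin 3) E) i j - w i j :=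
      congrFun (congrFun hsum i) j
    have h2 : θ ((1 : Matrix (Fin 3) (Fin 3) E) i j) = (1 : Matrix (Fin 3) (Fin 3) E) i j := by
      simp [Matrix.one_apply, apply_ite]
    simp only [Matrix.sub_apply, Matrix.smul_apply, smul_eq_mul, map_sub, map_mul, h1, h2,
      h.map_eq, map_ofNat]
    ring
  choose τ hτ using hfix
  have hτ' : (Matrix.of τ).map (algebraMap F E) = (2 * ξ) • w - ξ • (1 : Matrix (Fin 3) (Fin 3) E) := by
    ext i j; exact hτ i j
  refine ⟨Matrix.of τ, ?_, ?_⟩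
  · refine Matrix.map_injective (algebraMap F E).injective ?_
    change (antitranspose (Matrix.of τ)).map (algebraMap F E) = (Matrix.of τ).map (algebraMap F E)
    rw [← antitranspose_map, hτ', sub_eq_add_neg, ← neg_smul, antitranspose_add,
      antitranspose_smul, antitranspose_smul, hwsym, antitranspose_one]
  · rw [IsCayley, hτ', sub_add_cancel, Matrix.mul_smul, huw]

lemma exists_prod_X_sub_C_eq {k : Type*} [Field k] [IsAlgClosed k] {p : Polynomial k}
    (hp : p.Monic) (hdeg : p.natDegree = 3) (hsep : p.Separable) :
    ∃ d : Fin 3 → k, Function.Injective d ∧ p = ∏ i, (Polynomial.X - Polynomial.C (d i)) := by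
  have hs := IsAlgClosed.splits p
  have hcard : p.roots.card = 3 := by rw [← hdeg]; exact hs.natDegree_eq_card_roots.symm
  have hnd := Polynomial.nodup_roots hsep
  obtain ⟨a, b, c, habc⟩ := Multiset.card_eq_three.1 hcard
  rw [habc] at hnd
  refine ⟨![a, b, c], ?_, ?_⟩
  · simp at hnd
    obtain ⟨⟨h1, h2⟩, h3⟩ := hnd
    intro i j
    fin_cases i <;> fin_cases j <;> simp_all [eq_comm]
  · conv_lhs => rw [hs.eq_prod_roots_of_monic hp, habc]
    simp [Fin.prod_univ_three, mul_assoc]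

/-- A regular element of the symmetric space has a Cayley transform with an orthonormal
eigenbasis. -/
theorem exists_isCayley_isFrame [CharZero F] {θ : E ≃ₐ[F] E} {ξ : E} (h : IsImaginary θ ξ)
    {k : Type*} [Field k] [Algebra F k] [IsAlgClosed k] (φ : E →ₐ[F] k) {γ : GL (Fin 3) E}
    (hγ : γ ∈ symmPoints θ) (hreg : IsRegularSemisimple γ) :
    ∃ (c : E) (τ : Matrix (Fin 3) (Fin 3) F) (P : GL (Fin 3) k) (t : Fin 3 → k),
      θ c * c = 1 ∧ IsUnit (1 - c • γ.val) ∧ antitranspose τ = τ ∧ IsCayley c ξ γ.val τ ∧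
      IsFrame (τ.map (algebraMap F k)) P t := by
  have : CharZero E := charZero_of_injective_algebraMap (algebraMap F E).injective
  have : CharZero k := charZero_of_injective_algebraMap (algebraMap F k).injective
  have hφ : Function.Injective (φ : E →+* k) := φ.toRingHom.injective
  obtain ⟨hsym, -⟩ := (mem_symm_iff _ _).1 hγ
  obtain ⟨d, hd, hχ⟩ := exists_prod_X_sub_C_eq (p := (γ.val.map (φ : E →+* k)).charpoly)
    (Matrix.charpoly_monic _) (by rw [Matrix.charpoly_natDegree_eq_dim]; simp)
    (by rw [Matrix.charpoly_map]; exact hreg.map)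
  obtain ⟨P, hP⟩ := exists_isFrame hd (by rw [antitranspose_map, hsym]) hχ
  have hξ : φ ξ ≠ 0 := fun h0 => h.ne_zero (hφ (by simpa using h0))
  -- The parameter will be c = (a - ξ)/(a + ξ), which has norm one. The condition 1 - c dᵢ = 0 is
  -- linear in a with at most one solution, so the infinite field F contains an a avoiding all three
  -- eigenvalues.
  obtain ⟨a, ha⟩ : ∃ a : F, ∀ i, algebraMap F k a * (1 - d i) ≠ -φ ξ * (1 + d i) := by
    have hfin : (⋃ i, {a : F | algebraMap F k a * (1 - d i) = -φ ξ * (1 + d i)}).Finite := by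
      refine Set.finite_iUnion fun i => Set.Subsingleton.finite fun a ha b hb => ?_
      have hdi : 1 - d i ≠ 0 := by
        intro h0
        have h1 : d i = 1 := by linear_combination -h0
        have h2 : algebraMap F k a * (1 - d i) = -φ ξ * (1 + d i) := ha
        rw [h0, h1, mul_zero] at h2
        have h3 : φ ξ * 2 = 0 := by linear_combination h2
        exact hξ ((mul_eq_zero.1 h3).resolve_right two_ne_zero)
      exact (algebraMap F k).injective (mul_right_cancel₀ hdi (Eq.trans ha (Eq.symm hb)))
    obtain ⟨a, ha⟩ := hfin.exists_notMem
    exact ⟨a, fun i hi => ha (Set.mem_iUnion.2 ⟨i, hi⟩)⟩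
  have hplus := h.algebraMap_add_ne_zero a
  have hminus : algebraMap F E a - ξ ≠ 0 := by
    intro h0
    have := h.algebraMap_add_ne_zero (-a)
    rw [map_neg] at this
    exact this (by linear_combination -h0)
  set c := (algebraMap F E a - ξ) / (algebraMap F E a + ξ) with hc
  have hcc : θ c * c = 1 := by
    rw [hc, map_div₀, map_sub, map_add, AlgEquiv.commutes, h.map_eq]
    have h1 : algebraMap F E a + -ξ ≠ 0 := by rwa [← sub_eq_add_neg]
    field_simp
    ring
  have hφc : φ c = (algebraMap F k a - φ ξ) / (algebraMap F k a + φ ξ) := by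
    rw [hc, map_div₀, map_sub, map_add, AlgHom.commutes]
  have hplus' : algebraMap F k a + φ ξ ≠ 0 := by
    rw [← AlgHom.commutes φ, ← map_add]
    exact fun h0 => hplus (hφ (by simpa using h0))
  have hcd : ∀ i, 1 - φ c * d i ≠ 0 := by
    intro i h0
    apply ha i
    rw [hφc] at h0
    field_simp at h0
    linear_combination h0
  have hUP : (1 - φ c • γ.val.map (φ : E →+* k)) * P.val =
      P.val * Matrix.diagonal fun i => 1 - φ c * d i := by
    have : (Matrix.diagonal fun i => 1 - φ c * d i) = 1 - φ c • Matrix.diagonal d := by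
      ext i j
      by_cases hij : i = j <;> simp [hij]
    rw [this, Matrix.sub_mul, Matrix.mul_sub, Matrix.smul_mul, hP.mul_eq, Matrix.mul_smul,
      Matrix.one_mul, Matrix.mul_one]
  have hmapU : (1 - c • γ.val).map (φ : E →+* k) = 1 - φ c • γ.val.map (φ : E →+* k) := by
    rw [map_sub_matrix, map_smul_matrix, map_one_matrix]
    rfl
  have hu : IsUnit (1 - c • γ.val) := by
    rw [Matrix.isUnit_iff_isUnit_det]
    refine IsUnit.mk0 _ fun h0 => ?_
    have h1 := det_of_mul_eq P hUP
    rw [← hmapU] at h1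
    have h2 : ((1 - c • γ.val).map (φ : E →+* k)).det = φ (1 - c • γ.val).det :=
      (RingHom.map_det (φ : E →+* k) _).symm
    rw [h2, h0, map_zero] at h1
    exact Finset.prod_ne_zero_iff.2 (fun i _ => hcd i) h1.symm
  obtain ⟨τ, hτsym, hτ⟩ := exists_isCayley h hcc hγ hu
  -- From τ = 2ξ(1 - cγ)⁻¹ - ξ, the eigenvectors of γ serve for τ, with eigenvalues transformed by
  -- the same injective fractional linear map.
  refine ⟨c, τ, P, fun i => 2 * φ ξ / (1 - φ c * d i) - φ ξ, hcc, hu, hτsym, hτ, ?_, ?_,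
    hP.orthonormal⟩
  · intro i j hij
    have h1 := hcd i
    have h2 := hcd j
    have hc0 : φ c ≠ 0 := by
      rw [hφc]
      refine div_ne_zero ?_ hplus'
      rw [← AlgHom.commutes φ, ← map_sub]
      exact fun h0 => hminus (hφ (by simpa using h0))
    have h3 : 2 * φ ξ / (1 - φ c * d i) = 2 * φ ξ / (1 - φ c * d j) := by
      have : 2 * φ ξ / (1 - φ c * d i) - φ ξ = 2 * φ ξ / (1 - φ c * d j) - φ ξ := hij
      linear_combination this
    rw [div_eq_div_iff h1 h2] at h3
    have h4 := mul_left_cancel₀ (mul_ne_zero two_ne_zero hξ) h3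
    refine hd (mul_left_cancel₀ hc0 ?_)
    linear_combination h4
  · set s := 2 * φ ξ with hs
    set V := τ.map (algebraMap F k) + φ ξ • (1 : Matrix (Fin 3) (Fin 3) k) with hV
    set U := 1 - φ c • γ.val.map (φ : E →+* k) with hU
    have hUV : U * V = s • (1 : Matrix (Fin 3) (Fin 3) k) := by
      have := congrArg (fun M => M.map (φ : E →+* k)) hτ
      simp only [Matrix.map_mul, map_smul_matrix, map_add_matrix, map_one_matrix, map_map_matrix,
        hmapU] at this
      have h1 : ((φ : E →+* k).comp (algebraMap F E)) = algebraMap F k := φ.comp_algebraMap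
      have h2 : (φ : E →+* k) (2 * ξ) = s := by
        rw [map_mul, map_ofNat]
        rfl
      rw [h1, h2] at this
      exact this
    have hVP : V * P.val = P.val * Matrix.diagonal fun i => s / (1 - φ c * d i) := by
      have h1 : U * (V * P.val) = U * (P.val * Matrix.diagonal fun i => s / (1 - φ c * d i)) := by
        rw [← Matrix.mul_assoc, hUV, ← Matrix.mul_assoc, hUP, Matrix.mul_assoc,
          Matrix.diagonal_mul_diagonal, Matrix.smul_mul, Matrix.one_mul]
        have : (Matrix.diagonal fun i => (1 - φ c * d i) * (s / (1 - φ c * d i))) =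
            s • (1 : Matrix (Fin 3) (Fin 3) k) := by
          ext i j
          by_cases hij : i = j
          · subst hij
            have := hcd i
            simp only [Matrix.diagonal_apply_eq, Matrix.smul_apply, Matrix.one_apply_eq,
              smul_eq_mul, mul_one]
            field_simp
          · simp [hij]
        rw [this, Matrix.mul_smul, Matrix.mul_one]
      have hUu : IsUnit U := by
        rw [← hmapU]
        exact hu.map (φ : E →+* k).mapMatrix
      exact hUu.mul_left_cancel h1
    have h1 : τ.map (algebraMap F k) = V - φ ξ • (1 : Matrix (Fin 3) (Fin 3) k) := by
      rw [hV, add_sub_cancel_right]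
    have h2 : (Matrix.diagonal fun i => s / (1 - φ c * d i) - φ ξ) =
        (Matrix.diagonal fun i => s / (1 - φ c * d i)) - φ ξ • (1 : Matrix (Fin 3) (Fin 3) k) := by
      ext i j
      by_cases hij : i = j <;> simp [hij]
    rw [h1, h2, Matrix.sub_mul, Matrix.mul_sub, hVP, Matrix.smul_mul, Matrix.mul_smul,
      Matrix.one_mul, Matrix.mul_one]

end Cayley
end SymmSpace

/-! ### Stable classes and two-torsion of the centralizer -/

namespace SymmSpace

section BaseChange

variable {F E : Type u} [Field F] [Field E] [Algebra F E] {R : Type u} [CommRing R] [Algebra F R]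

lemma includeLeft_comp_algebraMap :
    (Algebra.TensorProduct.includeLeft : E →ₐ[F] E ⊗[F] R).toRingHom.comp (algebraMap F E) =
      (Algebra.TensorProduct.includeRight : R →ₐ[F] E ⊗[F] R).toRingHom.comp (algebraMap F R) :=
  (Algebra.TensorProduct.includeLeft : E →ₐ[F] E ⊗[F] R).comp_algebraMap.trans
    (Algebra.TensorProduct.includeRight : R →ₐ[F] E ⊗[F] R).comp_algebraMap.symm

lemma includeRight_injective : Function.Injective
    (Algebra.TensorProduct.includeRight : R →ₐ[F] E ⊗[F] R).toRingHom :=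
  Algebra.TensorProduct.includeRight_injective (algebraMap F E).injective

variable {c ξ : E} {γ γ' : GL (Fin 3) E} {τ τ' : Matrix (Fin 3) (Fin 3) F}

/-- As τ, τ' and g have entries in R, the equation over E ⊗ R descends along the injection of R.
Orbits and stabilizers of γ thus become those of τ over R itself. -/
lemma IsCayley.baseChange_intertwine_iff [CharZero F] (hc : c ≠ 0) (hξ : ξ ≠ 0)
    (h : IsCayley c ξ γ.val τ) (h' : IsCayley c ξ γ'.val τ') (g : GL (Fin 3) R) :
    baseChange R γ * embed F E R g = embed F E R g * baseChange R γ' ↔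
      τ.map (algebraMap F R) * g.val = g.val * τ'.map (algebraMap F R) := by
  rw [Units.ext_iff, Units.val_mul, Units.val_mul]
  refine (h.intertwine_iff hc hξ h' (Algebra.TensorProduct.includeLeft : E →ₐ[F] E ⊗[F] R).toRingHom
    (embed F E R g).val).trans ?_
  rw [includeLeft_comp_algebraMap, ← map_map_matrix, ← map_map_matrix]
  change _ * g.val.map (Algebra.TensorProduct.includeRight : R →ₐ[F] E ⊗[F] R).toRingHom =
    g.val.map (Algebra.TensorProduct.includeRight : R →ₐ[F] E ⊗[F] R).toRingHom * _ ↔ _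
  rw [← Matrix.map_mul, ← Matrix.map_mul]
  exact (Matrix.map_injective includeRight_injective).eq_iff

lemma inv_mul_mul_eq_iff {G : Type*} [Group G] (a b g : G) : g⁻¹ * a * g = b ↔ a * g = g * b := by
  rw [mul_assoc, inv_mul_eq_iff_eq_mul]

lemma IsCayley.mem_stabilizer_iff [CharZero F] {k : Type u} [Field k] [Algebra F k] (hc : c ≠ 0)
    (hξ : ξ ≠ 0) (h : IsCayley c ξ γ.val τ) (g : GL (Fin 3) k) :
    g ∈ stabilizer F γ k ↔ g ∈ specialOrthogonal k ∧ g ∈ torusOver τ k := by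
  refine Subgroup.mem_inf.trans (and_congr_right fun _ => ?_)
  rw [Subgroup.mem_comap, Subgroup.mem_centralizer_singleton_iff, mem_torus]
  have := h.baseChange_intertwine_iff hc hξ h g
  exact ⟨fun h1 => (this.1 h1.symm).symm, fun h1 => (this.2 h1.symm).symm⟩

/-- A stably conjugate element has a Cayley transform with the same parameter. -/
lemma isUnit_of_mem_stableClass {θ : E ≃ₐ[F] E} {k : Type u} [Field k] [Algebra F k]
    (hu : IsUnit (1 - c • γ.val)) (hγ' : γ' ∈ stableClass θ k γ) :
    IsUnit (1 - c • γ'.val) := by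
  obtain ⟨-, g, -, hg⟩ := hγ'
  let f := (Algebra.TensorProduct.includeLeft : E →ₐ[F] E ⊗[F] k).toRingHom
  have hf : Function.Injective f :=
    Algebra.TensorProduct.includeLeft_injective (algebraMap F k).injective
  have hmap : ∀ δ : GL (Fin 3) E, f (1 - c • δ.val).det = (1 - f c • (baseChange k δ).val).det := by
    intro δ
    have h1 : (1 - c • δ.val).map f = 1 - f c • (baseChange k δ).val := by
      rw [map_sub_matrix, map_smul_matrix, map_one_matrix]
      rfl
    rw [← h1]
    exact RingHom.map_det f _
  have hconj : 1 - f c • (baseChange k γ').val =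
      ((embed F E k g)⁻¹).val * (1 - f c • (baseChange k γ).val) * (embed F E k g).val := by
    rw [← hg, Matrix.mul_sub, Matrix.sub_mul, Matrix.mul_one, Matrix.mul_smul, Matrix.smul_mul,
      Units.val_mul, Units.val_mul]
    congr 1
    exact (embed F E k g).inv_val.symm
  have hdet : (1 - c • γ'.val).det = (1 - c • γ.val).det := by
    apply hf
    rw [hmap, hmap, hconj, Matrix.det_mul, Matrix.det_mul, mul_right_comm, ← Matrix.det_mul,
      show ((embed F E k g)⁻¹).val * (embed F E k g).val = 1 from (embed F E k g).inv_val,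
      Matrix.det_one, one_mul]
  rw [Matrix.isUnit_iff_isUnit_det] at hu ⊢
  rwa [hdet]

end BaseChange

/-! ### Two-torsion of the centralizer for each type -/

section Counting

variable {F E : Type u} [Field F] [Field E] [Algebra F E] {θ : E ≃ₐ[F] E} {ξ : E}

/-- The invariants of `θ ⊗ id` on `E ⊗ R` are `R`. -/
lemma IsImaginary.exists_includeRight_eq [CharZero F] (h : IsImaginary θ ξ) {R : Type u}
    [CommRing R] [Algebra F R] {x : E ⊗[F] R} (hx : conj θ R x = x) :
    ∃ r : R, (Algebra.TensorProduct.includeRight : R →ₐ[F] E ⊗[F] R) r = x := by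
  -- Every y + ȳ comes from R, and an invariant element is half of its own such sum.
  have key : ∀ y : E ⊗[F] R,
      ∃ r : R, (Algebra.TensorProduct.includeRight : R →ₐ[F] E ⊗[F] R) r = y + conj θ R y := by
    intro y
    induction y with
    | zero => exact ⟨0, by simp⟩
    | tmul e r =>
      obtain ⟨a, ha⟩ := h.exists_algebraMap_eq (e := e + θ e) (by
        rw [map_add, h.map_map, add_comm])
      refine ⟨a • r, ?_⟩
      have h1 : conj θ R (e ⊗ₜ r) = θ e ⊗ₜ r := by simp [conj]
      rw [h1, ← TensorProduct.add_tmul, ← ha, Algebra.TensorProduct.includeRight_apply,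
        Algebra.algebraMap_eq_smul_one, TensorProduct.smul_tmul]
    | add y z hy hz =>
      obtain ⟨r, hr⟩ := hy
      obtain ⟨s, hs⟩ := hz
      exact ⟨r + s, by rw [map_add, hr, hs, map_add]; abel⟩
  obtain ⟨r, hr⟩ := key x
  refine ⟨(2⁻¹ : F) • r, ?_⟩
  rw [map_smul, hr, hx, ← two_smul F, inv_smul_smul₀ two_ne_zero]

lemma conj_includeRight (R : Type u) [CommRing R] [Algebra F R] (r : R) :
    conj θ R ((Algebra.TensorProduct.includeRight : R →ₐ[F] E ⊗[F] R) r) =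
      (Algebra.TensorProduct.includeRight : R →ₐ[F] E ⊗[F] R) r := by
  simp [conj]

/-- If x x̄ = 1 and x² = 1 then x̄ = x, so x comes from R. -/
lemma IsImaginary.twoTorsionCard_U1 [CharZero F] (h : IsImaginary θ ξ) (R : Type u)
    [CommRing R] [Algebra F R] : twoTorsionCard (U1 θ R) = twoTorsionCard Rˣ := by
  let i : R →ₐ[F] E ⊗[F] R := Algebra.TensorProduct.includeRight
  have hi : Function.Injective i := includeRight_injective
  have hmem : ∀ r : Rˣ, r ^ 2 = 1 → Units.map i.toMonoidHom r ∈ U1 θ R := by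
    intro r hr
    ext
    change i r * conj θ R (i r) = 1
    rw [conj_includeRight, ← map_mul, ← pow_two, ← Units.val_pow_eq_pow_val, hr, Units.val_one,
      map_one]
  symm
  refine Nat.card_eq_of_bijective
    (fun r : {r : Rˣ // r ^ 2 = 1} => (⟨⟨Units.map i.toMonoidHom r.1, hmem r.1 r.2⟩, by
      ext1
      change Units.map i.toMonoidHom r.1 ^ 2 = 1
      rw [← map_pow, r.2, map_one]⟩ : {x : U1 θ R // x ^ 2 = 1})) ⟨?_, ?_⟩
  · intro r s hrs
    have := congrArg (fun x : {x : U1 θ R // x ^ 2 = 1} => x.1.1) hrs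
    exact Subtype.ext (Units.map_injective hi this)
  · rintro ⟨⟨x, hx⟩, hx2⟩
    have h1 : x.val * conj θ R x.val = 1 := congrArg Units.val hx
    have h2 : x.val * x.val = 1 := by
      have := congrArg (fun y : U1 θ R => y.1.val) hx2
      simpa [pow_two] using this
    have h3 : conj θ R x.val = x.val := x.isUnit.mul_left_cancel (h1.trans h2.symm)
    obtain ⟨r, hr⟩ := h.exists_includeRight_eq h3
    have hrr : r * r = 1 := hi (by rw [map_mul, hr, h2, map_one])
    refine ⟨⟨⟨r, r, hrr, hrr⟩, by ext; simpa [pow_two] using hrr⟩, ?_⟩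
    ext
    exact hr

lemma IsImaginary.twoTorsionCard_U1_of_ringEquiv [CharZero F] (h : IsImaginary θ ξ) (R : Type u)
    [CommRing R] [Algebra F R] (K : Type*) [Field K] [Algebra F K] (e : R ≃ₐ[F] K) :
    twoTorsionCard (U1 θ R) = 2 := by
  have : CharZero K := charZero_of_injective_algebraMap (algebraMap F K).injective
  rw [h.twoTorsionCard_U1, twoTorsionCard_congr (Units.mapEquiv (e : R ≃* K)),
    twoTorsionCard_units_of_isDomain K two_ne_zero]

/-- The two-torsion of the rational points of the centralizer. -/
theorem IsFrame.twoTorsionCard_centralizer [CharZero F] (h : IsImaginary θ ξ) {k : Type u}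
    [Field k] [Algebra F k] (φ : E →ₐ[F] k) {c : E} (hc : c ≠ 0) {γ : GL (Fin 3) E}
    {τ : Matrix (Fin 3) (Fin 3) F} (hτ : IsCayley c ξ γ.val τ) {P : GL (Fin 3) k}
    {t : Fin 3 → k} (hP : IsFrame (τ.map (algebraMap F k)) P t) :
    twoTorsionCard (centralizer θ γ F) = twoTorsionCard (torus τ) := by
  let i : F →ₐ[F] E ⊗[F] F := Algebra.TensorProduct.includeRight
  have hi : Function.Injective i.toRingHom := includeRight_injective
  -- E ⊗ F is E, which embeds in k, so the eigenbasis also governs matrices over E ⊗ F.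
  let ψ : E ⊗[F] F →ₐ[F] k := φ.comp (Algebra.TensorProduct.rid F F E).toAlgHom
  have hψ : Function.Injective ψ.toRingHom :=
    φ.toRingHom.injective.comp (Algebra.TensorProduct.rid F F E).injective
  have hPψ : IsFrame ((τ.map i.toRingHom).map ψ.toRingHom) P t := by
    rw [map_map_matrix]
    have : ψ.toRingHom.comp i.toRingHom = algebraMap F k := (ψ.comp i).comp_algebraMap
    rw [this]
    exact hP
  have hconj : ∀ M : Matrix (Fin 3) (Fin 3) F,
      (M.map i.toRingHom).map (conj θ F).toRingHom = M.map i.toRingHom := by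
    intro M
    ext a b
    exact conj_includeRight F (M a b)
  have hcomm : ∀ g : GL (Fin 3) (E ⊗[F] F), g ∈ Subgroup.centralizer {baseChange F γ} ↔
      Commute g.val (τ.map i.toRingHom) := by
    intro g
    have h1 := hτ.intertwine_iff hc h.ne_zero hτ
      (Algebra.TensorProduct.includeLeft : E →ₐ[F] E ⊗[F] F).toRingHom g.val
    rw [includeLeft_comp_algebraMap] at h1
    rw [Subgroup.mem_centralizer_singleton_iff, Units.ext_iff]
    exact ⟨fun h2 => (h1.1 h2.symm).symm, fun h2 => (h1.2 h2.symm).symm⟩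
  have hsymm : ∀ M : Matrix (Fin 3) (Fin 3) (E ⊗[F] F), Commute M (τ.map i.toRingHom) →
      antitranspose M = M := fun M hM => hPψ.antitranspose_eq_of_map hψ hM
  have hmem : ∀ g : torus τ, g ^ 2 = 1 → embed F E F g.1 ∈ centralizer θ γ F := by
    intro g hg
    have h1 : Commute (embed F E F g.1).val (τ.map i.toRingHom) := commute_map i.toRingHom g.2
    refine Subgroup.mem_inf.2 ⟨?_, (hcomm _).2 h1⟩
    refine (mem_unitary_iff _ _).2 ?_
    have h2 : (embed F E F g.1).val.map (conj θ F).toRingHom = (embed F E F g.1).val :=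
      hconj g.1.val
    rw [h2, hsymm _ h1, ← Units.val_mul, ← pow_two, ← map_pow]
    have h3 : g.1 ^ 2 = 1 := congrArg Subtype.val hg
    rw [h3, map_one, Units.val_one]
  symm
  refine Nat.card_eq_of_bijective
    (fun g : {g : torus τ // g ^ 2 = 1} => (⟨⟨embed F E F g.1.1, hmem g.1 g.2⟩, by
      ext1
      change embed F E F g.1.1 ^ 2 = 1
      have h3 : g.1.1 ^ 2 = 1 := congrArg Subtype.val g.2
      rw [← map_pow, h3, map_one]⟩ : {x : centralizer θ γ F // x ^ 2 = 1})) ⟨?_, ?_⟩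
  · intro g g' hg
    have := congrArg (fun x : {x : centralizer θ γ F // x ^ 2 = 1} => x.1.1) hg
    exact Subtype.ext (Subtype.ext (map_injective_of_field hi this))
  · rintro ⟨⟨x, hx⟩, hx2⟩
    obtain ⟨hxU, hxC⟩ := Subgroup.mem_inf.1 hx
    have h1 := (hcomm x).1 hxC
    have h2 : antitranspose (x.val.map (conj θ F).toRingHom) * x.val = 1 :=
      (mem_unitary_iff _ _).1 hxU
    have h3 : Commute (x.val.map (conj θ F).toRingHom) (τ.map i.toRingHom) := by
      have := commute_map (conj θ F).toRingHom h1
      rwa [hconj] at this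
    rw [hsymm _ h3] at h2
    have h4 : x.val * x.val = 1 := by
      have := congrArg (fun y : centralizer θ γ F => y.1.val) hx2
      simpa [pow_two] using this
    -- x is symmetric, so unitarity reads x̄x = 1; together with x² = 1 this gives x̄ = x, and x
    -- descends to F.
    have h5 : x.val.map (conj θ F).toRingHom = x.val := x.isUnit.mul_right_cancel (h2.trans h4.symm)
    have h6 : ∀ a b, ∃ r : F, i r = x.val a b := fun a b =>
      h.exists_includeRight_eq (congrFun (congrFun h5 a) b)
    choose M hM using h6
    have hM' : (Matrix.of M).map i.toRingHom = x.val := by ext a b; exact hM a b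
    have hMM : Matrix.of M * Matrix.of M = 1 := by
      refine Matrix.map_injective hi ?_
      change (Matrix.of M * Matrix.of M).map i.toRingHom =
        (1 : Matrix (Fin 3) (Fin 3) F).map i.toRingHom
      rw [Matrix.map_mul, hM', h4, map_one_matrix]
    have hMτ : Commute (Matrix.of M) τ := (commute_map_iff hi).1 (by rw [hM']; exact h1)
    refine ⟨⟨⟨⟨Matrix.of M, Matrix.of M, hMM, hMM⟩, hMτ⟩, ?_⟩, ?_⟩
    · ext1
      ext1
      change (Matrix.of M) ^ 2 = 1
      rw [pow_two, hMM]
    · refine Subtype.ext (Subtype.ext (Units.ext ?_))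
      exact hM'

variable [CharZero F] {γ : GL (Fin 3) E}

/-- Only the isomorphism on F-points matters: the factors Eˣ and U_{1,E/F}(F) contribute ±1 each. -/
lemma IsTypeI.twoTorsionCard_eq (h : IsImaginary θ ξ) (hγ : IsTypeI θ γ) :
    twoTorsionCard (centralizer θ γ F) = 4 := by
  have : CharZero E := charZero_of_injective_algebraMap (algebraMap F E).injective
  obtain ⟨e, -⟩ := hγ
  rw [twoTorsionCard_congr (e F), twoTorsionCard_prod,
    h.twoTorsionCard_U1_of_ringEquiv F F AlgEquiv.refl,
    twoTorsionCard_congr (Units.mapEquiv (Algebra.TensorProduct.rid F F E : E ⊗[F] F ≃* E)),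
    twoTorsionCard_units_of_isDomain E two_ne_zero]

lemma IsTypeII.twoTorsionCard_eq (h : IsImaginary θ ξ) (hγ : IsTypeII θ γ) :
    twoTorsionCard (centralizer θ γ F) = 8 := by
  obtain ⟨e, -⟩ := hγ
  rw [twoTorsionCard_congr (e F), twoTorsionCard_prod, twoTorsionCard_prod,
    h.twoTorsionCard_U1_of_ringEquiv F F AlgEquiv.refl]

lemma IsTypeIII.twoTorsionCard_eq (h : IsImaginary θ ξ) (hγ : IsTypeIII θ γ) :
    twoTorsionCard (centralizer θ γ F) = 4 := by
  obtain ⟨K, _, _, -, -, e, -⟩ := hγ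
  rw [twoTorsionCard_congr (e F), twoTorsionCard_prod,
    h.twoTorsionCard_U1_of_ringEquiv F F AlgEquiv.refl,
    h.twoTorsionCard_U1_of_ringEquiv (K ⊗[F] F) K (Algebra.TensorProduct.rid F F K)]

lemma IsTypeIV.twoTorsionCard_eq (h : IsImaginary θ ξ) (hγ : IsTypeIV θ γ) :
    twoTorsionCard (centralizer θ γ F) = 2 := by
  obtain ⟨K, _, _, -, e, -⟩ := hγ
  rw [twoTorsionCard_congr (e F),
    h.twoTorsionCard_U1_of_ringEquiv (K ⊗[F] F) K (Algebra.TensorProduct.rid F F K)]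

end Counting

end SymmSpace

/-! ### Rational orbits and the tori `T_ν` -/

namespace SymmSpace

section StableRational

variable {F E k : Type u} [Field F] [Field E] [Algebra F E] [Field k] [Algebra F k]
  {θ : E ≃ₐ[F] E} {c ξ : E} {γ γ' : GL (Fin 3) E} {τ τ' : Matrix (Fin 3) (Fin 3) F}

lemma mem_specialOrthogonal_of_map {g : GL (Fin 3) F}
    (hg : Matrix.GeneralLinearGroup.map (algebraMap F k) g ∈ specialOrthogonal k) :
    g ∈ specialOrthogonal F := by
  have hinj := (algebraMap F k).injective
  rw [mem_specialOrthogonal_iff] at hg ⊢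
  have hval : (Matrix.GeneralLinearGroup.map (algebraMap F k) g).val =
    g.val.map (algebraMap F k) := rfl
  rw [hval, antitranspose_map, ← Matrix.map_mul] at hg
  refine ⟨Matrix.map_injective hinj ?_, hinj ?_⟩
  · exact hg.1.trans (map_one_matrix _).symm
  · rw [map_one, ← hg.2]
    exact RingHom.map_det _ _

lemma rationalOrbit_subset_stableClass : rationalOrbit θ γ ⊆ stableClass θ k γ := by
  rintro γ' ⟨hγ', g, hg, rfl⟩
  refine ⟨hγ', Matrix.GeneralLinearGroup.map (algebraMap F k) g,
    map_mem_specialOrthogonal (Algebra.ofId F k) hg, ?_⟩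
  have : embed F E k (Matrix.GeneralLinearGroup.map (algebraMap F k) g) =
      baseChange k (Matrix.GeneralLinearGroup.map (algebraMap F E) g) := by
    ext i j
    exact (RingHom.congr_fun (includeLeft_comp_algebraMap (E := E) (R := k)) (g.val i j)).symm
  rw [this, map_mul, map_mul, map_inv]

/-- If the stabilizer has no cohomology, the stable class is the rational orbit. -/
theorem IsCayley.stableClass_eq_rationalOrbit [CharZero F] [IsGalois F k] (h : IsImaginary θ ξ)
    (hc : θ c * c = 1) (hu : IsUnit (1 - c • γ.val)) (hτ : IsCayley c ξ γ.val τ)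
    (hH1 : ∀ x : H1 (k ≃ₐ[F] k) (stabilizer F γ k), x = 1) :
    stableClass θ k γ = rationalOrbit θ γ := by
  have hc0 : c ≠ 0 := right_ne_zero_of_mul_eq_one hc
  refine Set.Subset.antisymm (fun γ' hγ' => ?_) rationalOrbit_subset_stableClass
  obtain ⟨τ', -, hτ'⟩ := exists_isCayley h hc hγ'.1 (isUnit_of_mem_stableClass hu hγ')
  obtain ⟨hγ'S, g, hgSO, hg⟩ := hγ'
  rw [inv_mul_mul_eq_iff, hτ.baseChange_intertwine_iff hc0 h.ne_zero hτ'] at hg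
  let act : (k ≃ₐ[F] k) → GL (Fin 3) k →* GL (Fin 3) k :=
    fun s => Matrix.GeneralLinearGroup.map (s : k →ₐ[F] k).toRingHom
  have hact_mul : ∀ s t x, act (s * t) x = act s (act t x) := fun s t x => rfl
  have hsg : ∀ s, τ.map (algebraMap F k) * (act s g).val = (act s g).val * τ'.map (algebraMap F k) := by
    intro s
    have := congrArg (fun M => M.map (s : k →ₐ[F] k).toRingHom) hg
    simp only [Matrix.map_mul, map_algebraMap_map] at this
    exact this
  -- Both g and its Galois conjugate s(g) intertwine τ with τ', so g s(g)⁻¹ commutes with τ.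
  have hmem : ∀ s, g * (act s g)⁻¹ ∈ stabilizer F γ k := by
    intro s
    refine (hτ.mem_stabilizer_iff hc0 h.ne_zero _).2
      ⟨mul_mem hgSO (inv_mem (map_mem_specialOrthogonal (s : k →ₐ[F] k) hgSO)), ?_⟩
    have h1 : τ'.map (algebraMap F k) * ((act s g)⁻¹).val =
        ((act s g)⁻¹).val * τ.map (algebraMap F k) := by
      calc τ'.map (algebraMap F k) * ((act s g)⁻¹).val
          = ((act s g)⁻¹).val * ((act s g).val * τ'.map (algebraMap F k)) *
              ((act s g)⁻¹).val := by
            rw [← Matrix.mul_assoc, GL_inv_mul_val, Matrix.one_mul]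
        _ = _ := by
            rw [← hsg, Matrix.mul_assoc, Matrix.mul_assoc, GL_mul_inv_val, Matrix.mul_one]
    rw [mem_torus]
    change g.val * ((act s g)⁻¹).val * τ.map (algebraMap F k) =
      τ.map (algebraMap F k) * (g.val * ((act s g)⁻¹).val)
    rw [Matrix.mul_assoc, ← h1, ← Matrix.mul_assoc, ← hg, Matrix.mul_assoc]
  let a : Cocycle (k ≃ₐ[F] k) (stabilizer F γ k) :=
    { toFun := fun s => ⟨g * (act s g)⁻¹, hmem s⟩
      locallyConstant := by
        -- The torus attached to the zero matrix is all of GL₃, so local constancy of the Galois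
        -- action on a torus applies to g.
        have h0 : ∀ x : GL (Fin 3) k, x ∈ torusOver (0 : Matrix (Fin 3) (Fin 3) F) k := by
          intro x
          rw [mem_torus]
          simp
        have h1 := isLocallyConstant_smul (F := F) (k := k) ⟨g, h0 g⟩
        refine (IsLocallyConstant.iff_exists_open _).2 fun s => ?_
        obtain ⟨U, hU, hs, hcst⟩ := (IsLocallyConstant.iff_exists_open _).1 h1 s
        refine ⟨U, hU, hs, fun t ht => ?_⟩
        have h2 : act t g = act s g := congrArg Subtype.val (hcst t ht)
        simp only [h2]
      map_mul := fun s t => by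
        ext1
        change g * (act (s * t) g)⁻¹ = g * (act s g)⁻¹ * act s (g * (act t g)⁻¹)
        rw [map_mul, map_inv, hact_mul, mul_assoc, inv_mul_cancel_left] }
  obtain ⟨b, hb⟩ := Quotient.exact (hH1 (Quotient.mk _ a))
  have hb' : ∀ s, g * (act s g)⁻¹ = b.1 * (act s b.1)⁻¹ := by
    intro s
    have h1 : (1 : GL (Fin 3) k) = b.1⁻¹ * (g * (act s g)⁻¹) * act s b.1 :=
      congrArg Subtype.val (hb s)
    calc g * (act s g)⁻¹ = b.1 * (b.1⁻¹ * (g * (act s g)⁻¹) * act s b.1) * (act s b.1)⁻¹ := by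
          group
      _ = _ := by rw [← h1, mul_one]
  -- If g s(g)⁻¹ = b s(b)⁻¹ with b in the stabilizer, then b⁻¹g is Galois-fixed; it still
  -- intertwines τ with τ'.
  obtain ⟨q, hq⟩ := exists_map_eq_of_forall_map_eq (F := F) (b.1⁻¹ * g) fun s => by
    change act s (b.1⁻¹ * g) = b.1⁻¹ * g
    calc act s (b.1⁻¹ * g) = b.1⁻¹ * (b.1 * (act s b.1)⁻¹) * act s g := by
          rw [map_mul, map_inv, inv_mul_cancel_left]
      _ = b.1⁻¹ * g := by rw [← hb', mul_assoc, inv_mul_cancel_right]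
  have hbmem := (hτ.mem_stabilizer_iff hc0 h.ne_zero _).1 b.2
  refine ⟨hγ'S, q, mem_specialOrthogonal_of_map (k := k) ?_, ?_⟩
  · rw [hq]
    exact mul_mem (inv_mem hbmem.1) hgSO
  · rw [inv_mul_mul_eq_iff, Units.ext_iff]
    have h1 := hτ.intertwine_iff hc0 h.ne_zero hτ' (RingHom.id E) (q.val.map (algebraMap F E))
    have h2 : τ * q.val = q.val * τ' := by
      refine Matrix.map_injective (algebraMap F k).injective ?_
      change (τ * q.val).map (algebraMap F k) = (q.val * τ').map (algebraMap F k)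
      have h3 : q.val.map (algebraMap F k) = (b.1⁻¹).val * g.val := congrArg Units.val hq
      have h4 : (b.1⁻¹).val * τ.map (algebraMap F k) = τ.map (algebraMap F k) * (b.1⁻¹).val :=
        (inv_mem hbmem.2 : b.1⁻¹ ∈ torusOver τ k)
      rw [Matrix.map_mul, Matrix.map_mul, h3, ← Matrix.mul_assoc, ← h4, Matrix.mul_assoc, hg,
        Matrix.mul_assoc]
    have h5 := congrArg (fun M => M.map (algebraMap F E)) h2
    simp only [Matrix.map_mul] at h5
    have h6 := h1.2 h5
    simpa using! h6

end StableRational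

/-! ### Representatives of the square classes of `F` -/

section SquareClassRepresentatives

/-- Since u, v and uv are nonsquares, the classes of 1, u, v, uv are distinct and fill the quotient
of order four. -/
lemma exists_eq_mul_sq_of_index_eq_four {G : Type*} [CommGroup G] (h : (squares G).index = 4)
    {u v : G} (hu : u ∉ squares G) (hv : v ∉ squares G) (huv : u * v ∉ squares G) (x : G) :
    ∃ y, x = y ^ 2 ∨ x = u * y ^ 2 ∨ x = v * y ^ 2 ∨ x = u * v * y ^ 2 := by
  let Q := G ⧸ squares G
  let π : G →* Q := QuotientGroup.mk' (squares G)
  have hπ : ∀ a, π a = 1 ↔ a ∈ squares G := fun a => QuotientGroup.eq_one_iff a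
  have hπ2 : ∀ a, π a * π a = 1 := fun a => by
    rw [← map_mul, hπ]; exact ⟨a, by simp [pow_two]⟩
  have hcard : Nat.card Q = 4 := h
  have : Finite Q := Nat.finite_of_card_ne_zero (by omega)
  have hu' : π u ≠ 1 := fun h => hu ((hπ _).1 h)
  have hv' : π v ≠ 1 := fun h => hv ((hπ _).1 h)
  have huv' : π u * π v ≠ 1 := fun h => huv ((hπ _).1 (by rw [map_mul, h]))
  have hne : π u ≠ π v := fun h => huv' (by rw [h, hπ2])
  let f : Fin 4 → Q := ![1, π u, π v, π u * π v]
  have hf : Function.Injective f := by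
    intro i j
    fin_cases i <;> fin_cases j <;>
      simp [f, hu', hv', huv', hne, hu'.symm, hv'.symm, huv'.symm, hne.symm]
  have hsurj : Function.Surjective f :=
    ((Nat.bijective_iff_injective_and_card f).2 ⟨hf, by simp [hcard]⟩).2
  have key : ∀ a, π x = π a → ∃ y, x = a * y ^ 2 := by
    intro a ha
    obtain ⟨y, hy⟩ := QuotientGroup.eq.1 ha.symm
    exact ⟨y, by rw [eq_comm, ← eq_inv_mul_iff_mul_eq]; exact hy⟩
  obtain ⟨i, hi⟩ := hsurj (π x)
  fin_cases i
  · obtain ⟨y, hy⟩ := key 1 (by rw [map_one]; exact hi.symm)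
    exact ⟨y, Or.inl (by simpa using hy)⟩
  · obtain ⟨y, hy⟩ := key u hi.symm
    exact ⟨y, Or.inr (Or.inl hy)⟩
  · obtain ⟨y, hy⟩ := key v hi.symm
    exact ⟨y, Or.inr (Or.inr (Or.inl hy))⟩
  · obtain ⟨y, hy⟩ := key (u * v) (by rw [map_mul]; exact hi.symm)
    exact ⟨y, Or.inr (Or.inr (Or.inr hy))⟩

/-- Such a y would be integral because y² is, and a unit times an irreducible is irreducible, hence
not a square in the valuation ring. -/
lemma not_sq_eq_unit_mul_irreducible {F : Type*} [Field F] [ValuativeRel F] {ϖ : 𝒪[F]}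
    (hϖ : Irreducible ϖ) (v : 𝒪[F]ˣ) (y : F) : y ^ 2 ≠ (v : 𝒪[F]) * (ϖ : F) := by
  intro h
  have hy : ValuativeRel.valuation F y ≤ 1 := by
    have h1 : ValuativeRel.valuation F y ^ 2 ≤ 1 := by
      rw [← map_pow, h]
      exact ((v : 𝒪[F]) * ϖ).2
    exact (pow_le_one_iff two_ne_zero).1 h1
  have h2 : (⟨y, hy⟩ : 𝒪[F]) ^ 2 = v * ϖ := Subtype.ext h
  have h3 : Irreducible ((v : 𝒪[F]) * ϖ) := (irreducible_units_mul v).2 hϖ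
  exact h3.not_isSquare ⟨⟨y, hy⟩, by rw [← h2, pow_two]⟩

/-- The square classes of `F` are represented by `1`, `ξ²`, `ϖ`, `ξ²ϖ`. -/
theorem exists_eq_mul_sq {F E : Type u} [Field F] [ValuativeRel F] [TopologicalSpace F]
    [IsNonarchimedeanLocalField F] [CharZero F] (hp : ringChar 𝓀[F] ≠ 2) [Field E] [Algebra F E]
    {θ : E ≃ₐ[F] E} {ϖ : 𝒪[F]} (hϖ : Irreducible ϖ) (ξ : (integralClosure 𝒪[F] E)ˣ)
    (h : IsImaginary θ ((ξ : integralClosure 𝒪[F] E) : E)) {D : F} (hD : D ≠ 0) :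
    ∃ ν f : F, D = ν * f ^ 2 ∧ algebraMap F E ν ∈
      ({1, ((ξ : integralClosure 𝒪[F] E) : E) ^ 2, algebraMap F E ϖ,
          ((ξ : integralClosure 𝒪[F] E) : E) ^ 2 * algebraMap F E ϖ} : Set E) := by
  have hinj := (algebraMap F E).injective
  obtain ⟨u, hu⟩ := h.exists_sq_eq
  have hu0 : u ≠ 0 := by
    rintro rfl
    rw [map_zero] at hu
    exact h.ne_zero (pow_eq_zero_iff two_ne_zero |>.1 hu.symm)
  have hϖ0 : (ϖ : F) ≠ 0 := fun h0 => hϖ.ne_zero (Subtype.ext h0)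
  -- Applied to ξ and ξ⁻¹, this makes u = ξ² a unit of the valuation ring: its elements are exactly
  -- those of F integral over it.
  have hint : ∀ (ζ : (integralClosure 𝒪[F] E)) (w : F), algebraMap F E w = (ζ : E) ^ 2 →
      w ∈ 𝒪[F] := by
    intro ζ w hw
    have h1 : IsIntegral 𝒪[F] (algebraMap F E w) := by
      rw [hw]
      exact IsIntegral.pow ζ.2 2
    have h2 : IsIntegral 𝒪[F] w :=
      (isIntegral_algHom_iff (IsScalarTower.toAlgHom 𝒪[F] F E) hinj).1 h1
    exact Valuation.Integers.mem_of_integral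
      (Valuation.integer.integers (ValuativeRel.valuation F)) h2
  have hξinv : (((ξ⁻¹ : (integralClosure 𝒪[F] E)ˣ) : integralClosure 𝒪[F] E) : E) =
      ((ξ : integralClosure 𝒪[F] E) : E)⁻¹ := by
    exact eq_inv_of_mul_eq_one_left (congrArg Subtype.val ξ.inv_mul)
  let U : 𝒪[F]ˣ :=
    ⟨⟨u, hint _ u hu⟩, ⟨u⁻¹, hint (ξ⁻¹ : (integralClosure 𝒪[F] E)ˣ) u⁻¹ (by
      rw [map_inv₀, hu, hξinv, inv_pow])⟩, Subtype.ext (mul_inv_cancel₀ hu0),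
      Subtype.ext (inv_mul_cancel₀ hu0)⟩
  -- A square root of u in F would be ±ξ, which does not lie in F.
  have hnu : Units.mk0 u hu0 ∉ squares Fˣ := by
    rintro ⟨y, hy⟩
    have h1 : (y : F) ^ 2 = u := congrArg Units.val hy
    have h2 : algebraMap F E y ^ 2 = ((ξ : integralClosure 𝒪[F] E) : E) ^ 2 := by
      rw [← map_pow, h1, hu]
    rcases sq_eq_sq_iff_eq_or_eq_neg.1 h2 with h3 | h3
    · refine h.algebraMap_add_ne_zero (-y) ?_
      rw [map_neg, h3, neg_add_cancel]
    · refine h.algebraMap_add_ne_zero y ?_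
      rw [h3, neg_add_cancel]
  have hnϖ : Units.mk0 (ϖ : F) hϖ0 ∉ squares Fˣ := by
    rintro ⟨y, hy⟩
    refine not_sq_eq_unit_mul_irreducible hϖ 1 (y : F) ?_
    have h1 : (y : F) ^ 2 = ϖ := congrArg Units.val hy
    simpa using h1
  have hnuϖ : Units.mk0 u hu0 * Units.mk0 (ϖ : F) hϖ0 ∉ squares Fˣ := by
    rintro ⟨y, hy⟩
    refine not_sq_eq_unit_mul_irreducible hϖ U (y : F) ?_
    exact congrArg Units.val hy
  obtain ⟨y, hy⟩ := exists_eq_mul_sq_of_index_eq_four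
    (IsNonarchimedeanLocalField.index_squares F hp F) hnu hnϖ hnuϖ (Units.mk0 D hD)
  have hval : ∀ v : Fˣ, Units.mk0 D hD = v * y ^ 2 → D = v * (y : F) ^ 2 :=
    fun v hv => congrArg Units.val hv
  rcases hy with hy | hy | hy | hy
  · exact ⟨1, y, hval 1 (by rw [one_mul, hy]), by simp⟩
  · exact ⟨u, y, hval _ hy, by simp [hu]⟩
  · exact ⟨ϖ, y, hval _ hy, by simp⟩
  · exact ⟨u * ϖ, y, hval _ hy, by simp [hu]⟩

end SquareClassRepresentatives

/-! ### Splitting off a rational eigenvalue -/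

section RationalEigenvalue

variable {F k : Type*} [Field F] [Field k] [Algebra F k]
  {τ : Matrix (Fin 3) (Fin 3) F} {P : GL (Fin 3) k} {t : Fin 3 → k}

lemma exists_sq_eq_one_of_two_lt (h : 2 < twoTorsionCard (torus τ)) :
    ∃ M : Matrix (Fin 3) (Fin 3) F, Commute M τ ∧ M * M = 1 ∧ M ≠ 1 ∧ M ≠ -1 := by
  by_contra! hcon
  have hfin : {g : torus τ | g ^ 2 = 1} ⊆
      {1, ⟨-1, by rw [mem_torus, Units.val_neg, Units.val_one]; exact Commute.neg_one_left _⟩} := by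
    intro g hg
    have h1 : g.1.val * g.1.val = 1 := by
      have := congrArg (fun x : torus τ => x.1.val) hg
      simpa [pow_two] using this
    by_cases h2 : g.1.val = 1
    · exact Or.inl (Subtype.ext (Units.ext h2))
    · exact Or.inr (Subtype.ext (Units.ext (hcon g.1.val g.2 h1 h2)))
  have h2 := (Set.ncard_le_ncard hfin (Set.toFinite _)).trans (Set.ncard_insert_le _ _)
  rw [Set.ncard_singleton] at h2
  rw [← Nat.card_coe_set_eq] at h2
  exact absurd h2 (not_le.2 h)

/-- Among three signs that are not all equal, one differs from the other two. Indices are cyclic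
modulo 3. -/
lemma exists_opposite_sign (ε : Fin 3 → k) (hε : ∀ i, ε i * ε i = 1) (h1 : ε ≠ 1)
    (h2 : ε ≠ -1) : ∃ i, ε (i + 1) = -ε i ∧ ε (i + 2) = -ε i := by
  have h : ∀ i, ε i = 1 ∨ ε i = -1 := fun i => mul_self_eq_one_iff.1 (hε i)
  have key : ∀ i, (∃ r, ε i = r ∧ ε (i + 1) = -r ∧ ε (i + 2) = -r) →
      ∃ i, ε (i + 1) = -ε i ∧ ε (i + 2) = -ε i := by
    rintro i ⟨r, h3, h4, h5⟩
    exact ⟨i, by rw [h3, h4], by rw [h3, h5]⟩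
  rcases h 0 with a | a <;> rcases h 1 with b | b <;> rcases h 2 with c | c
  · exact absurd (funext fun i => by fin_cases i <;> simp [a, b, c]) h1
  · exact key 2 ⟨-1, c, by rw [neg_neg]; exact a, by rw [neg_neg]; exact b⟩
  · exact key 1 ⟨-1, b, by rw [neg_neg]; exact c, by rw [neg_neg]; exact a⟩
  · exact key 0 ⟨1, a, b, c⟩
  · exact key 0 ⟨-1, a, by rw [neg_neg]; exact b, by rw [neg_neg]; exact c⟩
  · exact key 1 ⟨1, b, c, a⟩
  · exact key 2 ⟨1, c, a, b⟩
  · exact absurd (funext fun i => by fin_cases i <;> simp [a, b, c]) h2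

/-- If the torus has nontrivial two-torsion modulo signs, then one of the eigenvalues is
rational, and the others are `x ± δ` with `x` and `δ²` rational. -/
theorem IsFrame.exists_rational_eigenvalue [CharZero F] (h : IsFrame (τ.map (algebraMap F k)) P t)
    (h2 : 2 < twoTorsionCard (torus τ)) :
    ∃ (i : Fin 3) (z x D : F) (δ : k), t i = algebraMap F k z ∧
      t (i + 1) = algebraMap F k x + δ ∧ t (i + 2) = algebraMap F k x - δ ∧
      δ ^ 2 = algebraMap F k D ∧ D ≠ 0 := by
  have : CharZero k := charZero_of_injective_algebraMap (algebraMap F k).injective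
  have hinj := (algebraMap F k).injective
  have hfin : ∀ i j : Fin 3, j = i ∨ j = i + 1 ∨ j = i + 2 := by decide
  have hfin1 : ∀ i : Fin 3, i + 1 ≠ i := by decide
  have hfin2 : ∀ i : Fin 3, i + 2 ≠ i := by decide
  have hfin3 : ∀ i : Fin 3, i + 1 ≠ i + 2 := by decide
  obtain ⟨M, hMτ, hMM, hM1, hM2⟩ := exists_sq_eq_one_of_two_lt h2
  obtain ⟨ε, hε⟩ := h.exists_diagonal (commute_map (algebraMap F k) hMτ)
  have hεε : ∀ i, ε i * ε i = 1 := by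
    have h1 := mul_eq_of_mul_mul_eq P hε hε
    rw [← Matrix.map_mul, hMM, map_one_matrix] at h1
    have h3 : (fun i => ε i * ε i) = 1 := diagonal_injective P h1 (by
      rw [Matrix.one_mul]
      change _ = _ * (Matrix.diagonal fun _ => (1 : k))
      rw [Matrix.diagonal_one, Matrix.mul_one])
    exact congrFun h3
  have hM : M.map (algebraMap F k) = P.val * Matrix.diagonal ε * (P⁻¹).val :=
    (mul_eq_mul_diagonal_iff P _ _).1 hε
  have hε1 : ε ≠ 1 := by
    rintro rfl
    refine hM1 (Matrix.map_injective hinj ?_)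
    change M.map (algebraMap F k) = (1 : Matrix (Fin 3) (Fin 3) F).map (algebraMap F k)
    rw [hM, map_one_matrix]
    change _ * (Matrix.diagonal fun _ => (1 : k)) * _ = _
    rw [Matrix.diagonal_one, Matrix.mul_one, GL_mul_inv_val]
  have hε2 : ε ≠ -1 := by
    rintro rfl
    refine hM2 (Matrix.map_injective hinj ?_)
    change M.map (algebraMap F k) = (-1 : Matrix (Fin 3) (Fin 3) F).map (algebraMap F k)
    have h3 : (-1 : Matrix (Fin 3) (Fin 3) F).map (algebraMap F k) = -1 := by
      rw [← zero_sub, map_sub_matrix, map_one_matrix]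
      simp
    rw [hM, h3]
    have h4 : Matrix.diagonal (-1 : Fin 3 → k) = -1 := by
      ext i j
      by_cases hij : i = j <;> simp [hij]
    rw [h4, Matrix.mul_neg, Matrix.mul_one, Matrix.neg_mul, GL_mul_inv_val]
  obtain ⟨i, hi1, hi2⟩ := exists_opposite_sign ε hεε hε1 hε2
  obtain ⟨η, hη⟩ : ∃ η : F, algebraMap F k η = ε i := by
    rcases mul_self_eq_one_iff.1 (hεε i) with h3 | h3
    · exact ⟨1, by rw [h3, map_one]⟩
    · exact ⟨-1, by rw [h3, map_neg, map_one]⟩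
  -- twice the projection onto the `i`-th eigenline
  set N := 1 + η • M with hN
  have hNP : N.map (algebraMap F k) * P.val =
      P.val * Matrix.diagonal (Pi.single i 2) := by
    rw [hN, map_add_matrix, map_smul_matrix, map_one_matrix, Matrix.add_mul, Matrix.smul_mul, hε,
      Matrix.one_mul, hη]
    have h3 : Matrix.diagonal (Pi.single i 2 : Fin 3 → k) = 1 + ε i • Matrix.diagonal ε := by
      have h4 := hεε i
      rw [← Matrix.diagonal_one, ← Matrix.diagonal_smul, Matrix.diagonal_add]
      congr 1
      ext j
      simp only [Pi.smul_apply, smul_eq_mul]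
      have hj : j = i ∨ j = i + 1 ∨ j = i + 2 := hfin i j
      rcases hj with rfl | rfl | rfl
      · rw [Pi.single_eq_same, h4]; norm_num
      · rw [Pi.single_eq_of_ne (hfin1 i), hi1]; linear_combination h4
      · rw [Pi.single_eq_of_ne (hfin2 i), hi2]; linear_combination h4
    rw [h3, Matrix.mul_add, Matrix.mul_one, Matrix.mul_smul]
  have hN0 : N.map (algebraMap F k) ≠ 0 := by
    intro h0
    rw [h0] at hNP
    have h3 : (Pi.single i 2 : Fin 3 → k) = 0 :=
      diagonal_injective P hNP (by simp)
    have := congrFun h3 i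
    simp at this
  have hτN : (τ * N).map (algebraMap F k) = t i • N.map (algebraMap F k) := by
    have h3 := mul_eq_of_mul_mul_eq P h.mul_eq hNP
    rw [mul_eq_mul_diagonal_iff] at h3 hNP
    have h4 : (fun j => t j * (Pi.single i 2 : Fin 3 → k) j) = t i • Pi.single i 2 := by
      ext j
      by_cases hj : j = i
      · subst hj; simp
      · simp [hj]
    rw [Matrix.map_mul, h3, hNP, h4, Matrix.diagonal_smul, Matrix.mul_smul, Matrix.smul_mul]
  -- Since τN = tᵢN with N rational and nonzero, tᵢ is a quotient of two entries in F.
  obtain ⟨z, hz⟩ : ∃ z, algebraMap F k z = t i := by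
    obtain ⟨a, b, hab⟩ : ∃ a b, N a b ≠ 0 := by
      by_contra! hcon
      exact hN0 (by ext a b; simp [hcon a b])
    refine ⟨(τ * N) a b / N a b, ?_⟩
    have h3 := congrFun (congrFun hτN a) b
    simp only [Matrix.map_apply, Matrix.smul_apply, smul_eq_mul] at h3
    rw [map_div₀, h3, mul_div_cancel_right₀]
    exact fun h0 => hab (hinj (by rw [h0, map_zero]))
  have hsum : ∀ f : Fin 3 → k, ∑ j, f j = f i + f (i + 1) + f (i + 2) := by
    intro f
    rw [Fin.sum_univ_three]
    fin_cases i
    · rfl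
    · change _ = f 1 + f 2 + f 0; ring
    · change _ = f 2 + f 0 + f 1; ring
  have htrace : ∀ (X : Matrix (Fin 3) (Fin 3) F) (d : Fin 3 → k),
      X.map (algebraMap F k) * P.val = P.val * Matrix.diagonal d →
      algebraMap F k X.trace = d i + d (i + 1) + d (i + 2) := by
    intro X d hX
    rw [← hsum, ← Matrix.trace_diagonal, AddMonoidHom.map_trace]
    change (X.map (algebraMap F k)).trace = _
    rw [(mul_eq_mul_diagonal_iff P _ _).1 hX, Matrix.trace_mul_comm, ← Matrix.mul_assoc,
      GL_inv_mul_val, Matrix.one_mul]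
  have ht1 := htrace τ t h.mul_eq
  have ht2 := htrace (τ * τ) _ (by rw [Matrix.map_mul]; exact mul_eq_of_mul_mul_eq P h.mul_eq h.mul_eq)
  have hne : t (i + 1) ≠ t (i + 2) := fun h0 => by
    exact hfin3 i (h.injective h0)
  -- The traces of τ and τ² minus the contributions of z give the sum p and the sum of squares q of
  -- the other two eigenvalues. Their mean is p/2 and the square of half their difference is (2q -
  -- p²)/4.
  refine ⟨i, z, (τ.trace - z) / 2, (2 * ((τ * τ).trace - z ^ 2) - (τ.trace - z) ^ 2) / 4,
    (t (i + 1) - t (i + 2)) / 2, hz.symm, ?_, ?_, ?_, ?_⟩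
  · rw [map_div₀, map_sub, ht1, hz, map_ofNat]
    ring
  · rw [map_div₀, map_sub, ht1, hz, map_ofNat]
    ring
  · rw [map_div₀, map_sub, map_mul, map_sub, map_pow, map_pow, map_sub, ht1, ht2, hz, map_ofNat,
      map_ofNat]
    ring
  · intro h0
    have h3 : algebraMap F k ((2 * ((τ * τ).trace - z ^ 2) - (τ.trace - z) ^ 2) / 4) =
        ((t (i + 1) - t (i + 2)) / 2) ^ 2 := by
      rw [map_div₀, map_sub, map_mul, map_sub, map_pow, map_pow, map_sub, ht1, ht2, hz, map_ofNat,
        map_ofNat]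
      ring
    rw [h0, map_zero] at h3
    have h4 := (pow_eq_zero_iff two_ne_zero).1 h3.symm
    rw [div_eq_zero_iff] at h4
    exact hne (sub_eq_zero.1 (h4.resolve_right two_ne_zero))

end RationalEigenvalue

/-! ### The inverse Cayley transform -/

section InverseCayley

variable {F E : Type u} [Field F] [Field E] [Algebra F E] {θ : E ≃ₐ[F] E} {c ξ : E}

lemma antitranspose_eq_of_mul_eq_one {A : Type*} [CommRing A] {M N : Matrix (Fin 3) (Fin 3) A}
    (hM : antitranspose M = M) (h : M * N = 1) : antitranspose N = N := by
  have h1 : antitranspose N * M = 1 := by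
    rw [← hM, ← antitranspose_mul, h, antitranspose_one]
  calc antitranspose N = antitranspose N * (M * N) := by rw [h, Matrix.mul_one]
    _ = N := by rw [← Matrix.mul_assoc, h1, Matrix.one_mul]

/-- The inverse Cayley transform of a rational symmetric matrix. -/
theorem exists_mem_symmPoints (h : IsImaginary θ ξ) (hc : θ c * c = 1)
    {τ : Matrix (Fin 3) (Fin 3) F} (hτ : antitranspose τ = τ) {V : Matrix (Fin 3) (Fin 3) E}
    (hV : (τ.map (algebraMap F E) + ξ • (1 : Matrix (Fin 3) (Fin 3) E)) * V = 1) :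
    ∃ γ ∈ symmPoints θ, IsCayley c ξ γ.val τ ∧
      γ.val = c⁻¹ • ((1 : Matrix (Fin 3) (Fin 3) E) - (2 * ξ) • V) := by
  have hc0 : c ≠ 0 := right_ne_zero_of_mul_eq_one hc
  set W := τ.map (algebraMap F E) + ξ • (1 : Matrix (Fin 3) (Fin 3) E) with hW
  have hV' : V * W = 1 := mul_eq_one_comm.1 hV
  have hWs : antitranspose W = W := by
    rw [hW, antitranspose_add, antitranspose_map, hτ, antitranspose_smul, antitranspose_one]
  have hVs := antitranspose_eq_of_mul_eq_one hWs hV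
  set W' := W.map (θ : E →+* E) with hW'
  set V' := V.map (θ : E →+* E) with hVd
  have hWW' : W' = W - (2 * ξ) • (1 : Matrix (Fin 3) (Fin 3) E) := by
    have h1 : (θ : E →+* E).comp (algebraMap F E) = algebraMap F E :=
      (θ : E →ₐ[F] E).comp_algebraMap
    have h2 : (θ : E →+* E) ξ = -ξ := h.map_eq
    rw [hW', hW, map_add_matrix, map_smul_matrix, map_one_matrix, map_map_matrix, h1, h2, two_mul,
      add_smul, neg_smul]
    abel
  have hV'W' : V' * W' = 1 := by
    rw [hW', hVd, ← Matrix.map_mul, hV', map_one_matrix]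
  have hcomm : W * W' = W' * W := by
    rw [hWW', Matrix.mul_sub, Matrix.sub_mul]
    simp
  set M := c⁻¹ • ((1 : Matrix (Fin 3) (Fin 3) E) - (2 * ξ) • V) with hM
  -- With W = τ + ξ and W̄ = τ - ξ, one has M = c⁻¹W̄W⁻¹ and M̄ = cW̄⁻¹W, and W commutes with W̄.
  have hMM : M.map (θ : E →+* E) * M = 1 := by
    have h1 : (θ : E →+* E) c⁻¹ = c := by
      rw [map_inv₀]
      exact inv_eq_of_mul_eq_one_right hc
    have h2 : (θ : E →+* E) (2 * ξ) = -(2 * ξ) := by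
      rw [map_mul, map_ofNat, ← mul_neg]
      exact congrArg (2 * ·) h.map_eq
    have h3 : (1 : Matrix (Fin 3) (Fin 3) E) - (2 * ξ) • V = W' * V := by
      rw [hWW', Matrix.sub_mul, hV, Matrix.smul_mul, Matrix.one_mul]
    have h4 : (1 : Matrix (Fin 3) (Fin 3) E) - (-(2 * ξ)) • V' = V' * W := by
      have : W = W' + (2 * ξ) • (1 : Matrix (Fin 3) (Fin 3) E) := by rw [hWW', sub_add_cancel]
      rw [this, Matrix.mul_add, hV'W', Matrix.mul_smul, Matrix.mul_one, neg_smul, sub_neg_eq_add]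
    rw [hM, map_smul_matrix, map_sub_matrix, map_smul_matrix, map_one_matrix, h1, h2, ← hVd, h3, h4,
      Matrix.smul_mul, Matrix.mul_smul, smul_smul, mul_inv_cancel₀ hc0, one_smul]
    calc V' * W * (W' * V) = V' * (W * W') * V := by simp only [Matrix.mul_assoc]
      _ = V' * W' * (W * V) := by rw [hcomm]; simp only [Matrix.mul_assoc]
      _ = 1 := by rw [hV'W', hV, Matrix.one_mul]
  refine ⟨⟨M, M.map (θ : E →+* E), mul_eq_one_comm.1 hMM, hMM⟩, ?_, ?_, rfl⟩
  · refine (mem_symm_iff _ _).2 ⟨?_, hMM⟩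
    change antitranspose M = M
    rw [hM, antitranspose_smul, sub_eq_add_neg, ← neg_smul, antitranspose_add, antitranspose_smul,
      antitranspose_one, hVs]
  · change (1 - c • M) * W = _
    rw [hM, smul_smul, mul_inv_cancel₀ hc0, one_smul, sub_sub_cancel, Matrix.smul_mul, hV']

/-- The Cayley relation makes τ + ξ invertible. Being a statement about eigenvalues, this passes to
any matrix with the spectrum of τ, which then has an inverse Cayley transform. -/
lemma IsCayley.eigenvalue_add_ne_zero {k : Type*} [Field k] [Algebra F k] [CharZero F]
    (φ : E →ₐ[F] k) (hξ : ξ ≠ 0) {γ : Matrix (Fin 3) (Fin 3) E} {τ : Matrix (Fin 3) (Fin 3) F}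
    (hτ : IsCayley c ξ γ τ) {P : GL (Fin 3) k} {t : Fin 3 → k}
    (hP : IsFrame (τ.map (algebraMap F k)) P t) (i : Fin 3) : t i + φ ξ ≠ 0 := by
  have : CharZero E := charZero_of_injective_algebraMap (algebraMap F E).injective
  set W := τ.map (algebraMap F E) + ξ • (1 : Matrix (Fin 3) (Fin 3) E) with hW
  have hdet : W.det ≠ 0 := by
    have h1 := congrArg Matrix.det hτ
    rw [Matrix.det_mul, Matrix.det_smul, Matrix.det_one, mul_one] at h1
    exact right_ne_zero_of_mul (h1.trans_ne (pow_ne_zero _ (mul_ne_zero two_ne_zero hξ)))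
  have hWP : W.map (φ : E →+* k) * P.val = P.val * Matrix.diagonal fun i => t i + φ ξ := by
    have h1 : (φ : E →+* k).comp (algebraMap F E) = algebraMap F k := φ.comp_algebraMap
    have h2 : (Matrix.diagonal fun i => t i + φ ξ) = Matrix.diagonal t + φ ξ • 1 := by
      ext i j
      by_cases hij : i = j <;> simp [hij]
    rw [hW, map_add_matrix, map_smul_matrix, map_one_matrix, map_map_matrix, h1, h2, Matrix.add_mul,
      Matrix.mul_add, hP.mul_eq, Matrix.smul_mul, Matrix.mul_smul, Matrix.one_mul, Matrix.mul_one]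
    rfl
  have h1 := det_of_mul_eq P hWP
  have h2 : (W.map (φ : E →+* k)).det = φ W.det := (RingHom.map_det (φ : E →+* k) _).symm
  rw [h2] at h1
  have h3 : φ W.det ≠ 0 := fun h0 => hdet (φ.toRingHom.injective (h0.trans (map_zero φ).symm))
  exact Finset.prod_ne_zero_iff.1 (h1 ▸ h3) i (Finset.mem_univ i)

end InverseCayley

/-! ### Meeting the torus `T_ν` -/

section Tori

lemma charpoly_cross {A : Type*} [CommRing A] (x y z w : A) :
    (!![x, 0, y; 0, z, 0; w, 0, x]).charpoly =
      (Polynomial.X - Polynomial.C z) *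
        ((Polynomial.X - Polynomial.C x) ^ 2 - Polynomial.C (w * y)) := by
  simp [Matrix.charpoly, Matrix.det_fin_three]
  ring

lemma antitranspose_cross {A : Type*} [CommRing A] (x y z w : A) :
    antitranspose !![x, 0, y; 0, z, 0; w, 0, x] = !![x, 0, y; 0, z, 0; w, 0, x] := by
  ext i j
  fin_cases i <;> fin_cases j <;>
    simp [antitranspose, J, Matrix.mul_apply, Matrix.vecMul, dotProduct, Fin.sum_univ_three]

variable {F E k : Type u} [Field F] [Field E] [Algebra F E] [Field k] [Algebra F k]
  {θ : E ≃ₐ[F] E} {c ξ : E} {γ : GL (Fin 3) E} {τ : Matrix (Fin 3) (Fin 3) F}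
  {P : GL (Fin 3) k} {t : Fin 3 → k}

/-- If the eigenvalues of the Cayley transform of `γ` are `z` and `x ± f √ν`, the stable class of
`γ` meets `T_ν`. -/
theorem IsCayley.stableClass_inter_T_nonempty [CharZero F] [IsAlgClosed k] (h : IsImaginary θ ξ)
    (φ : E →ₐ[F] k) (hc : θ c * c = 1) (hτ : IsCayley c ξ γ.val τ)
    (hP : IsFrame (τ.map (algebraMap F k)) P t) (i : Fin 3) {z x ν f : F} {δ : k}
    (hz : t i = algebraMap F k z) (hx1 : t (i + 1) = algebraMap F k x + δ)
    (hx2 : t (i + 2) = algebraMap F k x - δ) (hδ : δ ^ 2 = algebraMap F k (ν * f ^ 2)) :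
    (stableClass θ k γ ∩ T θ (algebraMap F E ν)).Nonempty := by
  have hc0 : c ≠ 0 := right_ne_zero_of_mul_eq_one hc
  have hne := hτ.eigenvalue_add_ne_zero φ h.ne_zero hP
  set X := algebraMap F E x + ξ with hX
  set Z := algebraMap F E z + ξ with hZ
  set Y := algebraMap F E f with hY
  set N := algebraMap F E ν with hN
  have hZ0 : Z ≠ 0 := h.algebraMap_add_ne_zero z
  -- The image of X² - NY² in k is the product of t + φ(ξ) over the two eigenvalues t = x ± δ.
  have hΔ : X ^ 2 - N * Y ^ 2 ≠ 0 := by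
    intro h0
    have h1 := congrArg φ h0
    simp only [hX, hN, hY, map_sub, map_pow, map_add, map_mul, AlgHom.commutes, map_zero] at h1
    rw [map_mul, map_pow] at hδ
    refine mul_ne_zero (hne (i + 1)) (hne (i + 2)) ?_
    rw [hx1, hx2]
    linear_combination h1 - hδ
  -- A symmetric model with eigenvalues z and x ± δ, because (νf)f = δ².
  let τ' : Matrix (Fin 3) (Fin 3) F := !![x, 0, f; 0, z, 0; ν * f, 0, x]
  have hτ's : antitranspose τ' = τ' := antitranspose_cross _ _ _ _
  have hτ'map : ∀ {A : Type u} [CommRing A] [Algebra F A], τ'.map (algebraMap F A) =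
      !![algebraMap F A x, 0, algebraMap F A f; 0, algebraMap F A z, 0;
        algebraMap F A (ν * f), 0, algebraMap F A x] := by
    intro A _ _
    ext a b
    fin_cases a <;> fin_cases b <;> simp [τ']
  let D := X ^ 2 - N * Y ^ 2
  -- The explicit inverse of τ' + ξ. It keeps the cross shape and the ratio N = ν between the two
  -- corners, so the inverse Cayley transform lands in T_ν.
  let V : Matrix (Fin 3) (Fin 3) E :=
    !![X / D, 0, -Y / D; 0, 1 / Z, 0; -(N * Y) / D, 0, X / D]
  have hD : D ≠ 0 := hΔ
  have hV : (τ'.map (algebraMap F E) + ξ • (1 : Matrix (Fin 3) (Fin 3) E)) * V = 1 := by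
    have hW : τ'.map (algebraMap F E) + ξ • (1 : Matrix (Fin 3) (Fin 3) E) =
        !![X, 0, Y; 0, Z, 0; N * Y, 0, X] := by
      rw [hτ'map]
      ext a b
      fin_cases a <;> fin_cases b <;> simp [hX, hY, hZ, hN]
    have e1 : X * (X / D) + Y * (-(N * Y) / D) = 1 := by
      field_simp
      simp only [D]
      ring
    have e2 : X * (-Y / D) + Y * (X / D) = 0 := by ring
    have e3 : N * Y * (X / D) + X * (-(N * Y) / D) = 0 := by ring
    have e4 : N * Y * (-Y / D) + X * (X / D) = 1 := by
      field_simp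
      simp only [D]
      ring
    have e5 : Z * (1 / Z) = 1 := mul_one_div_cancel hZ0
    rw [hW]
    ext a b
    fin_cases a <;> fin_cases b <;>
      simp [V, Matrix.mul_apply, Fin.sum_univ_three, e1, e2, e3, e4, hZ0]
  obtain ⟨γ', hγ', hCay, hval⟩ := exists_mem_symmPoints h hc hτ's hV
  refine ⟨γ', ⟨hγ', ?_⟩, hγ'.1, c⁻¹ * (1 - 2 * ξ * (X / D)), c⁻¹ * (2 * ξ * (Y / D)),
    c⁻¹ * (1 - 2 * ξ * (1 / Z)), ?_⟩
  -- Equal characteristic polynomials with distinct roots make τ and τ' conjugate under SO₃ over k.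
  · have hχ : (τ'.map (algebraMap F k)).charpoly =
        ∏ j, (Polynomial.X - Polynomial.C (t j)) := by
      have hprod : ∀ q : Fin 3 → Polynomial k, ∏ j, q j = q i * q (i + 1) * q (i + 2) := by
        intro q
        rw [Fin.prod_univ_three]
        fin_cases i
        · rfl
        · change _ = q 1 * q 2 * q 0; ring
        · change _ = q 2 * q 0 * q 1; ring
      have hδ' : algebraMap F k (ν * f) * algebraMap F k f = δ ^ 2 := by
        rw [hδ, ← map_mul]
        congr 1
        ring
      rw [hτ'map, charpoly_cross, hδ', hprod, hz, hx1, hx2]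
      simp only [map_add, map_sub, map_pow]
      ring
    obtain ⟨P', hP'⟩ := exists_isFrame hP.injective
      (by rw [antitranspose_map, hτ's]) hχ
    obtain ⟨g, hg, hgτ⟩ := hP.exists_conj hP'
    refine ⟨g, hg, ?_⟩
    rw [inv_mul_mul_eq_iff, hτ.baseChange_intertwine_iff hc0 h.ne_zero hCay]
    exact hgτ
  · rw [hval]
    ext a b
    fin_cases a <;> fin_cases b <;> simp [V] <;> ring

end Tori

lemma H1IsElementaryTwo.eq_one {Γ A : Type*} [Group Γ] [TopologicalSpace Γ] [Group A]
    [MulDistribMulAction Γ A] (h : H1IsElementaryTwo Γ A 0) (x : H1 Γ A) : x = 1 := by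
  obtain ⟨_, ⟨e⟩⟩ := h
  exact e.injective (Subsingleton.elim _ _)

lemma one_mem_frakD {F E : Type u} [Field F] [Field E] [Algebra F E] (k : Type u) [Field k]
    [Algebra F k] (γ : GL (Fin 3) E) : 1 ∈ frakD (F := F) k γ := by
  refine congrArg (Quotient.mk _) ?_
  congr 1

end SymmSpace

/-! ### The main theorem -/

open SymmSpace in
theorem mainTheorem6 {F E Fbar : Type u}
    -- `F` is a nonarchimedean local field of characteristic zero and odd residue characteristic
    [Field F] [ValuativeRel F] [TopologicalSpace F] [IsNonarchimedeanLocalField F] [CharZero F]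
    (hp : ringChar 𝓀[F] ≠ 2)
    -- `E/F` is an unramified quadratic extension, `θ` generates its Galois group
    [Field E] [Algebra F E] (hE : Module.finrank F E = 2)
    (hunr : Algebra.FormallyUnramified 𝒪[F] (integralClosure 𝒪[F] E))
    (θ : E ≃ₐ[F] E) (hθ : θ ≠ 1)
    [Field Fbar] [Algebra F Fbar] [IsAlgClosure F Fbar]
    -- `ϖ` is a uniformizer, `ξ` a unit of the valuation ring of `E` of trace zero
    (ϖ : 𝒪[F]) (hϖ : Irreducible ϖ)
    (ξ : (integralClosure 𝒪[F] E)ˣ) (hξ : Algebra.trace F E ((ξ : integralClosure 𝒪[F] E) : E) = 0)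
    (γ : GL (Fin 3) E) (hγ : γ ∈ SymmSpace.symmPoints θ)
    (hreg : SymmSpace.IsRegularSemisimple γ) :
    (SymmSpace.IsTypeI θ γ ∨ SymmSpace.IsTypeII θ γ ∨ SymmSpace.IsTypeIII θ γ →
      ∃ ν ∈ ({1, ((ξ : integralClosure 𝒪[F] E) : E) ^ 2, algebraMap F E ϖ,
          ((ξ : integralClosure 𝒪[F] E) : E) ^ 2 * algebraMap F E ϖ} : Set E),
        (SymmSpace.stableClass θ Fbar γ ∩ SymmSpace.T θ ν).Nonempty) ∧
    (SymmSpace.IsTypeI θ γ →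
      SymmSpace.H1IsElementaryTwo (Fbar ≃ₐ[F] Fbar) (SymmSpace.stabilizer F γ Fbar) 2) ∧
    (SymmSpace.IsTypeII θ γ →
      SymmSpace.H1IsElementaryTwo (Fbar ≃ₐ[F] Fbar) (SymmSpace.stabilizer F γ Fbar) 4) ∧
    (SymmSpace.IsTypeIII θ γ →
      SymmSpace.H1IsElementaryTwo (Fbar ≃ₐ[F] Fbar) (SymmSpace.stabilizer F γ Fbar) 2) ∧
    (SymmSpace.IsTypeIV θ γ →
      (∀ c : SymmSpace.H1 (Fbar ≃ₐ[F] Fbar) (SymmSpace.stabilizer F γ Fbar), c = 1) ∧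
      SymmSpace.frakD (F := F) Fbar γ = {1} ∧
      SymmSpace.stableClass θ Fbar γ = SymmSpace.rationalOrbit θ γ) := by
  have hFbar : IsAlgClosed Fbar := IsAlgClosure.isAlgClosed F
  have : Algebra.IsAlgebraic F Fbar := IsAlgClosure.isAlgebraic
  have : IsGalois F Fbar := { }
  have : CharZero E := charZero_of_injective_algebraMap (algebraMap F E).injective
  have : FiniteDimensional F E := Module.finite_of_finrank_pos (by omega)
  let φ : E →ₐ[F] Fbar := IsAlgClosed.lift
  have hξ0 : ((ξ : integralClosure 𝒪[F] E) : E) ≠ 0 := fun h0 => ξ.ne_zero (Subtype.ext h0)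
  have h := isImaginary_of_trace_eq_zero hE hθ hξ0 hξ
  obtain ⟨c, τ, P, t, hc, hu, -, hτ, hP⟩ := exists_isCayley_isFrame h φ hγ hreg
  have hc0 : c ≠ 0 := right_ne_zero_of_mul_eq_one hc
  have hcard := hP.twoTorsionCard_centralizer h φ hc0 hτ
  -- The exponent m solves |G_γ(F)[2]|² = 4 · 2ᵐ; the orders 4, 8, 4, 2 of types I to IV give m = 2,
  -- 4, 2, 0.
  have hH1 : ∀ m, twoTorsionCard (centralizer θ γ F) ^ 2 = 4 * 2 ^ m →
      H1IsElementaryTwo (Fbar ≃ₐ[F] Fbar) (stabilizer F γ Fbar) m := fun m hm =>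
    hP.h1IsElementaryTwo hp (hτ.mem_stabilizer_iff hc0 h.ne_zero) m (hcard ▸ hm)
  refine ⟨fun hT => ?_, fun hT => hH1 2 ?_, fun hT => hH1 4 ?_, fun hT => hH1 2 ?_,
    fun hT => ?_⟩
  -- In types I, II and III there are more than two square roots of 1, so one of them differs from
  -- ±1.
  · have h2 : 2 < twoTorsionCard (torus τ) := by
      rw [← hcard]
      rcases hT with hT | hT | hT <;> rw [hT.twoTorsionCard_eq h] <;> norm_num
    obtain ⟨i, z, x, D, δ, hz, hx1, hx2, hδ, hD⟩ := hP.exists_rational_eigenvalue h2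
    obtain ⟨ν, f, rfl, hν⟩ := exists_eq_mul_sq hp hϖ ξ h hD
    exact ⟨_, hν, hτ.stableClass_inter_T_nonempty h φ hc hP i hz hx1 hx2 hδ⟩
  · rw [hT.twoTorsionCard_eq h]
    norm_num
  · rw [hT.twoTorsionCard_eq h]
    norm_num
  · rw [hT.twoTorsionCard_eq h]
    norm_num
  · have h1 := (hH1 0 (by rw [hT.twoTorsionCard_eq h]; norm_num)).eq_one
    refine ⟨h1, ?_, hτ.stableClass_eq_rationalOrbit h hc hu h1⟩
    exact Set.eq_singleton_iff_unique_mem.2 ⟨one_mem_frakD Fbar γ, fun x _ => h1 x⟩
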